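/- **Model.** Let $K\ge 2$, let $\pi^\star$ be a probability vector on $[K]$, $\mu^\star_1,\dots,\mu^\star_K\in\mathbb R^d$, $\Sigma^\star\in\mathbb R^{d\times d}$ positive definite, and $\mathbb Q$ a Borel probability measure on $\mathbb R^d$ with mean $0$ and $\int zz^\top d\mathbb Q=I_d$. A pair $(x,y^\star)$ follows the mixture model if $x=\mu^\star_{y^\star}+\Sigma^{\star1/2}z$ with $y^\star,z$ independent, $\mathbb P(y^\star=j)=\pi_j^\star$ and $z\sim\mathbb Q$. We say $\mathbb Q\in T_2(\sigma)$ if $W_2(\mathbb Q,\mathbb P')\le\sqrt{2\sigma^2D(\mathbb P'\|\mathbb Q)}$ for every Borel probability measure $\mathbb P'$ on $\mathbb R^d$ ($W_2$ the Wasserstein-2 distance, $D$ the Kullback–Leibler divergence). Put $\bar\mu^\star=\sum_j\pi^\star_j\mu^\star_j$ and $V^\star=\Sigma^{\star-1/2}(\mu_1^\star-\bar\mu^\star,\dots,\mu_K^\star-\bar\mu^\star)\in\mathbb R^{d\times K}$, and let $\sigma_{K-1}(V^\star)$ be its $(K-1)$-th largest singular value (zero if $d<K-1$). **Algorithm** (cross-validated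 whitened $k$-means, $n$ even). For a sample $u_1,\dots,u_m$ let $\bar u$ be its mean, $\widetilde\Sigma=\frac1m\sum_i(u_i-\bar u)(u_i-\bar u)^\top$, and $w(u)=\widetilde\Sigma^{-1/2}(u-\bar u)$ (with $\widetilde\Sigma^{-1/2}:=0$ if $\widetilde\Sigma$ is singular). Whitened $k$-means returns labels $\widehat s\in[K]^m$ minimizing $\sum_i\|w(u_i)-c_{s_i}(s)\|_2^2$ over $s\in[K]^m$, where $c_j(s)$ is the average of the $w(u_i)$ with $s_i=j$ ($0$ for an empty cluster), the centers $\widehat\mu_j=c_j(\widehat s)$, and the classifier $u\mapsto\operatorname{argmin}_{j\in[K]}\|w(u)-\widehat\mu_j\|_2$. Given $x_1,\dots,x_n$, run it separately on $\{x_i\}_{i\le n/2}$ and $\{x_i\}_{i>n/2}$; label each half by the classifier trained on the other half, getting $\widetilde y\in[K]^n$; choose a permutation $\widehat\tau$ of $[K]$ minimizing $|\{i\le n/2:\widehat s^{(1)}_i\ne\tau(\widetilde y_i)\}|$, where $\widehat s^{(1)}$ are the $k$-means labels of the first half; return $\widehat y=(\widehat\tau(\widetilde y_1),\dots,\widehat\tau(\widetilde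 y_{n/2}),\widetilde y_{n/2+1},\dots,\widetilde y_n)$. The optimal $k$-means solution of each half is chosen by any measurable function of that half; ties in classification and alignment are broken arbitrarily, with $\widehat y$ measurable. For $y^{(1)},y^{(2)}\in[K]^n$ let $\mathcal R(y^{(1)},y^{(2)})=n^{-1}\min_{\tau\in S_K}|\{i\in[n]:y_i^{(1)}\ne\tau(y^{(2)}_i)\}|$. **Theorem.** For all $\sigma>0$, $K_0\in\mathbb N$ and $p>0$ there are constants $c,C>0$, depending only on $\sigma,K_0,p$, such that the following holds. For every even $n$ let $(x_i,y_i^\star)_{i=1}^n$ be i.i.d. from a mixture model with parameters $d=d_n$, $K=K_n$, $\pi^\star,\mu^\star,\Sigma^\star,\mathbb Q$ that may depend on $n$, such that $\mathbb Q\in T_2(\sigma)$, $2\le K\le K_0$, $\min_j\pi^\star_j\ge p$, and $\sigma_{K-1}(V^\star)\ge R_n>0$. Assume $R_n\to\infty$ and $n/(d_n\log^2n)\to\infty$, and let $\widehat y$ be the output of the algorithm. Then there is $N$ such that for all even $n>N$ $$\mathbb E\,\mathcal R(\widehat y,y^\star)\le C\big(e^{-cR_n^2}+n^{-10}\big).$$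 Moreover: 1. if $R_n\le\sqrt{c^{-1}\log n}$ for all large $n$, then $\mathbb E\,\mathcal R(\widehat y,y^\star)\le C e^{-cR_n^2}$ for all large even $n$; 2. if, for some $\varepsilon>0$, $R_n\ge\sqrt{(1+\varepsilon)c^{-1}\log n}$ for all large $n$, then $\mathbb P[\mathcal R(\widehat y,y^\star)=0]\to1$ as $n\to\infty$ along even $n$. -/

import Mathlib

open MeasureTheory ProbabilityTheory Filter Topology
open scoped ENNReal MatrixOrder Matrix.Norms.L2Operator

noncomputable section

/-- `d`-dimensional Euclidean space. -/
abbrev EucSp (d : ℕ) : Type := EuclideanSpace ℝ (Fin d)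

/-! ## Transportation-cost inequality -/

/-- The Wasserstein-2 distance: the infimum over all couplings `γ` of `μ` and `ν` of
`(∫ ‖u - v‖² dγ(u, v)) ^ (1 / 2)`, with values in `[0, ∞]`. -/
def wasserstein2 {d : ℕ} (μ ν : Measure (EucSp d)) : ℝ≥0∞ :=
  ⨅ (γ : Measure (EucSp d × EucSp d)) (_ : γ.map Prod.fst = μ ∧ γ.map Prod.snd = ν),
    (∫⁻ p, ‖p.1 - p.2‖ₑ ^ 2 ∂γ) ^ (1 / 2 : ℝ)

/-- The class `T₂(σ)`: `W₂(μ, ν) ≤ √(2 σ² D(ν ‖ μ))` for every Borel probability measure `ν`,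
where `D` is the Kullback-Leibler divergence. -/
def IsT2 {d : ℕ} (σ : ℝ) (μ : Measure (EucSp d)) : Prop :=
  ∀ ν : Measure (EucSp d), IsProbabilityMeasure ν →
    wasserstein2 μ ν ≤
      (ENNReal.ofReal (2 * σ ^ 2) * InformationTheory.klDiv ν μ) ^ (1 / 2 : ℝ)

/-! ## Mixture model -/

/-- Parameters `(π, M, Σ, Q)` of a `K`-component mixture model in dimension `d`:
the weights `π` form a probability vector, the columns of `M` are the class centers, `Σ` is positive
semi-definite, and `Q` is a zero-mean isotropic (`E z zᵀ = I`) probability distribution. -/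
structure MixtureModel (d K : ℕ) where
  weight : Fin K → ℝ
  weight_nonneg : ∀ j, 0 ≤ weight j
  weight_sum : ∑ j, weight j = 1
  center : Fin K → EucSp d
  cov : Matrix (Fin d) (Fin d) ℝ
  cov_posSemidef : cov.PosSemidef
  noise : Measure (EucSp d)
  noise_prob : IsProbabilityMeasure noise
  noise_memLp : MemLp (fun z : EucSp d => z) 2 noise
  noise_mean : ∀ a : Fin d, ∫ z, z a ∂noise = 0
  noise_isotropic : ∀ a b : Fin d, ∫ z, z a * z b ∂noise = if a = b then 1 else 0

/-- The random labels `y i` and random vectors `x i` (`i < n`) are i.i.d. pairs from the mixture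
model `θ`: `x i = μ_{y i} + Σ^{1/2} z i` with `y i`, `z i` independent, `y i` of law `π`, `z i` of
law `Q`, and the pairs `(y i, z i)` independent over `i`. -/
def IsMixtureSample {d K n : ℕ} {Ω : Type*} [MeasurableSpace Ω] (θ : MixtureModel d K)
    (P : Measure Ω) (y : Fin n → Ω → Fin K) (x : Fin n → Ω → EucSp d) : Prop :=
  ∃ z : Fin n → Ω → EucSp d,
    (∀ i, Measurable (y i)) ∧
    (∀ i, Measurable (z i)) ∧
    iIndepFun (fun i ω => (y i ω, z i ω)) P ∧
    (∀ i, IndepFun (y i) (z i) P) ∧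
    (∀ i j, P.real {ω | y i ω = j} = θ.weight j) ∧
    (∀ i, P.map (z i) = θ.noise) ∧
    (∀ i ω, x i ω =
      θ.center (y i ω) + Matrix.toEuclideanCLM (𝕜 := ℝ) (CFC.sqrt θ.cov) (z i ω))

/-- `A^{-1/2}` for a positive definite matrix `A` (the zero matrix when `A` is singular). -/
def invSqrt {d : ℕ} (A : Matrix (Fin d) (Fin d) ℝ) : Matrix (Fin d) (Fin d) ℝ :=
  (CFC.sqrt A)⁻¹

/-- The overall mean `μ̄ = ∑ j, π_j μ_j`. -/
def MixtureModel.meanCenter {d K : ℕ} (θ : MixtureModel d K) : EucSp d :=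
  ∑ j, θ.weight j • θ.center j

/-- The `d × K` matrix `V = Σ^{-1/2} (μ_1 - μ̄, …, μ_K - μ̄)`. -/
def MixtureModel.signalMatrix {d K : ℕ} (θ : MixtureModel d K) : Matrix (Fin d) (Fin K) ℝ :=
  Matrix.of fun a j =>
    Matrix.toEuclideanCLM (𝕜 := ℝ) (invSqrt θ.cov) (θ.center j - θ.meanCenter) a

/-- Signal strength: `Σ` is positive definite and the `(K - 1)`-th largest singular value of `V` is
at least `R > 0`. Mathlib numbers singular values from `0`, so that one has index `K - 2`; the
notion is used for `K ≥ 2` only. -/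
def MixtureModel.SignalStrength {d K : ℕ} (θ : MixtureModel d K) (R : ℝ) : Prop :=
  θ.cov.PosDef ∧ 0 < R ∧
    R ≤ (Matrix.toLpLin 2 2 θ.signalMatrix).singularValues (K - 2)

/-! ## Whitened `k`-means -/

section Algorithm

variable {d K m : ℕ}

/-- The sample mean `x̄`. -/
def sampleMean (x : Fin m → EucSp d) : EucSp d := (m : ℝ)⁻¹ • ∑ i, x i

/-- The sample covariance matrix, with normalization `1 / m`. -/
def sampleCov (x : Fin m → EucSp d) : Matrix (Fin d) (Fin d) ℝ :=
  Matrix.of fun a b =>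
    (m : ℝ)⁻¹ * ∑ i, (x i a - sampleMean x a) * (x i b - sampleMean x b)

/-- Whitening of a point `u` by the sample `x`: `Σ̃^{-1/2} (u - x̄)`. -/
def whiten (x : Fin m → EucSp d) (u : EucSp d) : EucSp d :=
  Matrix.toEuclideanCLM (𝕜 := ℝ) (invSqrt (sampleCov x)) (u - sampleMean x)

/-- The mean of the points `w i` with label `j` (zero for an empty cluster). -/
def clusterMean (w : Fin m → EucSp d) (s : Fin m → Fin K) (j : Fin K) : EucSp d :=
  ((Finset.univ.filter fun i => s i = j).card : ℝ)⁻¹ •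
    ∑ i ∈ Finset.univ.filter (fun i => s i = j), w i

/-- The `k`-means objective of the label vector `s` on the points `w`. -/
def kmeansLoss (w : Fin m → EucSp d) (s : Fin m → Fin K) : ℝ :=
  ∑ i, ‖w i - clusterMean w s (s i)‖ ^ 2

/-- `s` is an optimal solution of the `k`-means program on the whitened sample. -/
def IsWhitenedKMeans (x : Fin m → EucSp d) (s : Fin m → Fin K) : Prop :=
  ∀ s' : Fin m → Fin K,
    kmeansLoss (fun i => whiten x (x i)) s ≤ kmeansLoss (fun i => whiten x (x i)) s'

/-- The class centers `μ̂_j` of the whitened sample `x` with labels `s`. -/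
def whitenedCenter (x : Fin m → EucSp d) (s : Fin m → Fin K) (j : Fin K) : EucSp d :=
  clusterMean (fun i => whiten x (x i)) s j

/-- The label `j` is a value at `u` of the classifier trained on the sample `x` with labels `s`:
`j` minimizes `‖Σ̃^{-1/2} (u - x̄) - μ̂_j‖`. -/
def IsPredictedLabel (x : Fin m → EucSp d) (s : Fin m → Fin K) (u : EucSp d) (j : Fin K) : Prop :=
  ∀ k : Fin K, ‖whiten x u - whitenedCenter x s j‖ ≤ ‖whiten x u - whitenedCenter x s k‖

/-- The permutation `τ` minimizes `#{i | y₁ i ≠ τ (y₂ i)}`. -/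
def IsAlignment (y₁ y₂ : Fin m → Fin K) (τ : Equiv.Perm (Fin K)) : Prop :=
  ∀ τ' : Equiv.Perm (Fin K),
    hammingDist y₁ (fun i => τ (y₂ i)) ≤ hammingDist y₁ (fun i => τ' (y₂ i))

/-- The first half of a sample of size `m + m`. -/
def firstHalf (x : Fin (m + m) → EucSp d) : Fin m → EucSp d := fun i => x (Fin.castAdd m i)

/-- The second half of a sample of size `m + m`. -/
def secondHalf (x : Fin (m + m) → EucSp d) : Fin m → EucSp d := fun i => x (Fin.natAdd m i)

/-- A `k`-means solver: a measurable map that sends each sample of size `m` to an optimal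
solution of the whitened `k`-means program. -/
def IsWhitenedKMeansSolver (solver : (Fin m → EucSp d) → Fin m → Fin K) : Prop :=
  Measurable solver ∧ ∀ x, IsWhitenedKMeans x (solver x)

/-- `yhat` is an output of cross-validated whitened `k`-means on the data `x`, when the clustering
step is carried out by `solver₁` on the first half and by `solver₂` on the second half: each half
is labelled by the classifier trained on the other half, and the predicted labels of the first
half are then aligned with the `k`-means labels of that half. Ties in the classification and the
alignment steps may be broken in any way. -/
def IsCVKMeansOutput (solver₁ solver₂ : (Fin m → EucSp d) → Fin m → Fin K)
    (x : Fin (m + m) → EucSp d) (yhat : Fin (m + m) → Fin K) : Prop :=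
  ∃ (ytilde₁ ytilde₂ : Fin m → Fin K) (τ : Equiv.Perm (Fin K)),
    (∀ i, IsPredictedLabel (secondHalf x) (solver₂ (secondHalf x)) (firstHalf x i) (ytilde₁ i)) ∧
    (∀ i, IsPredictedLabel (firstHalf x) (solver₁ (firstHalf x)) (secondHalf x i) (ytilde₂ i)) ∧
    IsAlignment (solver₁ (firstHalf x)) ytilde₁ τ ∧
    yhat = Fin.append (fun i => τ (ytilde₁ i)) ytilde₂

/-- The misclassification error `n⁻¹ min_τ #{i | y₁ i ≠ τ (y₂ i)}` over permutations `τ`. -/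
def misclassError {n : ℕ} (y₁ y₂ : Fin n → Fin K) : ℝ :=
  (n : ℝ)⁻¹ * ⨅ τ : Equiv.Perm (Fin K), (hammingDist y₁ (fun i => τ (y₂ i)) : ℝ)

end Algorithm

end

/-! ## Consequences of the transportation-cost inequality -/

section Transport

variable {d : ℕ} {σ : ℝ} {μ ν : Measure (EucSp d)}

theorem klFun_le_sub_one_sq {x : ℝ} (hx : 0 ≤ x) : InformationTheory.klFun x ≤ (x - 1) ^ 2 := by
  rw [InformationTheory.klFun_apply]
  rcases hx.eq_or_lt with rfl | hx
  · norm_num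
  · nlinarith [mul_le_mul_of_nonneg_left (Real.log_le_sub_one_of_pos hx) hx.le]

theorem klDiv_withDensity_ofReal {α : Type*} [MeasurableSpace α] {μ : Measure α}
    [IsProbabilityMeasure μ] {g : α → ℝ} (hg : Measurable g) (hg0 : ∀ x, 0 ≤ g x)
    [IsFiniteMeasure (μ.withDensity fun x => ENNReal.ofReal (g x))] :
    InformationTheory.klDiv (μ.withDensity fun x => ENNReal.ofReal (g x)) μ =
      ∫⁻ x, ENNReal.ofReal (InformationTheory.klFun (g x)) ∂μ := by
  rw [InformationTheory.klDiv_eq_lintegral_klFun_of_ac (withDensity_absolutelyContinuous _ _)]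
  refine lintegral_congr_ae ?_
  filter_upwards [Measure.rnDeriv_withDensity μ (f := fun x => ENNReal.ofReal (g x))
    (by fun_prop)] with x hx
  rw [hx, ENNReal.toReal_ofReal (hg0 x)]

theorem isProbabilityMeasure_withDensity_ofReal {α : Type*} [MeasurableSpace α] {μ : Measure α}
    {g : α → ℝ} (hg : Integrable g μ) (hg0 : ∀ x, 0 ≤ g x)
    (h1 : ∫ x, g x ∂μ = 1) :
    IsProbabilityMeasure (μ.withDensity fun x => ENNReal.ofReal (g x)) := by
  constructor
  rw [withDensity_apply _ MeasurableSet.univ, Measure.restrict_univ,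
    ← ofReal_integral_eq_lintegral_ofReal hg (ae_of_all _ hg0), h1, ENNReal.ofReal_one]

theorem integral_withDensity_ofReal {α : Type*} [MeasurableSpace α] {μ : Measure α}
    {g : α → ℝ} (hg : Measurable g) (hg0 : ∀ x, 0 ≤ g x) (f : α → ℝ) :
    ∫ x, f x ∂(μ.withDensity fun x => ENNReal.ofReal (g x)) = ∫ x, g x * f x ∂μ := by
  rw [integral_withDensity_eq_integral_toReal_smul (by fun_prop) (by simp)]
  refine integral_congr_ae (ae_of_all _ fun x => ?_)
  simp [ENNReal.toReal_ofReal (hg0 x)]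

theorem integrable_withDensity_ofReal {α : Type*} [MeasurableSpace α] {μ : Measure α}
    {g : α → ℝ} (hg : Measurable g) (hg0 : ∀ x, 0 ≤ g x) {M : ℝ} (hM : ∀ x, g x ≤ M)
    {f : α → ℝ} (hf : Integrable f μ) :
    Integrable f (μ.withDensity fun x => ENNReal.ofReal (g x)) := by
  rw [integrable_withDensity_iff_integrable_smul' (by fun_prop) (by simp)]
  refine (hf.bdd_mul (c := M) (f := fun x => g x) hg.aestronglyMeasurable ?_).congr ?_
  · refine ae_of_all _ fun x => ?_
    rw [Real.norm_of_nonneg (hg0 x)]; exact hM x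
  · refine ae_of_all _ fun x => ?_
    simp [ENNReal.toReal_ofReal (hg0 x)]

theorem IsT2.exists_coupling (h : IsT2 σ μ) [IsProbabilityMeasure ν] {D B : ℝ}
    (hkl : InformationTheory.klDiv ν μ ≤ ENNReal.ofReal D) (hB : 2 * σ ^ 2 * D < B) (hB0 : 0 < B) :
    ∃ γ : Measure (EucSp d × EucSp d), γ.map Prod.fst = μ ∧ γ.map Prod.snd = ν ∧
      ∫⁻ p, ‖p.1 - p.2‖ₑ ^ 2 ∂γ < ENNReal.ofReal B := by
  have h1 : wasserstein2 μ ν < ENNReal.ofReal B ^ (1 / 2 : ℝ) := by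
    refine (h ν inferInstance).trans_lt ?_
    refine ENNReal.rpow_lt_rpow ?_ (by norm_num)
    calc ENNReal.ofReal (2 * σ ^ 2) * InformationTheory.klDiv ν μ
        ≤ ENNReal.ofReal (2 * σ ^ 2) * ENNReal.ofReal D := by gcongr
      _ = ENNReal.ofReal (2 * σ ^ 2 * D) := (ENNReal.ofReal_mul (by positivity)).symm
      _ < ENNReal.ofReal B := (ENNReal.ofReal_lt_ofReal_iff hB0).2 hB
  rw [wasserstein2] at h1
  simp only [iInf_lt_iff] at h1
  obtain ⟨γ, ⟨h2, h3⟩, h4⟩ := h1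
  exact ⟨γ, h2, h3, (ENNReal.rpow_lt_rpow_iff (by norm_num)).1 h4⟩

/-- Kantorovich duality (easy direction) for a quadratic cost, combined with `T₂(σ)`. -/
theorem IsT2.integral_sub_integral_le (h : IsT2 σ μ) [IsProbabilityMeasure ν] {D a : ℝ}
    (hD : 0 ≤ D) (ha : 0 ≤ a)
    (hkl : InformationTheory.klDiv ν μ ≤ ENNReal.ofReal D) {φ ψ : EucSp d → ℝ}
    (hφ : Integrable φ μ) (hψ : Integrable ψ ν)
    (hle : ∀ u v, ψ v - φ u ≤ a * ‖u - v‖ ^ 2) :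
    ∫ v, ψ v ∂ν - ∫ u, φ u ∂μ ≤ a * (2 * σ ^ 2 * D) := by
  have key : ∀ B : ℝ, 2 * σ ^ 2 * D < B → ∫ v, ψ v ∂ν - ∫ u, φ u ∂μ ≤ a * B := by
    intro B hB
    have hB0 : 0 < B := lt_of_le_of_lt (by positivity) hB
    obtain ⟨γ, rfl, rfl, h3⟩ := h.exists_coupling hkl hB hB0
    have hnorm : ∀ p : EucSp d × EucSp d, ‖p.1 - p.2‖ₑ ^ 2 = ENNReal.ofReal (‖p.1 - p.2‖ ^ 2) := by
      intro p
      rw [← ofReal_norm, ENNReal.ofReal_pow (norm_nonneg _)]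
    simp_rw [hnorm] at h3
    have hint : Integrable (fun p : EucSp d × EucSp d => ‖p.1 - p.2‖ ^ 2) γ := by
      refine ⟨by fun_prop, ?_⟩
      rw [hasFiniteIntegral_iff_ofReal (ae_of_all _ fun p => by positivity)]
      exact h3.trans ENNReal.ofReal_lt_top
    have hval : ∫ p, ‖p.1 - p.2‖ ^ 2 ∂γ ≤ B := by
      rw [← ofReal_integral_eq_lintegral_ofReal hint (ae_of_all _ fun p => by positivity),
        ENNReal.ofReal_lt_ofReal_iff hB0] at h3
      exact h3.le
    have hψ' : Integrable (fun p : EucSp d × EucSp d => ψ p.2) γ := hψ.comp_measurable measurable_snd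
    have hφ' : Integrable (fun p : EucSp d × EucSp d => φ p.1) γ := hφ.comp_measurable measurable_fst
    rw [integral_map (by fun_prop) hψ.1, integral_map (by fun_prop) hφ.1, ← integral_sub hψ' hφ']
    calc ∫ p, ψ p.2 - φ p.1 ∂γ ≤ ∫ p, a * ‖p.1 - p.2‖ ^ 2 ∂γ :=
          integral_mono (hψ'.sub hφ') (hint.const_mul a) fun p => hle _ _
      _ = a * ∫ p, ‖p.1 - p.2‖ ^ 2 ∂γ := integral_const_mul _ _
      _ ≤ a * B := by gcongr
  refine le_of_forall_pos_le_add fun e he => ?_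
  have := key (2 * σ ^ 2 * D + e / (a + 1)) (by linarith [div_pos he (by linarith : 0 < a + 1)])
  have h2 : a * (e / (a + 1)) ≤ e := by
    rw [mul_div_assoc', div_le_iff₀ (by linarith)]; nlinarith
  nlinarith

theorem IsT2.measureReal_le_inner_le (h : IsT2 σ μ) [IsProbabilityMeasure μ] {b : EucSp d}
    (hint : Integrable (fun z => inner ℝ b z) μ) (hmean : ∫ z, inner ℝ b z ∂μ = 0)
    {t : ℝ} (ht : 0 < t) :
    μ.real {z | t ≤ inner ℝ b z} ≤ Real.exp (-(t ^ 2 / (2 * σ ^ 2 * ‖b‖ ^ 2))) := by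
  set A : Set (EucSp d) := {z | t ≤ inner ℝ b z} with hA
  have hAm : MeasurableSet A := measurableSet_le measurable_const (by fun_prop)
  set m := μ.real A with hm
  rcases (measureReal_nonneg : 0 ≤ μ.real A).eq_or_lt with h0 | hpos
  · rw [hm, ← h0]; positivity
  rw [← hm] at hpos
  have hm1 : m ≤ 1 := measureReal_le_one
  set g : EucSp d → ℝ := A.indicator fun _ => m⁻¹ with hgdef
  have hgm : Measurable g := measurable_const.indicator hAm
  have hg0 : ∀ x, 0 ≤ g x := fun x => Set.indicator_nonneg (fun _ _ => by positivity) _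
  have hgM : ∀ x, g x ≤ m⁻¹ := fun x => Set.indicator_le_self' (fun _ _ => by positivity) _
  have hgi : Integrable g μ := (integrable_const _).indicator hAm
  have hg1 : ∫ x, g x ∂μ = 1 := by
    rw [hgdef, integral_indicator_const _ hAm, smul_eq_mul, ← hm, mul_inv_cancel₀ hpos.ne']
  have := isProbabilityMeasure_withDensity_ofReal hgi hg0 hg1
  have hkl : InformationTheory.klDiv (μ.withDensity fun x => ENNReal.ofReal (g x)) μ ≤
      ENNReal.ofReal (-Real.log m) := by
    rw [klDiv_withDensity_ofReal hgm hg0]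
    have hfun : (fun x => InformationTheory.klFun (g x)) =
        fun x => g x * (-Real.log m) + (1 - g x) := by
      funext x
      rw [InformationTheory.klFun_apply]
      by_cases hx : x ∈ A
      · simp [hgdef, hx, Real.log_inv]; ring
      · simp [hgdef, hx]
    have hi1 : Integrable (fun x => g x * (-Real.log m)) μ := hgi.mul_const _
    have hi2 : Integrable (fun x => 1 - g x) μ := (integrable_const _).sub hgi
    have hi : Integrable (fun x => InformationTheory.klFun (g x)) μ := by
      rw [hfun]; exact hi1.add hi2
    rw [← ofReal_integral_eq_lintegral_ofReal hi
      (ae_of_all _ fun x => InformationTheory.klFun_nonneg (hg0 x)), hfun,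
      integral_add hi1 hi2, integral_mul_const,
      integral_sub (integrable_const _) hgi, hg1]
    simp
  have hD : 0 ≤ -Real.log m := by
    have := Real.log_nonpos hpos.le hm1; linarith
  have hmain := h.integral_sub_integral_le (ψ := fun v => inner ℝ b v)
    (φ := fun u => inner ℝ b u + t / 2) (a := ‖b‖ ^ 2 / (2 * t)) hD (by positivity) hkl
    (hint.add (integrable_const _))
    (integrable_withDensity_ofReal hgm hg0 hgM hint) (by
      intro u v
      have h1 : inner ℝ b v - inner ℝ b u ≤ ‖b‖ * ‖u - v‖ := by
        rw [← inner_sub_right, norm_sub_rev]; exact real_inner_le_norm _ _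
      have h2 : ‖b‖ * ‖u - v‖ ≤ t / 2 + ‖b‖ ^ 2 / (2 * t) * ‖u - v‖ ^ 2 := by
        have : t / 2 + ‖b‖ ^ 2 / (2 * t) * ‖u - v‖ ^ 2 - ‖b‖ * ‖u - v‖
          = (t - ‖b‖ * ‖u - v‖) ^ 2 / (2 * t) := by field_simp; ring
        have h3 : 0 ≤ (t - ‖b‖ * ‖u - v‖) ^ 2 / (2 * t) := by positivity
        linarith
      linarith)
  rw [integral_withDensity_ofReal hgm hg0, integral_add hint (integrable_const _), hmean] at hmain
  have hge : t ≤ ∫ x, g x * inner ℝ b x ∂μ := by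
    calc t = ∫ x, g x * t ∂μ := by rw [integral_mul_const, hg1, one_mul]
      _ ≤ _ := by
        refine integral_mono (hgi.mul_const _) (hint.bdd_mul (c := m⁻¹)
          hgm.aestronglyMeasurable (ae_of_all _ fun x => ?_)) fun x => ?_
        · rw [Real.norm_of_nonneg (hg0 x)]; exact hgM x
        · by_cases hx : x ∈ A
          · exact mul_le_mul_of_nonneg_left hx (hg0 x)
          · simp [hgdef, hx]
  simp only [integral_const, probReal_univ, smul_eq_mul, one_mul, zero_add] at hmain
  rcases (by positivity : 0 ≤ 2 * σ ^ 2 * ‖b‖ ^ 2).eq_or_lt with h0 | hs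
  · rw [← h0]; simpa using hm1
  rw [← Real.log_le_iff_le_exp hpos]
  rw [le_neg, div_le_iff₀ hs]
  have h5 : t / 2 ≤ ‖b‖ ^ 2 / (2 * t) * (2 * σ ^ 2 * -Real.log m) := by linarith
  rw [div_mul_eq_mul_div, le_div_iff₀ (by positivity)] at h5
  nlinarith

theorem IsT2.measureReal_le_abs_inner_le (h : IsT2 σ μ) [IsProbabilityMeasure μ] {b : EucSp d}
    (hint : Integrable (fun z => inner ℝ b z) μ) (hmean : ∫ z, inner ℝ b z ∂μ = 0)
    {t : ℝ} (ht : 0 < t) :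
    μ.real {z | t ≤ |inner ℝ b z|} ≤ 2 * Real.exp (-(t ^ 2 / (2 * σ ^ 2 * ‖b‖ ^ 2))) := by
  have h1 := h.measureReal_le_inner_le hint hmean ht
  have h2 := h.measureReal_le_inner_le (b := -b) (by simpa using hint.neg)
    (by simp [integral_neg, hmean]) ht
  rw [norm_neg] at h2
  have hsub : {z : EucSp d | t ≤ |inner ℝ b z|} ⊆
      {z | t ≤ inner ℝ b z} ∪ {z | t ≤ inner ℝ (-b) z} := by
    intro z hz
    simp only [Set.mem_union, Set.mem_ofPred_eq, inner_neg_left] at hz ⊢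
    exact le_abs.1 hz
  calc _ ≤ μ.real ({z | t ≤ inner ℝ b z} ∪ {z | t ≤ inner ℝ (-b) z}) := measureReal_mono hsub
    _ ≤ _ := measureReal_union_le _ _
    _ ≤ _ := by linarith

end Transport

section Moments

variable {d : ℕ} {σ : ℝ} {μ ν : Measure (EucSp d)}

theorem IsT2.lintegral_exp_inner_sq_le (h : IsT2 σ μ) (hσ : 0 < σ) [IsProbabilityMeasure μ]
    {e : EucSp d} (he : ‖e‖ = 1) (hint : Integrable (fun z => inner ℝ e z) μ)
    (hmean : ∫ z, inner ℝ e z ∂μ = 0) :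
    ∫⁻ z, ENNReal.ofReal (Real.exp ((inner ℝ e z) ^ 2 / (4 * σ ^ 2))) ∂μ ≤ 3 := by
  set l : ℝ := 1 / (4 * σ ^ 2) with hl
  have hl0 : 0 < l := by positivity
  have hint1 : ∀ x : ℝ, ∫ t in (0 : ℝ)..x, l * Real.exp (l * t) = Real.exp (l * x) - 1 := by
    intro x
    have : ∀ t ∈ Set.uIcc 0 x, HasDerivAt (fun t => Real.exp (l * t)) (l * Real.exp (l * t)) t := by
      intro t _
      have h1 : HasDerivAt (fun t => l * t) l t := by simpa using (hasDerivAt_id t).const_mul l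
      simpa [mul_comm] using h1.exp
    rw [intervalIntegral.integral_eq_sub_of_hasDerivAt this
      (Continuous.intervalIntegrable (by fun_prop) _ _)]
    simp
  have hlc := lintegral_comp_eq_lintegral_meas_le_mul μ (f := fun z => (inner ℝ e z) ^ 2)
    (g := fun t => l * Real.exp (l * t)) (ae_of_all _ fun z => by positivity)
    (by fun_prop) (fun t _ => Continuous.intervalIntegrable (by fun_prop) _ _)
    (ae_of_all _ fun t => by positivity)
  simp_rw [hint1] at hlc
  have htail : ∫⁻ t in Set.Ioi (0 : ℝ), μ {z | t ≤ (inner ℝ e z) ^ 2} *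
      ENNReal.ofReal (l * Real.exp (l * t)) ≤ 2 := by
    calc _ ≤ ∫⁻ t in Set.Ioi (0 : ℝ), ENNReal.ofReal (2 * l * Real.exp (-l * t)) := by
          refine setLIntegral_mono (by fun_prop) fun t ht => ?_
          have ht0 : 0 < t := ht
          have h1 := h.measureReal_le_abs_inner_le hint hmean (Real.sqrt_pos.2 ht0)
          have hset : {z : EucSp d | √t ≤ |inner ℝ e z|} = {z | t ≤ (inner ℝ e z) ^ 2} := by
            ext z
            simp only [Set.mem_ofPred_eq]
            rw [← sq_abs (inner ℝ e z), Real.sqrt_le_left (abs_nonneg _)]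
          rw [hset, he, Real.sq_sqrt ht0.le] at h1
          rw [← ofReal_measureReal, ← ENNReal.ofReal_mul measureReal_nonneg]
          refine ENNReal.ofReal_le_ofReal ?_
          calc _ ≤ 2 * Real.exp (-(t / (2 * σ ^ 2 * 1 ^ 2))) * (l * Real.exp (l * t)) := by gcongr
            _ = 2 * l * (Real.exp (-(t / (2 * σ ^ 2 * 1 ^ 2))) * Real.exp (l * t)) := by ring
            _ = _ := by
              rw [← Real.exp_add]
              congr 2
              rw [hl]; field_simp; ring
      _ = ENNReal.ofReal (∫ t in Set.Ioi (0 : ℝ), 2 * l * Real.exp (-l * t)) := by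
          rw [ofReal_integral_eq_lintegral_ofReal]
          · exact (integrableOn_exp_mul_Ioi (by linarith) 0).const_mul _
          · exact ae_of_all _ fun t => by positivity
      _ = 2 := by
          rw [integral_const_mul, integral_exp_mul_Ioi (by linarith) 0]
          simp only [mul_zero, Real.exp_zero]
          rw [show 2 * l * (-1 / -l) = 2 by field_simp]
          simp
  have heq : ∀ z : EucSp d, ENNReal.ofReal (Real.exp ((inner ℝ e z) ^ 2 / (4 * σ ^ 2))) =
      ENNReal.ofReal (Real.exp (l * (inner ℝ e z) ^ 2) - 1) + 1 := by
    intro z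
    have h0 : 0 ≤ Real.exp (l * (inner ℝ e z) ^ 2) - 1 := by
      have := Real.one_le_exp (x := l * (inner ℝ e z) ^ 2) (by positivity)
      linarith
    rw [← ENNReal.ofReal_one, ← ENNReal.ofReal_add h0 zero_le_one, hl]
    congr 1
    rw [sub_add_cancel]; congr 1; ring
  simp_rw [heq]
  rw [lintegral_add_right _ measurable_const, hlc]
  calc _ ≤ (2 : ℝ≥0∞) + 1 := by
        gcongr; simp
    _ = 3 := by norm_num

theorem IsT2.integrable_exp_inner_sq (h : IsT2 σ μ) (hσ : 0 < σ) [IsProbabilityMeasure μ]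
    {e : EucSp d} (he : ‖e‖ = 1) (hint : Integrable (fun z => inner ℝ e z) μ)
    (hmean : ∫ z, inner ℝ e z ∂μ = 0) :
    Integrable (fun z => Real.exp ((inner ℝ e z) ^ 2 / (4 * σ ^ 2))) μ := by
  refine ⟨by fun_prop, ?_⟩
  rw [hasFiniteIntegral_iff_ofReal (ae_of_all _ fun p => by positivity)]
  exact (h.lintegral_exp_inner_sq_le hσ he hint hmean).trans_lt (by simp)

theorem IsT2.integral_exp_inner_sq_le (h : IsT2 σ μ) (hσ : 0 < σ) [IsProbabilityMeasure μ]
    {e : EucSp d} (he : ‖e‖ = 1) (hint : Integrable (fun z => inner ℝ e z) μ)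
    (hmean : ∫ z, inner ℝ e z ∂μ = 0) :
    ∫ z, Real.exp ((inner ℝ e z) ^ 2 / (4 * σ ^ 2)) ∂μ ≤ 3 := by
  have h1 := h.lintegral_exp_inner_sq_le hσ he hint hmean
  rw [← ofReal_integral_eq_lintegral_ofReal (h.integrable_exp_inner_sq hσ he hint hmean)
    (ae_of_all _ fun p => by positivity)] at h1
  rw [show (3 : ℝ≥0∞) = ENNReal.ofReal 3 by simp] at h1
  exact (ENNReal.ofReal_le_ofReal_iff (by norm_num)).1 h1

theorem pow_four_le_exp_sq (hσ : 0 < σ) (x : ℝ) :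
    x ^ 4 ≤ 32 * σ ^ 4 * Real.exp (x ^ 2 / (4 * σ ^ 2)) := by
  have h1 := Real.quadratic_le_exp_of_nonneg (x := x ^ 2 / (4 * σ ^ 2)) (by positivity)
  have h2 : 0 ≤ x ^ 2 / (4 * σ ^ 2) := by positivity
  have h3 : x ^ 4 = 32 * σ ^ 4 * ((x ^ 2 / (4 * σ ^ 2)) ^ 2 / 2) := by field_simp; ring
  calc x ^ 4 = 32 * σ ^ 4 * ((x ^ 2 / (4 * σ ^ 2)) ^ 2 / 2) := h3
    _ ≤ _ := by gcongr; linarith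

theorem IsT2.integrable_inner_pow_four (h : IsT2 σ μ) (hσ : 0 < σ) [IsProbabilityMeasure μ]
    {e : EucSp d} (he : ‖e‖ = 1) (hint : Integrable (fun z => inner ℝ e z) μ)
    (hmean : ∫ z, inner ℝ e z ∂μ = 0) :
    Integrable (fun z => (inner ℝ e z) ^ 4) μ := by
  refine ((h.integrable_exp_inner_sq hσ he hint hmean).const_mul (32 * σ ^ 4)).mono'
    (by fun_prop) (ae_of_all _ fun z => ?_)
  rw [Real.norm_of_nonneg (by positivity)]
  exact pow_four_le_exp_sq hσ _

theorem IsT2.integral_inner_pow_four_le (h : IsT2 σ μ) (hσ : 0 < σ) [IsProbabilityMeasure μ]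
    {e : EucSp d} (he : ‖e‖ = 1) (hint : Integrable (fun z => inner ℝ e z) μ)
    (hmean : ∫ z, inner ℝ e z ∂μ = 0) :
    ∫ z, (inner ℝ e z) ^ 4 ∂μ ≤ 96 * σ ^ 4 := by
  calc _ ≤ ∫ z, 32 * σ ^ 4 * Real.exp ((inner ℝ e z) ^ 2 / (4 * σ ^ 2)) ∂μ :=
        integral_mono (h.integrable_inner_pow_four hσ he hint hmean)
          ((h.integrable_exp_inner_sq hσ he hint hmean).const_mul _)
          fun z => pow_four_le_exp_sq hσ _
    _ ≤ 32 * σ ^ 4 * 3 := by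
        rw [integral_const_mul]
        have := h.integral_exp_inner_sq_le hσ he hint hmean
        gcongr
    _ = _ := by ring

/-- A piecewise linear step from `0` to `1` across the interval `[1/3, 2/3]`. -/
def stepFun (s : ℝ) : ℝ := max 0 (min 1 (3 * s - 1))

theorem continuous_stepFun : Continuous stepFun := by unfold stepFun; fun_prop

theorem stepFun_nonneg (s : ℝ) : 0 ≤ stepFun s := le_max_left _ _

theorem stepFun_le_one (s : ℝ) : stepFun s ≤ 1 := max_le zero_le_one (min_le_left _ _)

theorem sub_stepFun_sq_le (s : ℝ) : (s - stepFun s) ^ 2 ≤ min (s ^ 2) ((s - 1) ^ 2) := by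
  unfold stepFun
  rcases le_total (3 * s - 1) 0 with h | h
  · rw [min_eq_right (by linarith), max_eq_left h, le_min_iff]
    constructor <;> nlinarith
  rcases le_total (3 * s - 1) 1 with h' | h'
  · rw [min_eq_right h', max_eq_right h, le_min_iff]
    constructor <;> nlinarith
  · rw [min_eq_left h', max_eq_right zero_le_one, le_min_iff]
    constructor <;> nlinarith

theorem indicator_Ioo_le_min_sq (s : ℝ) :
    (Set.Ioo (1 / 3 : ℝ) (2 / 3)).indicator (fun _ => (1 : ℝ)) s ≤
      9 * min (s ^ 2) ((s - 1) ^ 2) := by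
  by_cases h : s ∈ Set.Ioo (1 / 3 : ℝ) (2 / 3)
  · obtain ⟨h1, h2⟩ := h
    rw [Set.indicator_of_mem (show s ∈ Set.Ioo (1 / 3 : ℝ) (2 / 3) from ⟨h1, h2⟩)]
    have : 1 / 9 ≤ min (s ^ 2) ((s - 1) ^ 2) := le_min (by nlinarith) (by nlinarith)
    linarith
  · rw [Set.indicator_of_notMem h]; positivity

theorem stepFun_sub_le {θ : ℝ} (hθ : 0 < θ) (hθ2 : θ ≤ 1 / 2) (s r : ℝ) :
    stepFun r - stepFun s ≤ 9 / θ * (s - r) ^ 2 +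
      θ * ((Set.Ioo (1 / 3 : ℝ) (2 / 3)).indicator (fun _ => (1 : ℝ)) s +
        (Set.Ioo (1 / 3 : ℝ) (2 / 3)).indicator (fun _ => (1 : ℝ)) r) := by
  set D := Set.Ioo (1 / 3 : ℝ) (2 / 3)
  have hlip : stepFun r - stepFun s ≤ 3 * |s - r| := by
    have h1 : s - r ≤ |s - r| := le_abs_self _
    have h2 : -(s - r) ≤ |s - r| := neg_le_abs _
    unfold stepFun
    rcases max_cases 0 (min 1 (3 * r - 1)) with h | h <;>
    rcases max_cases 0 (min 1 (3 * s - 1)) with h' | h' <;>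
    rcases min_cases 1 (3 * r - 1) with h3 | h3 <;>
    rcases min_cases 1 (3 * s - 1) with h4 | h4 <;> linarith
  have h9 : 9 ≤ 9 / θ := by rw [le_div_iff₀ hθ]; linarith
  have hD : ∀ x, 0 ≤ D.indicator (fun _ => (1 : ℝ)) x :=
    fun x => Set.indicator_nonneg (fun _ _ => zero_le_one) x
  by_cases h : s ∈ D ∨ r ∈ D
  · have h1 : 1 ≤ D.indicator (fun _ => (1 : ℝ)) s + D.indicator (fun _ => (1 : ℝ)) r := by
      rcases h with h | h
      · rw [Set.indicator_of_mem h]; linarith [hD r]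
      · rw [Set.indicator_of_mem h]; linarith [hD s]
    have h2 : 3 * |s - r| ≤ 9 / θ * (s - r) ^ 2 + θ := by
      have : 9 / θ * (s - r) ^ 2 + θ - 3 * |s - r| =
          (3 * |s - r| / θ - θ / θ) ^ 2 * θ + 3 * |s - r| := by
        rw [← sq_abs (s - r)]; field_simp; ring
      have : 0 ≤ (3 * |s - r| / θ - θ / θ) ^ 2 * θ + 3 * |s - r| := by positivity
      linarith
    nlinarith
  · push Not at h
    rw [Set.indicator_of_notMem h.1, Set.indicator_of_notMem h.2, add_zero, mul_zero, add_zero]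
    have h1 : stepFun r - stepFun s ≤ 9 * (s - r) ^ 2 := by
      have hs : s ≤ 1 / 3 ∨ 2 / 3 ≤ s := by
        by_contra! hc; exact h.1 hc
      have hr : r ≤ 1 / 3 ∨ 2 / 3 ≤ r := by
        by_contra! hc; exact h.2 hc
      have e0 : ∀ x : ℝ, x ≤ 1 / 3 → stepFun x = 0 := fun x hx => by
        unfold stepFun; rw [min_eq_right (by linarith), max_eq_left (by linarith)]
      have e1 : ∀ x : ℝ, 2 / 3 ≤ x → stepFun x = 1 := fun x hx => by
        unfold stepFun; rw [min_eq_left (by linarith), max_eq_right (by linarith)]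
      rcases hs with hs | hs <;> rcases hr with hr | hr
      · rw [e0 _ hs, e0 _ hr]; nlinarith
      · rw [e0 _ hs, e1 _ hr]; nlinarith
      · rw [e1 _ hs, e0 _ hr]; nlinarith
      · rw [e1 _ hs, e1 _ hr]; nlinarith
    nlinarith [sq_nonneg (s - r)]

end Moments

section Bimodal

variable {d : ℕ} {σ : ℝ} {μ ν : Measure (EucSp d)}

theorem IsT2.integral_stepFun_variance_le (h : IsT2 σ μ) (hσ : 0 < σ) [IsProbabilityMeasure μ]
    {e : EucSp d} (he : ‖e‖ = 1) (t : ℝ) {L : ℝ} (hL : 0 < L) :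
    L ^ 2 * ∫ z, (stepFun ((inner ℝ e z - t) / L) -
        ∫ z, stepFun ((inner ℝ e z - t) / L) ∂μ) ^ 2 ∂μ ≤
      216 * σ ^ 2 * ∫ z, (Set.Ioo (1 / 3 : ℝ) (2 / 3)).indicator (fun _ => (1 : ℝ))
        ((inner ℝ e z - t) / L) ∂μ := by
  set s : EucSp d → ℝ := fun z => (inner ℝ e z - t) / L with hs
  set H : EucSp d → ℝ := fun z => stepFun (s z) with hH
  set J : EucSp d → ℝ :=
    fun z => (Set.Ioo (1 / 3 : ℝ) (2 / 3)).indicator (fun _ => (1 : ℝ)) (s z) with hJ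
  change L ^ 2 * ∫ z, (H z - ∫ z, H z ∂μ) ^ 2 ∂μ ≤ 216 * σ ^ 2 * ∫ z, J z ∂μ
  set v0 := ∫ z, H z ∂μ with hv0
  set v := ∫ z, (H z - v0) ^ 2 ∂μ with hv
  set q := ∫ z, J z ∂μ with hq
  have hsm : Measurable s := by fun_prop
  have hHm : Measurable H := continuous_stepFun.measurable.comp hsm
  have hJm : Measurable J := (measurable_const.indicator measurableSet_Ioo).comp hsm
  have hH0 : ∀ z, 0 ≤ H z := fun z => stepFun_nonneg _
  have hH1 : ∀ z, H z ≤ 1 := fun z => stepFun_le_one _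
  have hJ0 : ∀ z, 0 ≤ J z := fun z => Set.indicator_nonneg (fun _ _ => zero_le_one) _
  have hJ1 : ∀ z, J z ≤ 1 := fun z => Set.indicator_le_self' (fun _ _ => zero_le_one) _
  have bi : ∀ {f : EucSp d → ℝ}, Measurable f → (∀ z, |f z| ≤ 4) → Integrable f μ :=
    fun hf hb => Integrable.of_bound hf.aestronglyMeasurable 4 (ae_of_all _ hb)
  have hHi : Integrable H μ := bi hHm fun z => by rw [abs_le]; constructor <;> linarith [hH0 z, hH1 z]
  have hJi : Integrable J μ := bi hJm fun z => by rw [abs_le]; constructor <;> linarith [hJ0 z, hJ1 z]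
  have hv00 : 0 ≤ v0 := integral_nonneg hH0
  have hv01 : v0 ≤ 1 := by
    calc v0 ≤ ∫ z, (1 : ℝ) ∂μ := integral_mono hHi (integrable_const _) hH1
      _ = 1 := by simp
  have hq0 : 0 ≤ q := integral_nonneg hJ0
  have hv0' : 0 ≤ v := integral_nonneg fun z => by positivity
  obtain ⟨θ, hθ0, hθ2, hθε⟩ : ∃ θ : ℝ, 0 < θ ∧ θ ≤ 1 / 2 ∧ θ * L ^ 2 / (36 * σ ^ 2) ≤ 1 := by
    refine ⟨min (1 / 2) (36 * σ ^ 2 / L ^ 2), by positivity, min_le_left _ _, ?_⟩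
    rw [div_le_one (by positivity), ← le_div_iff₀ (by positivity)]
    exact min_le_right _ _
  set ε := θ * L ^ 2 / (36 * σ ^ 2) with hε
  have hε0 : 0 < ε := by positivity
  set g : EucSp d → ℝ := fun z => 1 + ε * (H z - v0) with hg
  have hgm : Measurable g := by fun_prop
  have habs : ∀ z, |H z - v0| ≤ 1 := fun z => by
    rw [abs_le]; constructor <;> linarith [hH0 z, hH1 z]
  have hg0 : ∀ z, 0 ≤ g z := fun z => by
    have := (abs_le.1 (habs z)).1
    simp only [hg]; nlinarith
  have hg2 : ∀ z, g z ≤ 2 := fun z => by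
    have := (abs_le.1 (habs z)).2
    simp only [hg]; nlinarith
  have hdi : Integrable (fun z => H z - v0) μ := hHi.sub (integrable_const _)
  have hd0 : ∫ z, (H z - v0) ∂μ = 0 := by
    rw [integral_sub hHi (integrable_const _)]; simp [hv0]
  have hgi : Integrable g μ := (integrable_const _).add (hdi.const_mul ε)
  have hg1 : ∫ z, g z ∂μ = 1 := by
    rw [hg, integral_add (integrable_const _) (hdi.const_mul ε), integral_const_mul, hd0]; simp
  have hd2i : Integrable (fun z => (H z - v0) ^ 2) μ := bi (by fun_prop) fun z => by
    rw [abs_of_nonneg (by positivity), ← sq_abs]; nlinarith [habs z, abs_nonneg (H z - v0)]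
  have := isProbabilityMeasure_withDensity_ofReal hgi hg0 hg1
  have hkl : InformationTheory.klDiv (μ.withDensity fun x => ENNReal.ofReal (g x)) μ ≤
      ENNReal.ofReal (ε ^ 2 * v) := by
    rw [klDiv_withDensity_ofReal hgm hg0, hv, ← integral_const_mul,
      ofReal_integral_eq_lintegral_ofReal (hd2i.const_mul _) (ae_of_all _ fun z => by positivity)]
    refine lintegral_mono fun z => ENNReal.ofReal_le_ofReal ?_
    refine (klFun_le_sub_one_sq (hg0 z)).trans (le_of_eq ?_)
    simp only [hg]; ring
  have hψi : Integrable (fun z => H z - θ * J z) μ := hHi.sub (hJi.const_mul θ)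
  have hmain := h.integral_sub_integral_le (ψ := fun z => H z - θ * J z)
    (φ := fun z => H z + θ * J z) (a := 9 / θ / L ^ 2) (by positivity) (by positivity) hkl
    (hHi.add (hJi.const_mul θ))
    (integrable_withDensity_ofReal hgm hg0 hg2 hψi) (by
      intro x y
      have h1 := stepFun_sub_le hθ0 hθ2 (s x) (s y)
      have h2 : 9 / θ * (s x - s y) ^ 2 ≤ 9 / θ / L ^ 2 * ‖x - y‖ ^ 2 := by
        have h3 : s x - s y = inner ℝ e (x - y) / L := by
          simp only [hs, inner_sub_right]; ring
        have h4 : (inner ℝ e (x - y)) ^ 2 ≤ ‖x - y‖ ^ 2 := by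
          rw [← sq_abs (inner ℝ e (x - y))]
          have := abs_real_inner_le_norm e (x - y)
          rw [he, one_mul] at this
          gcongr
        rw [h3, div_pow]
        calc 9 / θ * ((inner ℝ e (x - y)) ^ 2 / L ^ 2)
            = 9 / θ / L ^ 2 * (inner ℝ e (x - y)) ^ 2 := by ring
          _ ≤ _ := by gcongr
      have h3 : stepFun (s y) - stepFun (s x) ≤ 9 / θ / L ^ 2 * ‖x - y‖ ^ 2 +
        θ * (J x + J y) := h1.trans (by gcongr)
      simp only [hH]
      linarith)
  have hφv : ∫ z, H z + θ * J z ∂μ = v0 + θ * q := by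
    rw [integral_add hHi (hJi.const_mul θ), integral_const_mul]
  have hi1 : Integrable (fun z => v0 * (H z - v0)) μ := hdi.const_mul _
  have hi2 : Integrable (fun z => (H z - v0) ^ 2 + v0 * (H z - v0)) μ := hd2i.add hi1
  have hgHi : Integrable (fun z => H z + ε * ((H z - v0) ^ 2 + v0 * (H z - v0))) μ :=
    hHi.add (hi2.const_mul _)
  have hψv : v0 + ε * v - 2 * θ * q ≤ ∫ z, g z * (H z - θ * J z) ∂μ := by
    calc v0 + ε * v - 2 * θ * q
        = ∫ z, (H z + ε * ((H z - v0) ^ 2 + v0 * (H z - v0))) - 2 * θ * J z ∂μ := by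
          rw [integral_sub hgHi (hJi.const_mul _), integral_const_mul,
            integral_add hHi (hi2.const_mul _), integral_const_mul,
            integral_add hd2i hi1, integral_const_mul, hd0]
          ring
      _ ≤ _ := by
          refine integral_mono (hgHi.sub (hJi.const_mul _)) (bi (by fun_prop) fun z => ?_)
            fun z => ?_
          · rw [abs_mul, abs_of_nonneg (hg0 z)]
            have h1 : |H z - θ * J z| ≤ 2 := by
              rw [abs_le]; constructor <;> nlinarith [hH0 z, hH1 z, hJ0 z, hJ1 z]
            nlinarith [hg0 z, hg2 z, abs_nonneg (H z - θ * J z)]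
          · have h1 : g z * (θ * J z) ≤ 2 * (θ * J z) :=
              mul_le_mul_of_nonneg_right (hg2 z) (mul_nonneg hθ0.le (hJ0 z))
            simp only [hg] at h1 ⊢
            nlinarith
  rw [integral_withDensity_ofReal hgm hg0, hφv] at hmain
  have h5 : 9 / θ / L ^ 2 * (2 * σ ^ 2 * (ε ^ 2 * v)) = ε * v / 2 := by
    have : 9 / θ / L ^ 2 * (2 * σ ^ 2 * ε) = 1 / 2 := by rw [hε]; field_simp; ring
    calc _ = (9 / θ / L ^ 2 * (2 * σ ^ 2 * ε)) * (ε * v) := by ring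
      _ = _ := by rw [this]; ring
  rw [h5] at hmain
  have h6 : ε * v ≤ 6 * θ * q := by linarith
  have h7 : L ^ 2 * v * θ = 36 * σ ^ 2 * (ε * v) := by rw [hε]; field_simp
  have h8 : L ^ 2 * v * θ ≤ 216 * σ ^ 2 * q * θ := by
    rw [h7]
    calc 36 * σ ^ 2 * (ε * v) ≤ 36 * σ ^ 2 * (6 * θ * q) := by gcongr
      _ = _ := by ring
  exact le_of_mul_le_mul_right h8 hθ0

theorem IsT2.one_le_integral_min_sq (h : IsT2 σ μ) (hσ : 0 < σ) [IsProbabilityMeasure μ]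
    {e : EucSp d} (he : ‖e‖ = 1) (hint : Integrable (fun z => inner ℝ e z) μ)
    (hint2 : Integrable (fun z => (inner ℝ e z) ^ 2) μ)
    (hmean : ∫ z, inner ℝ e z ∂μ = 0) (hvar : ∫ z, (inner ℝ e z) ^ 2 ∂μ = 1) (t₁ t₂ : ℝ) :
    1 ≤ (15552 * σ ^ 2 + 4) * ∫ z, min ((inner ℝ e z - t₁) ^ 2) ((inner ℝ e z - t₂) ^ 2) ∂μ := by
  wlog hle : t₁ ≤ t₂ generalizing t₁ t₂
  · refine (this t₂ t₁ (le_of_not_ge hle)).trans_eq ?_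
    congr 1
    exact integral_congr_ae (ae_of_all _ fun z => min_comm _ _)
  have hci : ∀ c : ℝ, Integrable (fun z => (inner ℝ e z - c) ^ 2) μ := by
    intro c
    have : (fun z : EucSp d => (inner ℝ e z - c) ^ 2) =
        fun z => (inner ℝ e z) ^ 2 - 2 * c * inner ℝ e z + c ^ 2 := by funext z; ring
    rw [this]
    exact (hint2.sub (hint.const_mul _)).add (integrable_const _)
  have hone : ∀ c : ℝ, 1 ≤ ∫ z, (inner ℝ e z - c) ^ 2 ∂μ := by
    intro c
    have : (fun z : EucSp d => (inner ℝ e z - c) ^ 2) =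
        fun z => (inner ℝ e z) ^ 2 - 2 * c * inner ℝ e z + c ^ 2 := by funext z; ring
    have hi : Integrable (fun z => (inner ℝ e z) ^ 2 - 2 * c * inner ℝ e z) μ :=
      hint2.sub (hint.const_mul _)
    rw [this, integral_add hi (integrable_const _), integral_sub hint2 (hint.const_mul _),
      integral_const_mul, hvar, hmean]
    simp; positivity
  have hmi : Integrable (fun z => min ((inner ℝ e z - t₁) ^ 2) ((inner ℝ e z - t₂) ^ 2)) μ :=
    (hci t₁).inf (hci t₂)
  set m := ∫ z, min ((inner ℝ e z - t₁) ^ 2) ((inner ℝ e z - t₂) ^ 2) ∂μ with hm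
  have hm0 : 0 ≤ m := integral_nonneg fun z => by positivity
  set L := t₂ - t₁ with hL
  rcases lt_or_ge L (1 / 2) with hL2 | hL2
  · have h1 : 1 ≤ 2 * m + 2 * L ^ 2 := by
      calc 1 ≤ ∫ z, (inner ℝ e z - t₁) ^ 2 ∂μ := hone _
        _ ≤ ∫ z, 2 * min ((inner ℝ e z - t₁) ^ 2) ((inner ℝ e z - t₂) ^ 2) + 2 * L ^ 2 ∂μ := by
            refine integral_mono (hci _) ((hmi.const_mul 2).add (integrable_const _)) fun z => ?_
            rcases min_cases ((inner ℝ e z - t₁) ^ 2) ((inner ℝ e z - t₂) ^ 2) with hc | hc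
            · simp only [hc.1]; nlinarith [sq_nonneg (inner ℝ e z - t₁), sq_nonneg L]
            · simp only [hc.1]; nlinarith [sq_nonneg (inner ℝ e z - t₂ - L)]
        _ = _ := by
            rw [integral_add (hmi.const_mul 2) (integrable_const _), integral_const_mul]; simp [hm]
    have hL0 : 0 ≤ L := by linarith
    nlinarith [mul_nonneg (sq_nonneg σ) hm0]
  have hL0 : 0 < L := by linarith
  have hstep := h.integral_stepFun_variance_le hσ he t₁ hL0
  set s : EucSp d → ℝ := fun z => (inner ℝ e z - t₁) / L with hs
  set H : EucSp d → ℝ := fun z => stepFun (s z) with hH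
  set v0 := ∫ z, stepFun ((inner ℝ e z - t₁) / L) ∂μ with hv0
  set v := ∫ z, (stepFun ((inner ℝ e z - t₁) / L) - v0) ^ 2 ∂μ with hv
  set q := ∫ z, (Set.Ioo (1 / 3 : ℝ) (2 / 3)).indicator (fun _ => (1 : ℝ))
        ((inner ℝ e z - t₁) / L) ∂μ with hq
  have hmin : ∀ z, min ((inner ℝ e z - t₁) ^ 2) ((inner ℝ e z - t₂) ^ 2) =
      L ^ 2 * min (s z ^ 2) ((s z - 1) ^ 2) := by
    intro z
    rw [mul_min_of_nonneg _ _ (sq_nonneg L), ← mul_pow, ← mul_pow]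
    congr 3
    · simp only [hs]; field_simp
    · simp only [hs]; rw [mul_sub, mul_div_cancel₀ _ hL0.ne']; simp only [hL]; ring
  have hsm : Measurable s := by fun_prop
  have hqm : L ^ 2 * q ≤ 9 * m := by
    rw [hq, hm, ← integral_const_mul, ← integral_const_mul]
    refine integral_mono ?_ (hmi.const_mul _) fun z => ?_
    · refine Integrable.const_mul ?_ _
      refine Integrable.of_bound (C := 1)
        ((measurable_const.indicator measurableSet_Ioo).comp hsm).aestronglyMeasurable
        (ae_of_all _ fun z => ?_)
      rw [Real.norm_of_nonneg (Set.indicator_nonneg (fun _ _ => zero_le_one) _)]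
      exact Set.indicator_le_self' (fun _ _ => zero_le_one) _
    · simp only [hmin z]
      have := indicator_Ioo_le_min_sq (s z)
      nlinarith [sq_nonneg L]
  have hdi : Integrable (fun z => (stepFun ((inner ℝ e z - t₁) / L) - v0) ^ 2) μ := by
    refine Integrable.of_bound (C := (1 + |v0|) ^ 2)
      (((continuous_stepFun.measurable.comp hsm).sub_const v0).pow_const 2).aestronglyMeasurable
      (ae_of_all _ fun z => ?_)
    rw [Real.norm_of_nonneg (by positivity), ← sq_abs]
    have : |stepFun ((inner ℝ e z - t₁) / L) - v0| ≤ 1 + |v0| := by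
      refine (abs_sub _ _).trans ?_
      rw [abs_of_nonneg (stepFun_nonneg _)]
      linarith [stepFun_le_one ((inner ℝ e z - t₁) / L)]
    gcongr
  have hfin : 1 ≤ 2 * m + 2 * L ^ 2 * v := by
    calc 1 ≤ ∫ z, (inner ℝ e z - (t₁ + L * v0)) ^ 2 ∂μ := hone _
      _ ≤ ∫ z, 2 * min ((inner ℝ e z - t₁) ^ 2) ((inner ℝ e z - t₂) ^ 2) +
          2 * L ^ 2 * (stepFun ((inner ℝ e z - t₁) / L) - v0) ^ 2 ∂μ := by
          refine integral_mono (hci _) ((hmi.const_mul 2).add (hdi.const_mul _)) fun z => ?_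
          have h1 : inner ℝ e z - (t₁ + L * v0) = L * (s z - v0) := by
            simp only [hs]; field_simp; ring
          simp only [hmin z, h1]
          have h2 := sub_stepFun_sq_le (s z)
          change _ ≤ _ + 2 * L ^ 2 * (stepFun (s z) - v0) ^ 2
          have h3 : (s z - v0) ^ 2 ≤ 2 * (s z - stepFun (s z)) ^ 2 + 2 * (stepFun (s z) - v0) ^ 2 := by
            nlinarith [sq_nonneg ((s z - stepFun (s z)) - (stepFun (s z) - v0))]
          rw [mul_pow]
          nlinarith [mul_le_mul_of_nonneg_left h3 (sq_nonneg L),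
            mul_le_mul_of_nonneg_left h2 (sq_nonneg L)]
      _ = _ := by
          rw [integral_add (hmi.const_mul 2) (hdi.const_mul _), integral_const_mul,
            integral_const_mul]
  have hL4 : 1 / 4 ≤ L ^ 2 := by nlinarith
  have hq0 : 0 ≤ q := integral_nonneg fun z => Set.indicator_nonneg (fun _ _ => zero_le_one) _
  have h9 : q ≤ 36 * m := by nlinarith
  have : σ ^ 2 * q ≤ σ ^ 2 * (36 * m) := by gcongr
  nlinarith [sq_nonneg σ]

end Bimodal

section NoiseMoments

variable {d K : ℕ}

namespace MixtureModel

variable (θ : MixtureModel d K)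

theorem memLp_noise_coord (a : Fin d) : MemLp (fun z : EucSp d => z a) 2 θ.noise := by
  refine θ.noise_memLp.mono (by fun_prop) (ae_of_all _ fun z => ?_)
  exact PiLp.norm_apply_le z a

theorem integrable_noise_coord (a : Fin d) : Integrable (fun z : EucSp d => z a) θ.noise :=
  haveI := θ.noise_prob
  (θ.memLp_noise_coord a).integrable one_le_two

theorem inner_eq_sum (b z : EucSp d) : inner ℝ b z = ∑ a, b a * z a := by
  simp [PiLp.inner_apply, mul_comm]

theorem integrable_noise_inner (b : EucSp d) : Integrable (fun z => inner ℝ b z) θ.noise := by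
  simp_rw [inner_eq_sum]
  exact integrable_finsetSum _ fun a _ => (θ.integrable_noise_coord a).const_mul _

theorem integral_noise_inner (b : EucSp d) : ∫ z, inner ℝ b z ∂θ.noise = 0 := by
  simp_rw [inner_eq_sum]
  rw [integral_finsetSum _ fun a _ => (θ.integrable_noise_coord a).const_mul _]
  simp [integral_const_mul, θ.noise_mean]

theorem integrable_noise_coord_mul (a c : Fin d) :
    Integrable (fun z : EucSp d => z a * z c) θ.noise :=
  (θ.memLp_noise_coord a).integrable_mul (θ.memLp_noise_coord c)

theorem inner_sq_eq_sum (b z : EucSp d) :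
    (inner ℝ b z) ^ 2 = ∑ a, ∑ c, b a * b c * (z a * z c) := by
  rw [inner_eq_sum, sq, Finset.sum_mul_sum]
  refine Finset.sum_congr rfl fun a _ => Finset.sum_congr rfl fun c _ => by ring

theorem integrable_noise_inner_sq (b : EucSp d) :
    Integrable (fun z => (inner ℝ b z) ^ 2) θ.noise := by
  simp_rw [inner_sq_eq_sum]
  exact integrable_finsetSum _ fun a _ => integrable_finsetSum _ fun c _ =>
    (θ.integrable_noise_coord_mul a c).const_mul _

theorem integral_noise_inner_sq (b : EucSp d) :
    ∫ z, (inner ℝ b z) ^ 2 ∂θ.noise = ‖b‖ ^ 2 := by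
  simp_rw [inner_sq_eq_sum]
  rw [integral_finsetSum _ fun a _ => integrable_finsetSum _ fun c _ =>
    (θ.integrable_noise_coord_mul a c).const_mul _]
  have : ∀ a : Fin d, ∫ z, ∑ c, b a * b c * (z a * z c) ∂θ.noise = b a ^ 2 := by
    intro a
    rw [integral_finsetSum _ fun c _ => (θ.integrable_noise_coord_mul a c).const_mul _]
    simp [integral_const_mul, θ.noise_isotropic, sq]
  simp_rw [this]
  rw [EuclideanSpace.real_norm_sq_eq]

end MixtureModel

/-- Squared distance from `x` to the pair `{t₁, t₂}`. -/
def sqDistPair (t₁ t₂ x : ℝ) : ℝ := min ((x - t₁) ^ 2) ((x - t₂) ^ 2)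

theorem sqDistPair_nonneg (t₁ t₂ x : ℝ) : 0 ≤ sqDistPair t₁ t₂ x := by
  unfold sqDistPair; positivity

theorem continuous_sqDistPair (t₁ t₂ : ℝ) : Continuous (sqDistPair t₁ t₂) := by
  unfold sqDistPair; fun_prop

/-- The projection of `t` to `[-T, T]`. -/
def clampTo (T t : ℝ) : ℝ := max (-T) (min T t)

theorem abs_clampTo_le {T : ℝ} (hT : 0 ≤ T) (t : ℝ) : |clampTo T t| ≤ T := by
  rw [abs_le]
  exact ⟨le_max_left _ _, max_le (by linarith) (min_le_left _ _)⟩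

theorem sub_clampTo_sq_le {T x : ℝ} (hx : |x| ≤ T) (t : ℝ) :
    (x - clampTo T t) ^ 2 ≤ (x - t) ^ 2 := by
  obtain ⟨h1, h2⟩ := abs_le.1 hx
  unfold clampTo
  rcases le_total T t with h | h
  · rw [min_eq_left h, max_eq_right (by linarith)]; nlinarith
  rcases le_total (-T) t with h' | h'
  · rw [min_eq_right h, max_eq_right h']
  · rw [min_eq_right h, max_eq_left h']; nlinarith

theorem sqDistPair_clampTo_le {T x : ℝ} (hx : |x| ≤ T) (t₁ t₂ : ℝ) :
    sqDistPair (clampTo T t₁) (clampTo T t₂) x ≤ sqDistPair t₁ t₂ x :=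
  min_le_min (sub_clampTo_sq_le hx _) (sub_clampTo_sq_le hx _)

theorem sqDistPair_clampTo_le_four_mul {T : ℝ} (hT : 0 ≤ T) (t₁ t₂ x : ℝ) :
    sqDistPair (clampTo T t₁) (clampTo T t₂) x ≤ 4 * max T |x| ^ 2 := by
  refine (min_le_left _ _).trans ?_
  have h1 := abs_clampTo_le hT t₁
  have h2 : |x - clampTo T t₁| ≤ 2 * max T |x| := by
    refine (abs_sub _ _).trans ?_
    linarith [le_max_left T |x|, le_max_right T |x|]
  rw [← sq_abs]
  calc |x - clampTo T t₁| ^ 2 ≤ (2 * max T |x|) ^ 2 := by gcongr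
    _ = _ := by ring

/-- One-dimensional projections of a `T₂(σ)` isotropic distribution are not close to any
two-point distribution. -/
theorem exists_le_integral_min_sqDistPair {σ : ℝ} (hσ : 0 < σ) :
    ∃ a M : ℝ, 0 < a ∧ 0 < M ∧ ∀ {d K : ℕ} (θ : MixtureModel d K), IsT2 σ θ.noise →
      ∀ e : EucSp d, ‖e‖ = 1 → ∀ t₁ t₂ : ℝ,
        a ≤ ∫ z, min (sqDistPair t₁ t₂ (inner ℝ e z)) M ∂θ.noise := by
  set c : ℝ := 1 / (15552 * σ ^ 2 + 4) with hc
  have hc0 : 0 < c := by positivity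
  set S : ℝ := √(768 * σ ^ 4 / c) with hS
  have hS0 : 0 < S := Real.sqrt_pos.2 (by positivity)
  have hS2 : S ^ 2 = 768 * σ ^ 4 / c := Real.sq_sqrt (by positivity)
  refine ⟨c / 2, 4 * S ^ 2, by positivity, by positivity, ?_⟩
  intro d K θ hT2 e he t₁ t₂
  have := θ.noise_prob
  have hint := θ.integrable_noise_inner e
  have hint2 := θ.integrable_noise_inner_sq e
  have hvar := θ.integral_noise_inner_sq e
  rw [he, one_pow] at hvar
  have h4 := hT2.integral_inner_pow_four_le hσ he hint (θ.integral_noise_inner e)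
  have h4i := hT2.integrable_inner_pow_four hσ he hint (θ.integral_noise_inner e)
  have hpop := hT2.one_le_integral_min_sq hσ he hint hint2 (θ.integral_noise_inner e) hvar
    (clampTo S t₁) (clampTo S t₂)
  change 1 ≤ (15552 * σ ^ 2 + 4) *
    ∫ z, sqDistPair (clampTo S t₁) (clampTo S t₂) (inner ℝ e z) ∂θ.noise at hpop
  have hpop' : c ≤ ∫ z, sqDistPair (clampTo S t₁) (clampTo S t₂) (inner ℝ e z) ∂θ.noise := by
    rw [hc, div_le_iff₀ (by positivity)]; linarith
  have hmi : Integrable (fun z => min (sqDistPair t₁ t₂ (inner ℝ e z)) (4 * S ^ 2)) θ.noise := by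
    refine Integrable.of_bound (C := 4 * S ^ 2)
      (((continuous_sqDistPair t₁ t₂).comp (by fun_prop)).min
        continuous_const).aestronglyMeasurable (ae_of_all _ fun z => ?_)
    rw [Real.norm_of_nonneg (le_min (sqDistPair_nonneg _ _ _) (by positivity))]
    exact min_le_right _ _
  have hfi : Integrable (fun z => 4 / S ^ 2 * (inner ℝ e z) ^ 4) θ.noise := h4i.const_mul _
  have hpt : ∀ z : EucSp d, sqDistPair (clampTo S t₁) (clampTo S t₂) (inner ℝ e z) ≤
      min (sqDistPair t₁ t₂ (inner ℝ e z)) (4 * S ^ 2) + 4 / S ^ 2 * (inner ℝ e z) ^ 4 := by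
    intro z
    have h1 := sqDistPair_clampTo_le_four_mul hS0.le t₁ t₂ (inner ℝ e z)
    rcases le_or_gt |inner ℝ e z| S with hx | hx
    · rw [max_eq_left hx] at h1
      have := le_min (sqDistPair_clampTo_le hx t₁ t₂) h1
      have h0 : 0 ≤ 4 / S ^ 2 * (inner ℝ e z) ^ 4 := by positivity
      linarith
    · rw [max_eq_right hx.le, sq_abs] at h1
      have h2 : (inner ℝ e z) ^ 2 ≤ 1 / S ^ 2 * (inner ℝ e z) ^ 4 := by
        rw [div_mul_eq_mul_div, le_div_iff₀ (by positivity), one_mul]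
        have : S ^ 2 ≤ (inner ℝ e z) ^ 2 := by
          rw [← sq_abs (inner ℝ e z)]; gcongr
        nlinarith [sq_nonneg (inner ℝ e z)]
      have h0 : 0 ≤ min (sqDistPair t₁ t₂ (inner ℝ e z)) (4 * S ^ 2) :=
        le_min (sqDistPair_nonneg _ _ _) (by positivity)
      have h3 : 4 / S ^ 2 * (inner ℝ e z) ^ 4 = 4 * (1 / S ^ 2 * (inner ℝ e z) ^ 4) := by ring
      linarith
  have hdi : Integrable (fun z => sqDistPair (clampTo S t₁) (clampTo S t₂) (inner ℝ e z))
      θ.noise := by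
    refine (hmi.add hfi).mono'
      ((continuous_sqDistPair _ _).comp (by fun_prop)).aestronglyMeasurable
      (ae_of_all _ fun z => ?_)
    rw [Real.norm_of_nonneg (sqDistPair_nonneg _ _ _)]
    exact hpt z
  have hle : ∫ z, sqDistPair (clampTo S t₁) (clampTo S t₂) (inner ℝ e z) ∂θ.noise ≤
      ∫ z, (min (sqDistPair t₁ t₂ (inner ℝ e z)) (4 * S ^ 2) +
        4 / S ^ 2 * (inner ℝ e z) ^ 4) ∂θ.noise := integral_mono hdi (hmi.add hfi) hpt
  rw [integral_add hmi hfi, integral_const_mul] at hle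
  have h5 : 4 / S ^ 2 * ∫ z, (inner ℝ e z) ^ 4 ∂θ.noise ≤ c / 2 := by
    calc _ ≤ 4 / S ^ 2 * (96 * σ ^ 4) := by gcongr
      _ = c / 2 := by rw [hS2]; field_simp; norm_num
  linarith

end NoiseMoments

section Chernoff

variable {Ω ι : Type*} [MeasurableSpace Ω] {P : Measure Ω} [IsProbabilityMeasure P] [Fintype ι]
  {X : ι → Ω → ℝ}

theorem exp_neg_le_one_sub_half {x : ℝ} (h0 : 0 ≤ x) (h1 : x ≤ 1) :
    Real.exp (-x) ≤ 1 - x / 2 := by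
  rw [Real.exp_neg]
  calc (Real.exp x)⁻¹ ≤ (x + 1)⁻¹ := by
        gcongr; exact Real.add_one_le_exp x
    _ ≤ 1 - x / 2 := by
        rw [inv_le_iff_one_le_mul₀ (by linarith)]; nlinarith

theorem measureReal_sum_le_le_exp (hX : ∀ i, Measurable (X i)) (hind : iIndepFun X P)
    {a M : ℝ} (hM : 0 < M) (h0 : ∀ i ω, 0 ≤ X i ω) (h1 : ∀ i ω, X i ω ≤ M)
    (ha : ∀ i, a ≤ ∫ ω, X i ω ∂P) :
    P.real {ω | ∑ i, X i ω ≤ a / 4 * Fintype.card ι} ≤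
      Real.exp (-(a / (4 * M)) * Fintype.card ι) := by
  have hmgf : ∀ i, mgf (X i) P (-(1 / M)) ≤ Real.exp (-(a / (2 * M))) := by
    intro i
    have hi : Integrable (X i) P := Integrable.of_bound (hX i).aestronglyMeasurable M
      (ae_of_all _ fun ω => by rw [Real.norm_of_nonneg (h0 i ω)]; exact h1 i ω)
    have hle : mgf (X i) P (-(1 / M)) ≤ ∫ ω, (1 - 1 / (2 * M) * X i ω) ∂P := by
      refine integral_mono (Integrable.of_bound (C := 1) (by fun_prop) (ae_of_all _ fun ω => ?_))
        ((integrable_const _).sub (hi.const_mul _)) fun ω => ?_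
      · rw [Real.norm_of_nonneg (Real.exp_pos _).le]
        refine Real.exp_le_one_iff.2 ?_
        have := mul_nonneg (one_div_pos.2 hM).le (h0 i ω)
        linarith
      · have := exp_neg_le_one_sub_half (x := X i ω / M) (div_nonneg (h0 i ω) hM.le)
          ((div_le_one hM).2 (h1 i ω))
        calc _ = Real.exp (-(X i ω / M)) := by congr 1; ring
          _ ≤ _ := this
          _ = _ := by field_simp
    refine hle.trans ?_
    rw [integral_sub (integrable_const _) (hi.const_mul _), integral_const_mul]
    simp only [integral_const, probReal_univ, smul_eq_mul, mul_one]
    have h2 : 1 / (2 * M) * a ≤ 1 / (2 * M) * ∫ ω, X i ω ∂P := by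
      have := ha i; gcongr
    have h3 := Real.add_one_le_exp (-(a / (2 * M)))
    have h4 : 1 / (2 * M) * a = a / (2 * M) := by ring
    linarith
  have hsum : mgf (∑ i, X i) P (-(1 / M)) ≤ Real.exp (-(a / (2 * M)) * Fintype.card ι) := by
    rw [hind.mgf_sum hX]
    calc ∏ i, mgf (X i) P (-(1 / M)) ≤ ∏ i : ι, Real.exp (-(a / (2 * M))) :=
          Finset.prod_le_prod (fun i _ => mgf_nonneg) fun i _ => hmgf i
      _ = _ := by
          rw [Finset.prod_const, Finset.card_univ, ← Real.exp_nat_mul]; congr 1; ring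
  have hint : Integrable (fun ω => Real.exp (-(1 / M) * (∑ i, X i) ω)) P := by
    refine Integrable.of_bound (C := 1) (by fun_prop) (ae_of_all _ fun ω => ?_)
    rw [Real.norm_of_nonneg (Real.exp_pos _).le]
    refine Real.exp_le_one_iff.2 ?_
    have : 0 ≤ (∑ i, X i) ω := by
      rw [Finset.sum_apply]; exact Finset.sum_nonneg fun i _ => h0 i ω
    have := mul_nonneg (one_div_pos.2 hM).le this
    linarith
  have hch := measure_le_le_exp_mul_mgf (X := ∑ i, X i) (μ := P) (a / 4 * Fintype.card ι)
    (t := -(1 / M)) (by rw [neg_nonpos]; positivity) hint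
  simp only [Finset.sum_apply] at hch
  refine hch.trans ?_
  calc _ ≤ Real.exp (-(-(1 / M)) * (a / 4 * Fintype.card ι)) *
        Real.exp (-(a / (2 * M)) * Fintype.card ι) := by gcongr
    _ = _ := by
        rw [← Real.exp_add]; congr 1; field_simp; ring

theorem measureReal_le_sum_le_exp (hX : ∀ i, Measurable (X i)) (hind : iIndepFun X P)
    {l C : ℝ} (hl : 0 ≤ l) (hi : ∀ i, Integrable (fun ω => Real.exp (l * X i ω)) P)
    (h3 : ∀ i, ∫ ω, Real.exp (l * X i ω) ∂P ≤ 3) :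
    P.real {ω | C * Fintype.card ι ≤ ∑ i, X i ω} ≤
      Real.exp ((2 - l * C) * Fintype.card ι) := by
  have h3e : (3 : ℝ) ≤ Real.exp 2 := by
    have := Real.add_one_le_exp (2 : ℝ); linarith
  have hsum : mgf (∑ i, X i) P l ≤ Real.exp (2 * Fintype.card ι) := by
    rw [hind.mgf_sum hX]
    calc ∏ i, mgf (X i) P l ≤ ∏ i : ι, Real.exp 2 :=
          Finset.prod_le_prod (fun i _ => mgf_nonneg) fun i _ => (h3 i).trans h3e
      _ = _ := by
          rw [Finset.prod_const, Finset.card_univ, ← Real.exp_nat_mul]; congr 1; ring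
  have hint : Integrable (fun ω => Real.exp (l * (∑ i, X i) ω)) P :=
    hind.integrable_exp_mul_sum hX fun i _ => hi i
  have hch := measure_ge_le_exp_mul_mgf (X := ∑ i, X i) (μ := P) (C * Fintype.card ι)
    hl hint
  simp only [Finset.sum_apply] at hch
  refine hch.trans ?_
  calc _ ≤ Real.exp (-l * (C * Fintype.card ι)) * Real.exp (2 * Fintype.card ι) := by gcongr
    _ = _ := by
        rw [← Real.exp_add]; congr 1; ring

end Chernoff

section Nets

variable {d : ℕ}

theorem exists_half_net (d : ℕ) : ∃ N : Finset (EucSp d), N.card ≤ 5 ^ d ∧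
    ∀ x : EucSp d, ‖x‖ ≤ 1 → ∃ c ∈ N, ‖x - c‖ ≤ 1 / 2 := by
  classical
  let good : Finset (EucSp d) → Prop := fun s =>
    (∀ c ∈ s, ‖c‖ ≤ 2) ∧ ∀ c ∈ s, ∀ c' ∈ s, c ≠ c' → 1 ≤ ‖c - c'‖
  have hcard : ∀ s, good s → s.card ≤ 5 ^ d := fun s hs => by
    simpa using Besicovitch.card_le_of_separated s hs.1 hs.2
  obtain ⟨k, ⟨s, hs, hsk⟩, hmax⟩ : ∃ k, (∃ s, good s ∧ s.card = k) ∧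
      ∀ k', (∃ s, good s ∧ s.card = k') → k' ≤ k := by
    have hbdd : ∀ k, (∃ s, good s ∧ s.card = k) → k ≤ 5 ^ d := by
      rintro k ⟨s, hs, rfl⟩; exact hcard s hs
    have hne : ∃ k, ∃ s, good s ∧ s.card = k := ⟨0, ∅, by simp [good], rfl⟩
    refine ⟨sSup {k | ∃ s, good s ∧ s.card = k}, Nat.sSup_mem hne ⟨_, hbdd⟩, fun k' hk' => ?_⟩
    exact le_csSup ⟨_, hbdd⟩ hk'
  have hnet : ∀ x : EucSp d, ‖x‖ ≤ 2 → ∃ c ∈ s, ‖x - c‖ < 1 := by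
    intro x hx
    by_contra! hcon
    have hxs : x ∉ s := fun h => by have := hcon x h; simp at this; linarith
    have hg : good (insert x s) := by
      constructor
      · intro c hc
        rcases Finset.mem_insert.1 hc with rfl | hc
        · exact hx
        · exact hs.1 c hc
      · intro c hc c' hc' hne
        rcases Finset.mem_insert.1 hc with h1 | h1 <;>
        rcases Finset.mem_insert.1 hc' with h2 | h2
        · exact absurd (h1.trans h2.symm) hne
        · rw [h1]; exact hcon c' h2
        · rw [h2, norm_sub_rev]; exact hcon c h1
        · exact hs.2 c h1 c' h2 hne
    have := hmax _ ⟨_, hg, rfl⟩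
    rw [Finset.card_insert_of_notMem hxs] at this
    omega
  refine ⟨s.image fun c => (1 / 2 : ℝ) • c, Finset.card_image_le.trans (hcard s hs), ?_⟩
  intro x hx
  obtain ⟨c, hc, hlt⟩ := hnet ((2 : ℝ) • x) (by rw [norm_smul]; norm_num; linarith)
  refine ⟨_, Finset.mem_image_of_mem _ hc, ?_⟩
  have : x - (1 / 2 : ℝ) • c = (1 / 2 : ℝ) • ((2 : ℝ) • x - c) := by
    rw [smul_sub, smul_smul]; norm_num
  rw [this, norm_smul]
  norm_num
  linarith

theorem exists_dyadic_net (d k : ℕ) : ∃ N : Finset (EucSp d), N.card ≤ (5 ^ k) ^ d ∧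
    ∀ x : EucSp d, ‖x‖ ≤ 1 → ∃ c ∈ N, ‖x - c‖ ≤ (1 / 2) ^ k := by
  classical
  induction k with
  | zero => exact ⟨{0}, by simp, fun x hx => ⟨0, by simp, by simpa using hx⟩⟩
  | succ k ih =>
    obtain ⟨N, hN, hnet⟩ := ih
    obtain ⟨B, hB, hBnet⟩ := exists_half_net d
    refine ⟨(N ×ˢ B).image fun q => q.1 + ((1 / 2 : ℝ) ^ k) • q.2, ?_, ?_⟩
    · refine Finset.card_image_le.trans ?_
      rw [Finset.card_product]
      calc N.card * B.card ≤ (5 ^ k) ^ d * 5 ^ d := Nat.mul_le_mul hN hB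
        _ = _ := by rw [← mul_pow, pow_succ]
    · intro x hx
      obtain ⟨c, hc, hxc⟩ := hnet x hx
      obtain ⟨b, hb, hxb⟩ := hBnet ((2 : ℝ) ^ k • (x - c)) (by
        rw [norm_smul, norm_pow, Real.norm_of_nonneg (by norm_num : (0 : ℝ) ≤ 2)]
        calc (2 : ℝ) ^ k * ‖x - c‖ ≤ 2 ^ k * (1 / 2) ^ k := by gcongr
          _ = 1 := by rw [← mul_pow]; norm_num)
      refine ⟨_, Finset.mem_image_of_mem _ (Finset.mk_mem_product hc hb), ?_⟩
      have : x - (c + ((1 / 2 : ℝ) ^ k) • b) =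
          ((1 / 2 : ℝ) ^ k) • ((2 : ℝ) ^ k • (x - c) - b) := by
        rw [smul_sub, smul_smul, ← mul_pow]; norm_num; abel
      simp only [this]
      rw [norm_smul, norm_pow, Real.norm_of_nonneg (by norm_num : (0 : ℝ) ≤ 1 / 2), pow_succ]
      gcongr

theorem exists_unit_net (d k : ℕ) : ∃ N : Finset (EucSp d), N.card ≤ (5 ^ k) ^ d ∧
    (∀ c ∈ N, ‖c‖ = 1) ∧ ∀ x : EucSp d, ‖x‖ = 1 → ∃ c ∈ N, ‖x - c‖ ≤ 2 * (1 / 2) ^ k := by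
  classical
  obtain ⟨N, hN, hnet⟩ := exists_dyadic_net d k
  let near : EucSp d → Prop := fun c => ∃ e : EucSp d, ‖e‖ = 1 ∧ ‖e - c‖ ≤ (1 / 2) ^ k
  let f : EucSp d → EucSp d := fun c => if h : near c then h.choose else 0
  refine ⟨(N.filter near).image f, (Finset.card_image_le.trans (Finset.card_filter_le _ _)).trans hN,
    ?_, ?_⟩
  · intro c hc
    obtain ⟨c', hc', rfl⟩ := Finset.mem_image.1 hc
    have h := (Finset.mem_filter.1 hc').2
    simp only [f, dif_pos h]
    exact h.choose_spec.1
  · intro x hx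
    obtain ⟨c, hc, hxc⟩ := hnet x hx.le
    have h : near c := ⟨x, hx, hxc⟩
    refine ⟨f c, Finset.mem_image_of_mem _ (Finset.mem_filter.2 ⟨hc, h⟩), ?_⟩
    simp only [f, dif_pos h]
    have h2 := h.choose_spec.2
    calc ‖x - h.choose‖ ≤ ‖x - c‖ + ‖c - h.choose‖ := norm_sub_le_norm_sub_add_norm_sub _ _ _
      _ ≤ (1 / 2) ^ k + (1 / 2) ^ k := by rw [norm_sub_rev c]; gcongr
      _ = _ := by ring

theorem norm_apply_le_of_unit_net {E F : Type*} [NormedAddCommGroup E] [NormedSpace ℝ E]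
    [NormedAddCommGroup F] [NormedSpace ℝ F] (A : E →L[ℝ] F) {N : Set E} {B : ℝ} (hB : 0 ≤ B)
    (hnet : ∀ x : E, ‖x‖ = 1 → ∃ c ∈ N, ‖x - c‖ ≤ 1 / 2) (hA : ∀ c ∈ N, ‖A c‖ ≤ B) (x : E) :
    ‖A x‖ ≤ 2 * B * ‖x‖ := by
  have h : ‖A‖ ≤ B + ‖A‖ * (1 / 2) := by
    refine ContinuousLinearMap.opNorm_le_of_unit_norm (by positivity) fun x hx => ?_
    obtain ⟨c, hc, hxc⟩ := hnet x hx
    calc ‖A x‖ = ‖A c + A (x - c)‖ := by rw [← map_add]; congr 2; abel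
      _ ≤ ‖A c‖ + ‖A (x - c)‖ := norm_add_le _ _
      _ ≤ B + ‖A‖ * (1 / 2) := by
        gcongr
        · exact hA c hc
        · exact (A.le_opNorm _).trans (by gcongr)
  exact (A.le_opNorm x).trans (by gcongr; linarith)

end Nets

section GoodSample

/-- Labels `y i` of law `π` and noise vectors `z i` of law `Q`, all mutually independent. -/
structure IsNoiseSample {d K : ℕ} {Ω ι : Type*} [MeasurableSpace Ω] (θ : MixtureModel d K)
    (P : Measure Ω) (y : ι → Ω → Fin K) (z : ι → Ω → EucSp d) : Prop where
  measurable_label : ∀ i, Measurable (y i)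
  measurable_noise : ∀ i, Measurable (z i)
  indep : iIndepFun (fun i ω => (y i ω, z i ω)) P
  indep_label_noise : ∀ i, IndepFun (y i) (z i) P
  label_law : ∀ i j, P.real {ω | y i ω = j} = θ.weight j
  noise_law : ∀ i, P.map (z i) = θ.noise

/-- A sample of labels and noise vectors with non-negligible classes, with bounded empirical second
moments, and such that no one-dimensional projection of a class of noise vectors is close to a
two-point configuration. -/
structure GoodSample {d K m : ℕ} (κ C : ℝ) (y : Fin m → Fin K) (z : Fin m → EucSp d) : Prop where
  le_card : ∀ k, κ * m ≤ ((Finset.univ.filter fun i => y i = k).card : ℝ)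
  sum_inner_sq_le : ∀ b : EucSp d, ∑ i, (inner ℝ b (z i)) ^ 2 ≤ C * m * ‖b‖ ^ 2
  le_sum_sqDistPair : ∀ (b : EucSp d) (β : ℝ) (k : Fin K),
    κ * m * ‖b‖ ^ 2 ≤ ∑ i with y i = k, sqDistPair 0 1 (β + inner ℝ b (z i))

variable {d K m : ℕ}

theorem IsNoiseSample.comp {Ω ι ι' : Type*} [MeasurableSpace Ω] {θ : MixtureModel d K}
    {P : Measure Ω} {y : ι → Ω → Fin K} {z : ι → Ω → EucSp d} (h : IsNoiseSample θ P y z)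
    {f : ι' → ι} (hf : Function.Injective f) :
    IsNoiseSample θ P (fun i => y (f i)) (fun i => z (f i)) where
  measurable_label _ := h.measurable_label _
  measurable_noise _ := h.measurable_noise _
  indep := h.indep.precomp hf
  indep_label_noise _ := h.indep_label_noise _
  label_law _ := h.label_law _
  noise_law _ := h.noise_law _

theorem sub_sq_le_three (x x' t t' : ℝ) :
    (x' - t') ^ 2 ≤ 3 * (x - t) ^ 2 + 3 * (x - x') ^ 2 + 3 * (t - t') ^ 2 := by
  nlinarith [sq_nonneg ((x - t) + (x - x')), sq_nonneg ((x - t) - (t - t')),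
    sq_nonneg ((x - x') + (t - t'))]

theorem sqDistPair_le_three {x x' t₁ t₁' t₂ t₂' η : ℝ} (h1 : |t₁ - t₁'| ≤ η)
    (h2 : |t₂ - t₂'| ≤ η) :
    sqDistPair t₁' t₂' x' ≤ 3 * sqDistPair t₁ t₂ x + 3 * (x - x') ^ 2 + 3 * η ^ 2 := by
  have e1 : (t₁ - t₁') ^ 2 ≤ η ^ 2 := by rw [← sq_abs]; gcongr
  have e2 : (t₂ - t₂') ^ 2 ≤ η ^ 2 := by rw [← sq_abs]; gcongr
  have f1 := sub_sq_le_three x x' t₁ t₁'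
  have f2 := sub_sq_le_three x x' t₂ t₂'
  unfold sqDistPair
  rcases min_cases ((x - t₁) ^ 2) ((x - t₂) ^ 2) with hc | hc
  · rw [hc.1]; exact (min_le_left _ _).trans (by linarith)
  · rw [hc.1]; exact (min_le_right _ _).trans (by linarith)

theorem le_sum_sqDistPair_of_net {y : Fin m → Fin K} {z : Fin m → EucSp d} {a M C T η : ℝ}
    (hT : 0 < T) (hM : 0 < M) (hC0 : 0 ≤ C)
    (hC : ∀ b : EucSp d, ∑ i, (inner ℝ b (z i)) ^ 2 ≤ C * m * ‖b‖ ^ 2)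
    {N : Finset (EucSp d)} (hN : ∀ x : EucSp d, ‖x‖ = 1 → ∃ c ∈ N, ‖x - c‖ ≤ η)
    {F : Finset ℝ} (hF : ∀ t : ℝ, |t| ≤ T → ∃ t' ∈ F, |t - t'| ≤ η) (k : Fin K)
    (hnet : ∀ c ∈ N, ∀ t₁ ∈ F, ∀ t₂ ∈ F,
      a * m ≤ ∑ i with y i = k, min (sqDistPair t₁ t₂ (inner ℝ c (z i))) M)
    (hparam : 3 * C * η ^ 2 + 3 * η ^ 2 + M / T ^ 2 * C ≤ a / 2)
    {e : EucSp d} (he : ‖e‖ = 1) (t₁ t₂ : ℝ) :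
    a / 6 * m ≤ ∑ i with y i = k, sqDistPair t₁ t₂ (inner ℝ e (z i)) := by
  obtain ⟨c, hcN, hec⟩ := hN e he
  obtain ⟨s₁, hs₁, hts₁⟩ := hF _ (abs_clampTo_le hT.le t₁)
  obtain ⟨s₂, hs₂, hts₂⟩ := hF _ (abs_clampTo_le hT.le t₂)
  have h1 := hnet c hcN s₁ hs₁ s₂ hs₂
  have hpt : ∀ i, min (sqDistPair s₁ s₂ (inner ℝ c (z i))) M ≤
      3 * sqDistPair t₁ t₂ (inner ℝ e (z i)) +
      (3 * (inner ℝ (e - c) (z i)) ^ 2 + 3 * η ^ 2 + M / T ^ 2 * (inner ℝ e (z i)) ^ 2) := by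
    intro i
    have h0 := sqDistPair_nonneg t₁ t₂ (inner ℝ e (z i))
    rcases le_or_gt |inner ℝ e (z i)| T with hx | hx
    · have e1 := sqDistPair_le_three (x := inner ℝ e (z i)) (x' := inner ℝ c (z i)) hts₁ hts₂
      have e2 := sqDistPair_clampTo_le hx t₁ t₂
      have e3 : 0 ≤ M / T ^ 2 * (inner ℝ e (z i)) ^ 2 := by positivity
      rw [inner_sub_left]
      exact (min_le_left _ _).trans (by linarith)
    · have e3 : M ≤ M / T ^ 2 * (inner ℝ e (z i)) ^ 2 := by
        rw [div_mul_eq_mul_div, le_div_iff₀ (by positivity), ← sq_abs (inner ℝ e (z i))]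
        gcongr
      refine (min_le_right _ _).trans ?_
      have : 0 ≤ 3 * (inner ℝ (e - c) (z i)) ^ 2 + 3 * η ^ 2 := by positivity
      linarith
  have hrest : ∑ i with y i = k, (3 * (inner ℝ (e - c) (z i)) ^ 2 + 3 * η ^ 2 +
      M / T ^ 2 * (inner ℝ e (z i)) ^ 2) ≤ a / 2 * m := by
    calc _ ≤ ∑ i, (3 * (inner ℝ (e - c) (z i)) ^ 2 + 3 * η ^ 2 +
          M / T ^ 2 * (inner ℝ e (z i)) ^ 2) :=
          Finset.sum_le_sum_of_subset_of_nonneg (Finset.filter_subset _ _)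
            fun i _ _ => by positivity
      _ = 3 * ∑ i, (inner ℝ (e - c) (z i)) ^ 2 + 3 * η ^ 2 * m +
          M / T ^ 2 * ∑ i, (inner ℝ e (z i)) ^ 2 := by
          rw [Finset.sum_add_distrib, Finset.sum_add_distrib, Finset.mul_sum, Finset.mul_sum]
          simp; ring
      _ ≤ 3 * (C * m * η ^ 2) + 3 * η ^ 2 * m + M / T ^ 2 * (C * m * 1) := by
          gcongr
          · exact (hC _).trans (by gcongr)
          · have := hC e
            rwa [he, one_pow] at this
      _ = (3 * C * η ^ 2 + 3 * η ^ 2 + M / T ^ 2 * C) * m := by ring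
      _ ≤ _ := by gcongr
  have h2 := h1.trans (Finset.sum_le_sum fun i _ => hpt i)
  rw [Finset.sum_add_distrib, ← Finset.mul_sum] at h2
  linarith

theorem sqDistPair_add_mul {c : ℝ} (hc : 0 < c) (β x : ℝ) :
    sqDistPair 0 1 (β + c * x) = c ^ 2 * sqDistPair (-β / c) ((1 - β) / c) x := by
  unfold sqDistPair
  rw [mul_min_of_nonneg _ _ (sq_nonneg c), ← mul_pow, ← mul_pow]
  congr 2 <;> field_simp <;> ring

theorem goodSample_of_unit {y : Fin m → Fin K} {z : Fin m → EucSp d} {κ C : ℝ}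
    (h1 : ∀ k, κ * m ≤ ((Finset.univ.filter fun i => y i = k).card : ℝ))
    (h2 : ∀ b : EucSp d, ∑ i, (inner ℝ b (z i)) ^ 2 ≤ C * m * ‖b‖ ^ 2)
    (h3 : ∀ e : EucSp d, ‖e‖ = 1 → ∀ (t₁ t₂ : ℝ) (k : Fin K),
      κ * m ≤ ∑ i with y i = k, sqDistPair t₁ t₂ (inner ℝ e (z i))) :
    GoodSample κ C y z := by
  refine ⟨h1, h2, fun b β k => ?_⟩
  rcases eq_or_ne b 0 with rfl | hb
  · simp only [norm_zero, ne_eq, OfNat.ofNat_ne_zero, not_false_eq_true, zero_pow, mul_zero]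
    exact Finset.sum_nonneg fun i _ => sqDistPair_nonneg _ _ _
  have hb0 : 0 < ‖b‖ := norm_pos_iff.2 hb
  have he : ‖(‖b‖⁻¹ • b)‖ = 1 := norm_smul_inv_norm hb
  have hinner : ∀ i, inner ℝ b (z i) = ‖b‖ * inner ℝ (‖b‖⁻¹ • b) (z i) := fun i => by
    rw [real_inner_smul_left, mul_inv_cancel_left₀ hb0.ne']
  simp_rw [hinner, sqDistPair_add_mul hb0]
  rw [← Finset.mul_sum, mul_comm]
  exact mul_le_mul_of_nonneg_left (h3 _ he _ _ k) (by positivity)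

theorem exists_real_net {T η : ℝ} (hη : 0 < η) :
    ∃ F : Finset ℝ, ∀ t : ℝ, |t| ≤ T → ∃ t' ∈ F, |t - t'| ≤ η := by
  obtain ⟨s, -, hsf, hs⟩ := (isCompact_Icc (a := -T) (b := T)).finite_cover_balls hη
  refine ⟨hsf.toFinset, fun t ht => ?_⟩
  have := hs (abs_le.1 ht)
  simp only [Set.mem_iUnion, Metric.mem_ball, Real.dist_eq] at this
  obtain ⟨t', ht', hlt⟩ := this
  exact ⟨t', by simpa using ht', hlt.le⟩

/-- The linear map `b ↦ (⟪b, z i⟫)_i`. -/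
noncomputable def innerMap (z : Fin m → EucSp d) : EucSp d →L[ℝ] EuclideanSpace ℝ (Fin m) :=
  (PiLp.continuousLinearEquiv 2 ℝ (fun _ : Fin m => ℝ)).symm.toContinuousLinearMap ∘L
    ContinuousLinearMap.pi fun i => innerSL ℝ (z i)

theorem norm_innerMap_sq (z : Fin m → EucSp d) (b : EucSp d) :
    ‖innerMap z b‖ ^ 2 = ∑ i, (inner ℝ b (z i)) ^ 2 := by
  rw [EuclideanSpace.real_norm_sq_eq]
  simp [innerMap, real_inner_comm]

theorem sum_inner_sq_le_of_net {z : Fin m → EucSp d} {C : ℝ} (hC : 0 ≤ C)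
    {N : Finset (EucSp d)} (hN : ∀ x : EucSp d, ‖x‖ = 1 → ∃ c ∈ N, ‖x - c‖ ≤ 1 / 2)
    (hle : ∀ c ∈ N, ∑ i, (inner ℝ c (z i)) ^ 2 ≤ C * m) (b : EucSp d) :
    ∑ i, (inner ℝ b (z i)) ^ 2 ≤ 4 * C * m * ‖b‖ ^ 2 := by
  have h := norm_apply_le_of_unit_net (innerMap z) (N := (N : Set (EucSp d))) (B := √(C * m))
    (Real.sqrt_nonneg _) hN (fun c hc => by
      refine Real.le_sqrt_of_sq_le ?_
      rw [norm_innerMap_sq]; exact hle c hc) b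
  rw [← norm_innerMap_sq]
  calc ‖innerMap z b‖ ^ 2 ≤ (2 * √(C * m) * ‖b‖) ^ 2 := by gcongr
    _ = 4 * (√(C * m)) ^ 2 * ‖b‖ ^ 2 := by ring
    _ = _ := by rw [Real.sq_sqrt (by positivity)]; ring

variable {Ω : Type*} [MeasurableSpace Ω] {P : Measure Ω} [IsProbabilityMeasure P]
  {θ : MixtureModel d K} {y : Fin m → Ω → Fin K} {z : Fin m → Ω → EucSp d}

theorem IsNoiseSample.measureReal_le_sum_inner_sq {σ : ℝ} (hs : IsNoiseSample θ P y z) (hσ : 0 < σ)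
    (hT2 : IsT2 σ θ.noise) {e : EucSp d} (he : ‖e‖ = 1) :
    P.real {ω | 28 * σ ^ 2 * m ≤ ∑ i, (inner ℝ e (z i ω)) ^ 2} ≤ Real.exp (-5 * m) := by
  have := θ.noise_prob
  have hmeas : ∀ i, Measurable fun ω => (inner ℝ e (z i ω)) ^ 2 := fun i => by
    have := hs.measurable_noise i; fun_prop
  have hind : iIndepFun (fun i ω => (inner ℝ e (z i ω)) ^ 2) P :=
    hs.indep.comp (fun _ q => (inner ℝ e q.2) ^ 2) fun i => by fun_prop
  have hexp := hT2.integrable_exp_inner_sq hσ he (θ.integrable_noise_inner e)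
    (θ.integral_noise_inner e)
  have hexp3 := hT2.integral_exp_inner_sq_le hσ he (θ.integrable_noise_inner e)
    (θ.integral_noise_inner e)
  have hcong : ∀ x : ℝ, Real.exp (1 / (4 * σ ^ 2) * x ^ 2) = Real.exp (x ^ 2 / (4 * σ ^ 2)) :=
    fun x => by congr 1; ring
  have h := measureReal_le_sum_le_exp hmeas hind (l := 1 / (4 * σ ^ 2)) (C := 28 * σ ^ 2)
    (by positivity)
    (fun i => by
      simp_rw [hcong]
      rw [← hs.noise_law i] at hexp
      exact hexp.comp_measurable (hs.measurable_noise i))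
    (fun i => by
      simp_rw [hcong]
      rw [← hs.noise_law i, integral_map (hs.measurable_noise i).aemeasurable (by fun_prop)] at hexp3
      exact hexp3)
  rw [Fintype.card_fin] at h
  refine h.trans (le_of_eq ?_)
  congr 2
  field_simp
  norm_num

theorem IsNoiseSample.integral_indicator_mul {P : Measure Ω} (hs : IsNoiseSample θ P y z)
    (i : Fin m) (k : Fin K) {f : EucSp d → ℝ} (hf : Measurable f) :
    ∫ ω, (if y i ω = k then (1 : ℝ) else 0) * f (z i ω) ∂P =
      θ.weight k * ∫ u, f u ∂θ.noise := by
  have h1 := (hs.indep_label_noise i).integral_fun_comp_mul_comp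
    (f := fun j : Fin K => if j = k then (1 : ℝ) else 0) (g := f)
    (hs.measurable_label i).aemeasurable (hs.measurable_noise i).aemeasurable
    (measurable_of_countable _).aestronglyMeasurable hf.aestronglyMeasurable
  rw [h1, ← hs.noise_law i,
    integral_map (hs.measurable_noise i).aemeasurable hf.aestronglyMeasurable]
  congr 1
  have hset : MeasurableSet {ω | y i ω = k} := hs.measurable_label i (measurableSet_singleton k)
  rw [← hs.label_law i k, ← integral_indicator_one hset]
  refine integral_congr_ae (ae_of_all _ fun ω => ?_)
  simp [Set.indicator_apply]

theorem IsNoiseSample.measureReal_sum_label_le {p a M : ℝ} (hs : IsNoiseSample θ P y z)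
    (k : Fin K) (hp : 0 ≤ p) (hw : p ≤ θ.weight k) {f : EucSp d → ℝ} (hf : Measurable f)
    (hM : 0 < M) (h0 : ∀ u, 0 ≤ f u) (h1 : ∀ u, f u ≤ M) (ha : 0 ≤ a) (hfa : a ≤ ∫ u, f u ∂θ.noise) :
    P.real {ω | ∑ i with y i ω = k, f (z i ω) ≤ p * a / 4 * m} ≤
      Real.exp (-(p * a / (4 * M)) * m) := by
  have hmk : Measurable fun j : Fin K => if j = k then (1 : ℝ) else 0 := measurable_of_countable _
  have hmeas : ∀ i, Measurable fun ω => (if y i ω = k then (1 : ℝ) else 0) * f (z i ω) := fun i =>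
    (hmk.comp (hs.measurable_label i)).mul (hf.comp (hs.measurable_noise i))
  have hind : iIndepFun (fun i ω => (if y i ω = k then (1 : ℝ) else 0) * f (z i ω)) P :=
    hs.indep.comp (fun _ q => (if q.1 = k then (1 : ℝ) else 0) * f q.2) fun i =>
      (hmk.comp measurable_fst).mul (hf.comp measurable_snd)
  have h := measureReal_sum_le_le_exp hmeas hind hM (a := p * a)
    (fun i ω => by have := h0 (z i ω); split_ifs <;> simp [this])
    (fun i ω => by have := h1 (z i ω); split_ifs <;> simp [this, hM.le])
    (fun i => by rw [hs.integral_indicator_mul i k hf]; gcongr; exact hp.trans hw)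
  rw [Fintype.card_fin] at h
  simpa [Finset.sum_filter] using h

end GoodSample

theorem exists_measureReal_not_goodSample_le {σ p : ℝ} (hσ : 0 < σ) (hp : 0 < p) :
    ∃ κ C B γ : ℝ, 0 < κ ∧ 0 < C ∧ 1 ≤ B ∧ 0 < γ ∧
      ∀ {d K m : ℕ} {Ω : Type*} [MeasurableSpace Ω] {P : Measure Ω} [IsProbabilityMeasure P]
        {θ : MixtureModel d K} {y : Fin m → Ω → Fin K} {z : Fin m → Ω → EucSp d},
        1 ≤ K → IsT2 σ θ.noise → (∀ j, p ≤ θ.weight j) → IsNoiseSample θ P y z →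
        P.real {ω | ¬ GoodSample κ C (fun i => y i ω) (fun i => z i ω)} ≤
          K * B ^ (d + 1) * Real.exp (-γ * m) := by
  obtain ⟨a, M, ha, hM, hpop⟩ := exists_le_integral_min_sqDistPair hσ
  set C : ℝ := 4 * (28 * σ ^ 2) with hC
  have hC0 : 0 < C := by positivity
  set A : ℝ := p * a / 4 with hA
  have hA0 : 0 < A := by positivity
  obtain ⟨T, hT0, hT⟩ : ∃ T : ℝ, 0 < T ∧ M / T ^ 2 * C ≤ A / 6 := by
    refine ⟨√(6 * M * C / A), Real.sqrt_pos.2 (by positivity), ?_⟩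
    rw [Real.sq_sqrt (by positivity)]
    refine le_of_eq ?_
    field_simp
  obtain ⟨k₀, hk₀⟩ : ∃ k₀ : ℕ, 3 * C * (2 * (1 / 2 : ℝ) ^ k₀) ^ 2 ≤ A / 6 ∧
      3 * (2 * (1 / 2 : ℝ) ^ k₀) ^ 2 ≤ A / 6 := by
    have h0 : Tendsto (fun k : ℕ => (1 / 2 : ℝ) ^ k) atTop (𝓝 0) :=
      tendsto_pow_atTop_nhds_zero_of_lt_one (by norm_num) (by norm_num)
    have h1 : Tendsto (fun k : ℕ => 3 * C * (2 * (1 / 2 : ℝ) ^ k) ^ 2) atTop (𝓝 0) := by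
      simpa using ((h0.const_mul 2).pow 2).const_mul (3 * C)
    have h2 : Tendsto (fun k : ℕ => 3 * (2 * (1 / 2 : ℝ) ^ k) ^ 2) atTop (𝓝 0) := by
      simpa using ((h0.const_mul 2).pow 2).const_mul 3
    exact ((h1.eventually (ge_mem_nhds (by positivity))).and
      (h2.eventually (ge_mem_nhds (by positivity)))).exists
  set η : ℝ := 2 * (1 / 2 : ℝ) ^ k₀ with hη
  have hη0 : 0 < η := by positivity
  obtain ⟨F, hF⟩ := exists_real_net (T := T) hη0
  set γ : ℝ := min 5 (min (p * a / (4 * M)) (p / 4)) with hγ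
  have hγ0 : 0 < γ := by positivity
  set B : ℝ := 25 * 5 ^ k₀ * (F.card ^ 2 + 2) with hB
  have h5k : (1 : ℝ) ≤ 5 ^ k₀ := one_le_pow₀ (by norm_num)
  have hB1 : 1 ≤ B := by
    rw [hB]; nlinarith [sq_nonneg (F.card : ℝ), mul_nonneg (by linarith : (0 : ℝ) ≤ 5 ^ k₀ - 1) (sq_nonneg (F.card : ℝ))]
  refine ⟨min (A / 6) (p / 4), C, B, γ, by positivity, hC0, hB1, hγ0, ?_⟩
  intro d K m Ω _ P _ θ y z hK hT2 hw hs
  have := θ.noise_prob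
  obtain ⟨N₂, hN₂card, hN₂unit, hN₂⟩ := exists_unit_net d 2
  obtain ⟨N, hNcard, hNunit, hN⟩ := exists_unit_net d k₀
  set E₁ : Set Ω := ⋃ c ∈ N₂, {ω | 28 * σ ^ 2 * m ≤ ∑ i, (inner ℝ c (z i ω)) ^ 2} with hE₁
  set I : Finset (Fin K × EucSp d × ℝ × ℝ) := Finset.univ ×ˢ N ×ˢ F ×ˢ F with hI
  set E₂ : Set Ω := ⋃ q ∈ I, {ω | ∑ i with y i ω = q.1,
      min (sqDistPair q.2.2.1 q.2.2.2 (inner ℝ q.2.1 (z i ω))) M ≤ A * m} with hE₂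
  set E₃ : Set Ω := ⋃ k ∈ (Finset.univ : Finset (Fin K)),
      {ω | ∑ i with y i ω = k, (1 : ℝ) ≤ p * 1 / 4 * m} with hE₃
  have hsub : {ω | ¬ GoodSample (min (A / 6) (p / 4)) C (fun i => y i ω) (fun i => z i ω)} ⊆
      E₁ ∪ (E₂ ∪ E₃) := by
    intro ω hω
    by_contra hcon
    simp only [hE₁, hE₂, hE₃, Set.mem_union, Set.mem_iUnion, Set.mem_ofPred_eq, not_or, not_exists,
      not_le] at hcon
    obtain ⟨h1, h2, h3⟩ := hcon
    refine hω ?_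
    have hsq : ∀ b : EucSp d, ∑ i, (inner ℝ b (z i ω)) ^ 2 ≤ C * m * ‖b‖ ^ 2 :=
      sum_inner_sq_le_of_net (by positivity) (fun x hx => by
        obtain ⟨c, hc, hxc⟩ := hN₂ x hx
        exact ⟨c, hc, hxc.trans (by norm_num)⟩) fun c hc => (h1 c hc).le
    refine goodSample_of_unit (fun k => ?_) hsq fun e he t₁ t₂ k => ?_
    · have := (h3 k (Finset.mem_univ _)).le
      simp only [Finset.sum_const, nsmul_eq_mul, mul_one] at this
      exact (mul_le_mul_of_nonneg_right (min_le_right _ _) (by positivity)).trans this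
    · refine (mul_le_mul_of_nonneg_right (min_le_left _ _) (by positivity)).trans ?_
      refine le_sum_sqDistPair_of_net hT0 hM hC0.le hsq hN hF k (fun c hc s₁ hs₁ s₂ hs₂ => ?_)
        (by linarith [hk₀.1, hk₀.2]) he t₁ t₂
      exact (h2 (k, c, s₁, s₂) (by simp [hI, hc, hs₁, hs₂])).le
  have hexp : ∀ {g : ℝ}, γ ≤ g → Real.exp (-g * m) ≤ Real.exp (-γ * m) := fun hg => by
    refine Real.exp_le_exp.2 ?_
    have : (0 : ℝ) ≤ m := by positivity
    nlinarith
  have hP₁ : P.real E₁ ≤ 25 ^ d * Real.exp (-γ * m) := by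
    refine (measureReal_biUnion_finset_le _ _).trans ?_
    calc _ ≤ ∑ c ∈ N₂, Real.exp (-γ * m) := Finset.sum_le_sum fun c hc =>
          (hs.measureReal_le_sum_inner_sq hσ hT2 (hN₂unit c hc)).trans (hexp (min_le_left _ _))
      _ = N₂.card * Real.exp (-γ * m) := by simp
      _ ≤ _ := by
          gcongr
          calc (N₂.card : ℝ) ≤ (((5 ^ 2) ^ d : ℕ) : ℝ) := by exact_mod_cast hN₂card
            _ = 25 ^ d := by push_cast; norm_num
  have hP₂ : P.real E₂ ≤ K * ((5 ^ k₀) ^ d * F.card ^ 2) * Real.exp (-γ * m) := by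
    refine (measureReal_biUnion_finset_le _ _).trans ?_
    calc _ ≤ ∑ c ∈ I, Real.exp (-γ * m) := Finset.sum_le_sum fun q hq => by
          simp only [hI, Finset.mem_product, Finset.mem_univ, true_and] at hq
          refine (hs.measureReal_sum_label_le q.1 hp.le (hw _)
            (f := fun u => min (sqDistPair q.2.2.1 q.2.2.2 (inner ℝ q.2.1 u)) M)
            (((continuous_sqDistPair _ _).comp (by fun_prop)).min continuous_const).measurable hM
            (fun u => le_min (sqDistPair_nonneg _ _ _) hM.le) (fun u => min_le_right _ _) ha.le
            (hpop θ hT2 _ (hNunit _ hq.1) _ _)).trans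
            (hexp ((min_le_right _ _).trans (min_le_left _ _)))
      _ = K * (N.card * F.card ^ 2) * Real.exp (-γ * m) := by
          rw [Finset.sum_const, nsmul_eq_mul, hI]
          simp only [Finset.card_product, Finset.card_univ, Fintype.card_fin]
          push_cast; ring
      _ ≤ _ := by
          gcongr
          exact_mod_cast hNcard
  have hP₃ : P.real E₃ ≤ K * Real.exp (-γ * m) := by
    refine (measureReal_biUnion_finset_le _ _).trans ?_
    calc _ ≤ ∑ k : Fin K, Real.exp (-γ * m) := Finset.sum_le_sum fun k _ => by
          refine (hs.measureReal_sum_label_le k hp.le (hw _) (f := fun _ => (1 : ℝ)) (M := 1)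
            measurable_const zero_lt_one (fun _ => zero_le_one) (fun _ => le_rfl) zero_le_one
            (by simp)).trans (hexp ?_)
          rw [mul_one, mul_one]
          exact (min_le_right _ _).trans (min_le_right _ _)
      _ = _ := by simp
  have hK1 : (1 : ℝ) ≤ K := by exact_mod_cast hK
  have hB25 : (25 : ℝ) ^ d ≤ B ^ d := by
    gcongr; rw [hB]; nlinarith [sq_nonneg (F.card : ℝ), mul_nonneg (by linarith : (0 : ℝ) ≤ 5 ^ k₀ - 1) (sq_nonneg (F.card : ℝ))]
  have hB5 : ((5 : ℝ) ^ k₀) ^ d ≤ B ^ d := by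
    gcongr; rw [hB]; nlinarith [sq_nonneg (F.card : ℝ), mul_nonneg (by linarith : (0 : ℝ) ≤ 5 ^ k₀) (sq_nonneg (F.card : ℝ))]
  have hBd : (1 : ℝ) ≤ B ^ d := one_le_pow₀ hB1
  have hBF : (F.card : ℝ) ^ 2 + 2 ≤ B := by
    rw [hB]
    refine le_mul_of_one_le_left (by positivity) (by linarith)
  have hcoef : 25 ^ d + (K * ((5 ^ k₀) ^ d * (F.card : ℝ) ^ 2) + K) ≤ K * B ^ (d + 1) := by
    calc _ ≤ K * B ^ d + (K * (B ^ d * (F.card : ℝ) ^ 2) + K * B ^ d) := by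
          gcongr
          · exact hB25.trans (le_mul_of_one_le_left (by positivity) hK1)
          · exact le_mul_of_one_le_right (by positivity) hBd
      _ = K * B ^ d * (F.card ^ 2 + 2) := by ring
      _ ≤ K * B ^ d * B := by gcongr
      _ = _ := by rw [pow_succ]; ring
  calc _ ≤ P.real (E₁ ∪ (E₂ ∪ E₃)) := measureReal_mono hsub
    _ ≤ P.real E₁ + (P.real E₂ + P.real E₃) :=
        (measureReal_union_le _ _).trans (by gcongr; exact measureReal_union_le _ _)
    _ ≤ 25 ^ d * Real.exp (-γ * m) + (K * ((5 ^ k₀) ^ d * F.card ^ 2) * Real.exp (-γ * m) +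
        K * Real.exp (-γ * m)) := by gcongr
    _ = (25 ^ d + (K * ((5 ^ k₀) ^ d * (F.card : ℝ) ^ 2) + K)) * Real.exp (-γ * m) := by ring
    _ ≤ _ := by gcongr

section Signal

theorem exists_adjoint_apply_eq {E F : Type*} [NormedAddCommGroup E] [InnerProductSpace ℝ E]
    [FiniteDimensional ℝ E] [NormedAddCommGroup F] [InnerProductSpace ℝ F] [FiniteDimensional ℝ F]
    (T : E →ₗ[ℝ] F) {n : ℕ} (hn : Module.finrank ℝ E = n) (hn2 : 2 ≤ n) {R : ℝ} (hR : 0 < R)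
    (hsv : R ≤ T.singularValues (n - 2)) {w : E} (hw : w ≠ 0) (hTw : T w = 0) {c : E}
    (hc : inner ℝ w c = 0) :
    ∃ b : F, (∀ v : E, inner ℝ b (T v) = inner ℝ c v) ∧ R ^ 2 * ‖b‖ ^ 2 ≤ ‖c‖ ^ 2 := by
  classical
  have hS := T.isSymmetric_adjoint_comp_self
  set e := hS.eigenvectorBasis hn with he
  set l := hS.eigenvalues hn with hl
  have hTe : ∀ i, (LinearMap.adjoint T ∘ₗ T) (e i) = l i • e i := fun i =>
    hS.apply_eigenvectorBasis hn i
  have hbig : ∀ i : Fin n, (i : ℕ) ≠ n - 1 → R ^ 2 ≤ l i := by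
    intro i hi
    rw [hl, ← T.sq_singularValues_fin hn i]
    have : T.singularValues (n - 2) ≤ T.singularValues i :=
      T.singularValues_antitone (by have := i.2; omega)
    have := hsv.trans this
    gcongr
  have hlast : ∀ i : Fin n, (i : ℕ) = n - 1 → inner ℝ (e i) c = 0 := by
    intro i hi
    have hzero : ∀ j, j ≠ i → inner ℝ (e j) w = 0 := by
      intro j hj
      have h1 : l j * inner ℝ (e j) w = 0 := by
        rw [← real_inner_smul_left, ← hTe j, hS (e j) w]
        simp [hTw]
      have h2 := hbig j (fun h => hj (Fin.ext (h.trans hi.symm)))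
      have h3 : 0 < l j := lt_of_lt_of_le (by positivity) h2
      exact (mul_eq_zero.1 h1).resolve_left h3.ne'
    have hwsum : w = inner ℝ (e i) w • e i := by
      conv_lhs => rw [← e.sum_repr' w]
      rw [Finset.sum_eq_single i (fun j _ hj => by rw [hzero j hj, zero_smul]) (by simp)]
    have hne : inner ℝ (e i) w ≠ 0 := by
      intro h; rw [h, zero_smul] at hwsum; exact hw hwsum
    rw [hwsum, real_inner_smul_left] at hc
    exact (mul_eq_zero.1 hc).resolve_left hne
  set g : E := ∑ i, (inner ℝ (e i) c / l i) • e i with hg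
  have hgc : (LinearMap.adjoint T ∘ₗ T) g = c := by
    rw [hg, map_sum]
    conv_rhs => rw [← e.sum_repr' c]
    refine Finset.sum_congr rfl fun i _ => ?_
    rw [map_smul, hTe, smul_smul]
    by_cases hi : (i : ℕ) = n - 1
    · simp [hlast i hi]
    · have h3 : 0 < l i := lt_of_lt_of_le (by positivity) (hbig i hi)
      rw [div_mul_cancel₀ _ h3.ne']
  refine ⟨T g, fun v => ?_, ?_⟩
  · rw [← LinearMap.adjoint_inner_left, ← LinearMap.comp_apply, hgc]
  · have h1 : ‖T g‖ ^ 2 = ∑ i, (inner ℝ (e i) c) ^ 2 / l i := by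
      rw [← real_inner_self_eq_norm_sq, ← LinearMap.adjoint_inner_left, ← LinearMap.comp_apply, hgc,
        hg, inner_sum]
      refine Finset.sum_congr rfl fun i _ => ?_
      rw [real_inner_smul_right, real_inner_comm]; ring
    rw [h1, Finset.mul_sum]
    have h2 : ‖c‖ ^ 2 = ∑ i, (inner ℝ (e i) c) ^ 2 := by
      rw [← e.sum_sq_norm_inner_right c]; simp
    rw [h2]
    refine Finset.sum_le_sum fun i _ => ?_
    by_cases hi : (i : ℕ) = n - 1
    · simp [hlast i hi]
    · have h3 : 0 < l i := lt_of_lt_of_le (by positivity) (hbig i hi)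
      rw [mul_div_assoc', div_le_iff₀ h3, mul_comm]
      exact mul_le_mul_of_nonneg_left (hbig i hi) (sq_nonneg _)

variable {d K : ℕ}

theorem MixtureModel.sum_weight_smul_center_sub (θ : MixtureModel d K) :
    ∑ k, θ.weight k • (θ.center k - θ.meanCenter) = 0 := by
  simp_rw [smul_sub]
  rw [Finset.sum_sub_distrib, ← Finset.sum_smul, θ.weight_sum, one_smul]
  simp [MixtureModel.meanCenter]

/-- The indicator of a class is, on the class centers, an affine function with small slope. -/
theorem MixtureModel.SignalStrength.exists_affine {θ : MixtureModel d K} {R : ℝ}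
    (h : θ.SignalStrength R) (hK : 2 ≤ K) (j : Fin K) :
    ∃ (α : ℝ) (b : EucSp d), (∀ k, α + inner ℝ b
        (Matrix.toEuclideanCLM (𝕜 := ℝ) (invSqrt θ.cov) (θ.center k - θ.meanCenter)) =
        if k = j then 1 else 0) ∧ R ^ 2 * ‖b‖ ^ 2 ≤ K := by
  obtain ⟨-, hR, hsv⟩ := h
  set W := Matrix.toEuclideanCLM (𝕜 := ℝ) (invSqrt θ.cov) with hW
  set T := Matrix.toLpLin 2 2 θ.signalMatrix with hT
  have hTapply : ∀ v : EuclideanSpace ℝ (Fin K), T v =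
      ∑ k, v k • W (θ.center k - θ.meanCenter) := by
    intro v
    ext a
    simp only [hT, Matrix.toLpLin_apply, Matrix.mulVec, dotProduct, MixtureModel.signalMatrix,
      Matrix.of_apply]
    simp [hW, mul_comm]
  set w : EuclideanSpace ℝ (Fin K) := WithLp.toLp 2 θ.weight with hw
  have hw0 : w ≠ 0 := by
    intro h0
    have : ∀ k, θ.weight k = 0 := fun k => by
      have := congrArg (fun v : EuclideanSpace ℝ (Fin K) => v k) h0
      simpa [hw] using this
    have h1 := θ.weight_sum
    simp [this] at h1
  have hTw : T w = 0 := by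
    rw [hTapply]
    have : ∀ k, w k • W (θ.center k - θ.meanCenter) =
        W (θ.weight k • (θ.center k - θ.meanCenter)) := fun k => by rw [map_smul]
    simp_rw [this]
    rw [← map_sum, θ.sum_weight_smul_center_sub, map_zero]
  set c : EuclideanSpace ℝ (Fin K) :=
    WithLp.toLp 2 fun k => (if k = j then 1 else 0) - θ.weight j with hc
  have hwc : inner ℝ w c = 0 := by
    simp only [PiLp.inner_apply, hw, hc]
    simp [sub_mul, Finset.sum_sub_distrib, ← Finset.mul_sum, θ.weight_sum]
  obtain ⟨b, hb1, hb2⟩ := exists_adjoint_apply_eq T (by simp) hK hR hsv hw0 hTw hwc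
  refine ⟨θ.weight j, b, fun k => ?_, hb2.trans ?_⟩
  · have h1 := hb1 (EuclideanSpace.single k 1)
    have h2 : T (EuclideanSpace.single k 1) = W (θ.center k - θ.meanCenter) := by
      rw [hTapply, Finset.sum_eq_single k]
      · simp
      · intro i _ hi; simp [hi]
      · simp
    rw [h2] at h1
    rw [h1]
    simp [hc, EuclideanSpace.inner_single_right]
  · rw [EuclideanSpace.real_norm_sq_eq]
    have hwj : θ.weight j ≤ 1 := by
      rw [← θ.weight_sum]
      exact Finset.single_le_sum (fun i _ => θ.weight_nonneg i) (Finset.mem_univ j)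
    have hwj0 := θ.weight_nonneg j
    calc ∑ k, c k ^ 2 ≤ ∑ _k : Fin K, (1 : ℝ) := Finset.sum_le_sum fun k _ => by
          simp only [hc]; split_ifs <;> nlinarith
      _ = K := by simp

end Signal

section Whitening

variable {d m : ℕ}

theorem sqrt_isHermitian (A : Matrix (Fin d) (Fin d) ℝ) : (CFC.sqrt A).IsHermitian :=
  (Matrix.nonneg_iff_posSemidef.1 (CFC.sqrt_nonneg A)).isHermitian

theorem invSqrt_isHermitian (A : Matrix (Fin d) (Fin d) ℝ) : (invSqrt A).IsHermitian :=
  (sqrt_isHermitian A).inv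

theorem sqrt_mul_sqrt {A : Matrix (Fin d) (Fin d) ℝ} (hA : A.PosSemidef) :
    CFC.sqrt A * CFC.sqrt A = A :=
  CFC.sqrt_mul_sqrt_self A (Matrix.nonneg_iff_posSemidef.2 hA)

theorem isUnit_det_sqrt {A : Matrix (Fin d) (Fin d) ℝ} (hA : A.PosDef) :
    IsUnit (CFC.sqrt A).det := by
  have h1 : (CFC.sqrt A).det * (CFC.sqrt A).det = A.det := by
    rw [← Matrix.det_mul, sqrt_mul_sqrt hA.posSemidef]
  refine isUnit_iff_ne_zero.2 fun h0 => ?_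
  rw [h0, mul_zero] at h1
  exact hA.det_pos.ne h1

theorem invSqrt_mul_sqrt {A : Matrix (Fin d) (Fin d) ℝ} (hA : A.PosDef) :
    invSqrt A * CFC.sqrt A = 1 :=
  Matrix.nonsing_inv_mul _ (isUnit_det_sqrt hA)

theorem invSqrt_mul_invSqrt {A : Matrix (Fin d) (Fin d) ℝ} (hA : A.PosSemidef) :
    invSqrt A * invSqrt A = A⁻¹ := by
  rw [invSqrt, ← Matrix.mul_inv_rev, sqrt_mul_sqrt hA]

theorem inner_toEuclideanCLM_left {A : Matrix (Fin d) (Fin d) ℝ} (hA : A.IsHermitian)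
    (u v : EucSp d) :
    inner ℝ (Matrix.toEuclideanCLM (𝕜 := ℝ) A u) v =
      inner ℝ u (Matrix.toEuclideanCLM (𝕜 := ℝ) A v) := by
  have h : star (Matrix.toEuclideanCLM (𝕜 := ℝ) A) = Matrix.toEuclideanCLM (𝕜 := ℝ) A := by
    rw [← map_star]; congr 1
  rw [← ContinuousLinearMap.adjoint_inner_right, ← ContinuousLinearMap.star_eq_adjoint, h]

theorem toEuclideanCLM_mul_apply (A B : Matrix (Fin d) (Fin d) ℝ) (u : EucSp d) :
    Matrix.toEuclideanCLM (𝕜 := ℝ) (A * B) u =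
      Matrix.toEuclideanCLM (𝕜 := ℝ) A (Matrix.toEuclideanCLM (𝕜 := ℝ) B u) := by
  rw [map_mul]; rfl

theorem toEuclideanCLM_one_apply (u : EucSp d) :
    Matrix.toEuclideanCLM (𝕜 := ℝ) (1 : Matrix (Fin d) (Fin d) ℝ) u = u := by
  rw [map_one]; rfl

variable (x : Fin m → EucSp d)

theorem inner_sampleCov (u v : EucSp d) :
    inner ℝ u (Matrix.toEuclideanCLM (𝕜 := ℝ) (sampleCov x) v) =
      (m : ℝ)⁻¹ * ∑ i, inner ℝ u (x i - sampleMean x) * inner ℝ v (x i - sampleMean x) := by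
  have h1 : ∀ i, inner ℝ u (x i - sampleMean x) * inner ℝ v (x i - sampleMean x) =
      ∑ a, ∑ c, u a * v c * ((x i a - sampleMean x a) * (x i c - sampleMean x c)) := by
    intro i
    rw [MixtureModel.inner_eq_sum, MixtureModel.inner_eq_sum, Finset.sum_mul_sum]
    refine Finset.sum_congr rfl fun a _ => Finset.sum_congr rfl fun c _ => ?_
    simp only [PiLp.sub_apply]; ring
  simp_rw [h1]
  rw [Finset.sum_comm, MixtureModel.inner_eq_sum, Finset.mul_sum]
  refine Finset.sum_congr rfl fun a _ => ?_
  have h2 : (Matrix.toEuclideanCLM (𝕜 := ℝ) (sampleCov x) v) a = ∑ c, sampleCov x a c * v c := by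
    simp [Matrix.mulVec, dotProduct]
  rw [h2, Finset.sum_comm, Finset.mul_sum, Finset.mul_sum]
  refine Finset.sum_congr rfl fun c _ => ?_
  rw [sampleCov, Matrix.of_apply, ← Finset.mul_sum]
  ring

theorem sampleCov_isHermitian : (sampleCov x).IsHermitian := by
  ext a b
  simp [sampleCov, mul_comm]

theorem sampleCov_posSemidef : (sampleCov x).PosSemidef := by
  refine Matrix.PosSemidef.of_dotProduct_mulVec_nonneg (sampleCov_isHermitian x) fun v => ?_
  have h := inner_sampleCov x (WithLp.toLp 2 v) (WithLp.toLp 2 v)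
  have h2 : inner ℝ (WithLp.toLp 2 v : EucSp d)
      (Matrix.toEuclideanCLM (𝕜 := ℝ) (sampleCov x) (WithLp.toLp 2 v)) =
      star v ⬝ᵥ (sampleCov x).mulVec v := by
    rw [MixtureModel.inner_eq_sum]; simp [dotProduct]
  rw [← h2, h]
  have : ∀ i, 0 ≤ inner ℝ (WithLp.toLp 2 v : EucSp d) (x i - sampleMean x) *
      inner ℝ (WithLp.toLp 2 v : EucSp d) (x i - sampleMean x) := fun i => mul_self_nonneg _
  exact mul_nonneg (by positivity) (Finset.sum_nonneg fun i _ => this i)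

theorem sampleCov_posDef (hm : 0 < m)
    (h : ∀ b : EucSp d, (∀ i, inner ℝ b (x i - sampleMean x) = 0) → b = 0) :
    (sampleCov x).PosDef := by
  refine Matrix.PosDef.of_dotProduct_mulVec_pos (sampleCov_isHermitian x) fun {v} hv => ?_
  have h1 := inner_sampleCov x (WithLp.toLp 2 v) (WithLp.toLp 2 v)
  have h2 : inner ℝ (WithLp.toLp 2 v : EucSp d)
      (Matrix.toEuclideanCLM (𝕜 := ℝ) (sampleCov x) (WithLp.toLp 2 v)) =
      star v ⬝ᵥ (sampleCov x).mulVec v := by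
    rw [MixtureModel.inner_eq_sum]; simp [dotProduct]
  rw [← h2, h1]
  have hm' : (0 : ℝ) < m := by exact_mod_cast hm
  refine mul_pos (by positivity) ?_
  have hnn : ∀ i ∈ Finset.univ, 0 ≤ inner ℝ (WithLp.toLp 2 v : EucSp d) (x i - sampleMean x) *
      inner ℝ (WithLp.toLp 2 v : EucSp d) (x i - sampleMean x) := fun i _ => mul_self_nonneg _
  refine lt_of_le_of_ne (Finset.sum_nonneg hnn) fun h0 => hv ?_
  have h3 := (Finset.sum_eq_zero_iff_of_nonneg hnn).1 h0.symm
  have h4 := h (WithLp.toLp 2 v) fun i => mul_self_eq_zero.1 (h3 i (Finset.mem_univ i))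
  simpa using congrArg WithLp.ofLp h4

theorem sum_sub_sampleMean (hm : 0 < m) : ∑ i, (x i - sampleMean x) = 0 := by
  have hm' : (m : ℝ) ≠ 0 := by positivity
  rw [Finset.sum_sub_distrib, sampleMean]
  simp only [Finset.sum_const, Finset.card_univ, Fintype.card_fin]
  rw [← Nat.cast_smul_eq_nsmul ℝ, smul_smul, mul_inv_cancel₀ hm', one_smul, sub_self]

theorem sum_whiten (hm : 0 < m) : ∑ i, whiten x (x i) = 0 := by
  simp only [whiten]
  rw [← map_sum, sum_sub_sampleMean x hm, map_zero]

theorem sum_inner_whiten_sq (hm : 0 < m) (hx : (sampleCov x).PosDef) (e : EucSp d) :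
    ∑ i, (inner ℝ e (whiten x (x i))) ^ 2 = m * ‖e‖ ^ 2 := by
  have hm' : (m : ℝ) ≠ 0 := by positivity
  set W := Matrix.toEuclideanCLM (𝕜 := ℝ) (invSqrt (sampleCov x)) with hW
  have h1 := inner_sampleCov x (W e) (W e)
  have h2 : ∀ i, inner ℝ (W e) (x i - sampleMean x) = inner ℝ e (whiten x (x i)) := fun i =>
    inner_toEuclideanCLM_left (invSqrt_isHermitian _) _ _
  have h3 : inner ℝ (W e) (Matrix.toEuclideanCLM (𝕜 := ℝ) (sampleCov x) (W e)) = ‖e‖ ^ 2 := by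
    rw [hW, inner_toEuclideanCLM_left (invSqrt_isHermitian _), ← toEuclideanCLM_mul_apply,
      ← toEuclideanCLM_mul_apply]
    have : invSqrt (sampleCov x) * (sampleCov x * invSqrt (sampleCov x)) = 1 := by
      conv_lhs => enter [2, 1]; rw [← sqrt_mul_sqrt hx.posSemidef]
      have h5 : CFC.sqrt (sampleCov x) * invSqrt (sampleCov x) = 1 :=
        Matrix.mul_nonsing_inv _ (isUnit_det_sqrt hx)
      rw [Matrix.mul_assoc, h5, Matrix.mul_one, invSqrt_mul_sqrt hx]
    rw [Matrix.mul_assoc, this, toEuclideanCLM_one_apply, real_inner_self_eq_norm_sq]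
  rw [h3] at h1
  simp_rw [h2, ← sq] at h1
  rw [h1, mul_inv_cancel_left₀ hm']

theorem exists_inner_whiten (hx : (sampleCov x).PosDef) (b : EucSp d) :
    ∃ b' : EucSp d, ∀ u, inner ℝ b (u - sampleMean x) = inner ℝ b' (whiten x u) := by
  refine ⟨Matrix.toEuclideanCLM (𝕜 := ℝ) (CFC.sqrt (sampleCov x)) b, fun u => ?_⟩
  have h5 : CFC.sqrt (sampleCov x) * invSqrt (sampleCov x) = 1 :=
        Matrix.mul_nonsing_inv _ (isUnit_det_sqrt hx)
  rw [inner_toEuclideanCLM_left (sqrt_isHermitian _), whiten, ← toEuclideanCLM_mul_apply, h5,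
    toEuclideanCLM_one_apply]

end Whitening

section KMeans

variable {d K m : ℕ}

/-- The number of points with label `j`. -/
def clusterSize (s : Fin m → Fin K) (j : Fin K) : ℕ := (Finset.univ.filter fun i => s i = j).card

/-- The least-squares affine predictor of the indicator of the cluster `j`. -/
noncomputable def clusterScore (w : Fin m → EucSp d) (s : Fin m → Fin K) (j : Fin K) (u : EucSp d) :
    ℝ :=
  clusterSize s j / m * (1 + inner ℝ (clusterMean w s j) u)

/-- The residual sum of squares of `clusterScore`. -/
noncomputable def clusterRss (w : Fin m → EucSp d) (s : Fin m → Fin K) (j : Fin K) : ℝ :=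
  ∑ i, ((if s i = j then 1 else 0) - clusterScore w s j (w i)) ^ 2

/-- The relative residual `1 - (n_j / m) (1 + ‖c_j‖²)` of the cluster `j`. -/
noncomputable def clusterDefect (w : Fin m → EucSp d) (s : Fin m → Fin K) (j : Fin K) : ℝ :=
  1 - clusterSize s j / m * (1 + ‖clusterMean w s j‖ ^ 2)

variable {w : Fin m → EucSp d} {s : Fin m → Fin K}

theorem clusterSize_smul_clusterMean (w : Fin m → EucSp d) (s : Fin m → Fin K) (j : Fin K) :
    (clusterSize s j : ℝ) • clusterMean w s j = ∑ i with s i = j, w i := by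
  unfold clusterMean clusterSize
  by_cases h : (Finset.univ.filter fun i => s i = j).card = 0
  · rw [Finset.card_eq_zero] at h
    simp [h]
  · rw [smul_smul, mul_inv_cancel₀ (by exact_mod_cast h), one_smul]

theorem sum_clusterSize (s : Fin m → Fin K) : ∑ j, (clusterSize s j : ℝ) = m := by
  have := Finset.card_eq_sum_card_fiberwise (f := s) (s := Finset.univ) (t := Finset.univ)
    (by intro i _; simp)
  simp only [Finset.card_univ, Fintype.card_fin] at this
  exact_mod_cast this.symm

theorem clusterSize_le (s : Fin m → Fin K) (j : Fin K) : clusterSize s j ≤ m :=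
  (Finset.card_filter_le _ _).trans (by simp)

theorem sum_clusterSize_smul_clusterMean (w : Fin m → EucSp d) (s : Fin m → Fin K) :
    ∑ j, (clusterSize s j : ℝ) • clusterMean w s j = ∑ i, w i := by
  simp_rw [clusterSize_smul_clusterMean]
  exact Finset.sum_fiberwise _ _ _

theorem sum_indicator_sub_affine_sq (hw0 : ∑ i, w i = 0)
    (hw : ∀ e : EucSp d, ∑ i, (inner ℝ e (w i)) ^ 2 = m * ‖e‖ ^ 2) (j : Fin K) (α : ℝ)
    (b : EucSp d) :
    ∑ i, ((if s i = j then (1 : ℝ) else 0) - (α + inner ℝ b (w i))) ^ 2 =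
      clusterSize s j - 2 * (clusterSize s j) * (α + inner ℝ b (clusterMean w s j)) +
        m * (α ^ 2 + ‖b‖ ^ 2) := by
  have h1 : ∀ i, ((if s i = j then (1 : ℝ) else 0) - (α + inner ℝ b (w i))) ^ 2 =
      (if s i = j then (1 - 2 * (α + inner ℝ b (w i))) else 0) +
        (α ^ 2 + 2 * α * inner ℝ b (w i) + (inner ℝ b (w i)) ^ 2) := by
    intro i; split_ifs <;> ring
  have h2 : ∑ i, inner ℝ b (w i) = 0 := by rw [← inner_sum, hw0, inner_zero_right]
  have h3 : ∑ i with s i = j, inner ℝ b (w i) =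
      clusterSize s j * inner ℝ b (clusterMean w s j) := by
    rw [← inner_sum, ← clusterSize_smul_clusterMean, real_inner_smul_right]
  simp_rw [h1]
  rw [Finset.sum_add_distrib, Finset.sum_add_distrib, Finset.sum_add_distrib, ← Finset.mul_sum, h2,
    hw b, ← Finset.sum_filter, Finset.sum_sub_distrib, ← Finset.mul_sum, Finset.sum_add_distrib, h3]
  simp only [Finset.sum_const, nsmul_eq_mul, Finset.card_univ, Fintype.card_fin, mul_one]
  change (clusterSize s j : ℝ) - 2 * (clusterSize s j * α + _) + _ = _
  ring

theorem clusterRss_eq (hm : 0 < m) (hw0 : ∑ i, w i = 0)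
    (hw : ∀ e : EucSp d, ∑ i, (inner ℝ e (w i)) ^ 2 = m * ‖e‖ ^ 2) (j : Fin K) :
    clusterRss w s j = clusterSize s j * clusterDefect w s j := by
  have h := sum_indicator_sub_affine_sq (s := s) hw0 hw j (clusterSize s j / m)
    ((clusterSize s j / m : ℝ) • clusterMean w s j)
  have hm' : (m : ℝ) ≠ 0 := by positivity
  have h1 : clusterRss w s j = ∑ i, ((if s i = j then (1 : ℝ) else 0) - (clusterSize s j / m +
      inner ℝ ((clusterSize s j / m : ℝ) • clusterMean w s j) (w i))) ^ 2 := by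
    refine Finset.sum_congr rfl fun i _ => ?_
    rw [clusterScore, real_inner_smul_left]; ring
  rw [h1, h, real_inner_smul_left, real_inner_self_eq_norm_sq, norm_smul, mul_pow, Real.norm_eq_abs,
    sq_abs, clusterDefect]
  field_simp
  ring

theorem clusterRss_le (hm : 0 < m) (hw0 : ∑ i, w i = 0)
    (hw : ∀ e : EucSp d, ∑ i, (inner ℝ e (w i)) ^ 2 = m * ‖e‖ ^ 2) (j : Fin K) (α : ℝ)
    (b : EucSp d) :
    clusterRss w s j ≤ ∑ i, ((if s i = j then (1 : ℝ) else 0) - (α + inner ℝ b (w i))) ^ 2 := by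
  have hm' : (0 : ℝ) < m := by positivity
  rw [clusterRss_eq hm hw0 hw, sum_indicator_sub_affine_sq hw0 hw, clusterDefect]
  set n : ℝ := (clusterSize s j : ℝ)
  set c := clusterMean w s j
  have h1 : ‖b - (n / m) • c‖ ^ 2 = ‖b‖ ^ 2 - 2 * (n / m * inner ℝ b c) + (n / m) ^ 2 * ‖c‖ ^ 2 := by
    rw [norm_sub_sq_real, real_inner_smul_right, norm_smul, mul_pow, Real.norm_eq_abs, sq_abs]
  have h2 : n - 2 * n * (α + inner ℝ b c) + m * (α ^ 2 + ‖b‖ ^ 2) -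
      n * (1 - n / m * (1 + ‖c‖ ^ 2)) =
      m * ((α - n / m) ^ 2 + (‖b‖ ^ 2 - 2 * (n / m * inner ℝ b c) + (n / m) ^ 2 * ‖c‖ ^ 2)) := by
    field_simp; ring
  rw [← h1] at h2
  have h3 : 0 ≤ m * ((α - n / m) ^ 2 + ‖b - (n / m) • c‖ ^ 2) := by positivity
  linarith

theorem kmeansLoss_eq (hm : 0 < m) (w : Fin m → EucSp d) (s : Fin m → Fin K) :
    kmeansLoss w s = ∑ i, ‖w i‖ ^ 2 - m * (K - 1) + m * ∑ j, clusterDefect w s j := by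
  have hm' : (m : ℝ) ≠ 0 := by positivity
  have h1 : ∀ j, ∑ i with s i = j, ‖w i - clusterMean w s (s i)‖ ^ 2 =
      ∑ i with s i = j, ‖w i‖ ^ 2 - clusterSize s j * ‖clusterMean w s j‖ ^ 2 := by
    intro j
    have h2 : ∑ i with s i = j, ‖w i - clusterMean w s (s i)‖ ^ 2 = ∑ i with s i = j,
        (‖w i‖ ^ 2 - 2 * inner ℝ (w i) (clusterMean w s j) + ‖clusterMean w s j‖ ^ 2) := by
      refine Finset.sum_congr rfl fun i hi => ?_
      rw [(Finset.mem_filter.1 hi).2, norm_sub_sq_real]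
    rw [h2, Finset.sum_add_distrib, Finset.sum_sub_distrib, ← Finset.mul_sum, ← sum_inner,
      ← clusterSize_smul_clusterMean, real_inner_smul_left, real_inner_self_eq_norm_sq]
    simp only [Finset.sum_const, nsmul_eq_mul]
    change _ - _ + (clusterSize s j : ℝ) * _ = _
    ring
  have h3 : kmeansLoss w s = ∑ j, ∑ i with s i = j, ‖w i - clusterMean w s (s i)‖ ^ 2 :=
    (Finset.sum_fiberwise _ _ _).symm
  have h4 : ∑ j, clusterDefect w s j = K - (m : ℝ)⁻¹ * (m + ∑ j, clusterSize s j *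
      ‖clusterMean w s j‖ ^ 2) := by
    conv_rhs => rw [← sum_clusterSize s]
    rw [← Finset.sum_add_distrib, Finset.mul_sum]
    simp only [clusterDefect]
    rw [Finset.sum_sub_distrib]
    simp only [Finset.sum_const, nsmul_eq_mul, Finset.card_univ, Fintype.card_fin, mul_one]
    rw [sum_clusterSize]
    congr 1
    refine Finset.sum_congr rfl fun j _ => by ring
  rw [h3, h4]
  simp_rw [h1]
  rw [Finset.sum_sub_distrib, Finset.sum_fiberwise]
  field_simp
  ring

theorem clusterRss_nonneg (w : Fin m → EucSp d) (s : Fin m → Fin K) (j : Fin K) :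
    0 ≤ clusterRss w s j := Finset.sum_nonneg fun _ _ => sq_nonneg _

theorem clusterDefect_nonneg (hm : 0 < m) (hw0 : ∑ i, w i = 0)
    (hw : ∀ e : EucSp d, ∑ i, (inner ℝ e (w i)) ^ 2 = m * ‖e‖ ^ 2) (j : Fin K) :
    0 ≤ clusterDefect w s j := by
  rcases Nat.eq_zero_or_pos (clusterSize s j) with h | h
  · simp [clusterDefect, h]
  · have h1 := clusterRss_nonneg w s j
    rw [clusterRss_eq hm hw0 hw] at h1
    exact nonneg_of_mul_nonneg_right h1 (by exact_mod_cast h)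

theorem sum_clusterScore (hm : 0 < m) (hw0 : ∑ i, w i = 0) (u : EucSp d) :
    ∑ j, clusterScore w s j u = 1 := by
  have hm' : (m : ℝ) ≠ 0 := by positivity
  have h1 : ∀ j, clusterScore w s j u = (m : ℝ)⁻¹ * (clusterSize s j +
      inner ℝ ((clusterSize s j : ℝ) • clusterMean w s j) u) := fun j => by
    rw [clusterScore, real_inner_smul_left]; ring
  simp_rw [h1]
  rw [← Finset.mul_sum, Finset.sum_add_distrib, ← sum_inner, sum_clusterSize_smul_clusterMean, hw0,
    sum_clusterSize, inner_zero_left, add_zero, inv_mul_cancel₀ hm']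

/-- If the scores at `u` are close to the indicator of `l`, then the closest center is `c_l`. -/
theorem norm_sub_clusterMean_lt {u : EucSp d} {l j : Fin K} (hm : 0 < m)
    (hl : 0 < clusterSize s l) (hj : 0 < clusterSize s j)
    (hql : 0 ≤ clusterDefect w s l) (hqj : clusterDefect w s j ≤ 1 / 4)
    (hfl : 7 / 8 ≤ clusterScore w s l u) (hfj : clusterScore w s j u ≤ 1 / 8) :
    ‖u - clusterMean w s l‖ < ‖u - clusterMean w s j‖ := by
  have hm' : (0 : ℝ) < m := by positivity
  have key : ∀ k, 0 < clusterSize s k → ‖u - clusterMean w s k‖ ^ 2 = ‖u‖ ^ 2 + 1 +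
      m / clusterSize s k * (1 - clusterDefect w s k - 2 * clusterScore w s k u) := by
    intro k hk
    have hk' : (0 : ℝ) < clusterSize s k := by exact_mod_cast hk
    rw [norm_sub_sq_real, clusterDefect, clusterScore, real_inner_comm]
    field_simp
    ring
  have h1 : ‖u - clusterMean w s l‖ ^ 2 < ‖u - clusterMean w s j‖ ^ 2 := by
    rw [key l hl, key j hj]
    have hl' : (0 : ℝ) < clusterSize s l := by exact_mod_cast hl
    have hj' : (0 : ℝ) < clusterSize s j := by exact_mod_cast hj
    have e1 : m / clusterSize s l * (1 - clusterDefect w s l - 2 * clusterScore w s l u) < 0 :=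
      mul_neg_of_pos_of_neg (by positivity) (by linarith)
    have e2 : 0 < m / clusterSize s j * (1 - clusterDefect w s j - 2 * clusterScore w s j u) :=
      mul_pos (by positivity) (by linarith)
    linarith
  exact lt_of_pow_lt_pow_left₀ 2 (norm_nonneg _) h1

end KMeans

section Training

variable {d K m : ℕ} {κ C : ℝ} {y : Fin m → Fin K} {z : Fin m → EucSp d}

theorem sqDistPair_indicator_le (q : Prop) [Decidable q] (f : ℝ) :
    sqDistPair 0 1 f ≤ ((if q then 1 else 0) - f) ^ 2 := by
  unfold sqDistPair
  split_ifs
  · exact (min_le_right _ _).trans (le_of_eq (by ring))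
  · exact (min_le_left _ _).trans (le_of_eq (by ring))

theorem sqDistPair_le_two_mul (a t : ℝ) :
    sqDistPair 0 1 a ≤ 2 * sqDistPair 0 1 (a + t) + 2 * t ^ 2 := by
  unfold sqDistPair
  rcases min_cases ((a + t - 0) ^ 2) ((a + t - 1) ^ 2) with h | h
  · rw [h.1]; exact (min_le_left _ _).trans (by nlinarith [sq_nonneg (a + 2 * t)])
  · rw [h.1]; exact (min_le_right _ _).trans (by nlinarith [sq_nonneg (a - 1 + 2 * t)])

theorem abs_le_or_abs_sub_one_le {a δ : ℝ} (hδ : 0 ≤ δ) (h : sqDistPair 0 1 a ≤ δ ^ 2) :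
    |a| ≤ δ ∨ |a - 1| ≤ δ := by
  unfold sqDistPair at h
  rcases min_le_iff.1 h with h | h
  · left; rw [sub_zero] at h; exact abs_le_of_sq_le_sq h hδ
  · right; exact abs_le_of_sq_le_sq h hδ

theorem exists_perm_of_near_indicator {a : Fin K → Fin K → ℝ} {δ : ℝ} (hδK : K * δ < 1)
    (hsum : ∀ k, ∑ j, a j k = 1) (ha : ∀ j k, |a j k| ≤ δ ∨ |a j k - 1| ≤ δ)
    (hex : ∀ j, ∃ k, |a j k - 1| ≤ δ) :
    ∃ τ : Equiv.Perm (Fin K), ∀ j k, |a j k - if j = τ k then 1 else 0| ≤ δ := by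
  classical
  have huniq : ∀ j j' k, |a j k - 1| ≤ δ → |a j' k - 1| ≤ δ → j = j' := by
    intro j j' k h1 h2
    by_contra hne
    have hlow : ∀ i, -δ ≤ a i k := fun i => by
      rcases ha i k with h | h
      · exact (abs_le.1 h).1
      · have := (abs_le.1 h).1
        linarith
    have h3 : ∑ i, ((if i = j then 1 else 0) + (if i = j' then 1 else 0) - δ) ≤ ∑ i, a i k := by
      refine Finset.sum_le_sum fun i _ => ?_
      by_cases hi : i = j
      · subst hi
        simp only [if_true, if_neg hne]
        linarith [(abs_le.1 h1).1]
      · by_cases hi' : i = j'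
        · subst hi'
          simp only [if_neg hi, if_true]
          linarith [(abs_le.1 h2).1]
        · simp only [if_neg hi, if_neg hi']
          linarith [hlow i]
    rw [Finset.sum_sub_distrib, Finset.sum_add_distrib, hsum k] at h3
    simp at h3
    linarith
  choose g hg using hex
  have hginj : Function.Injective g := fun j j' h => huniq j j' (g j) (hg j) (h ▸ hg j')
  have hgbij : Function.Bijective g := Finite.injective_iff_bijective.1 hginj
  set e := Equiv.ofBijective g hgbij with he
  refine ⟨e.symm, fun j k => ?_⟩
  by_cases hjk : j = e.symm k
  · rw [if_pos hjk, hjk]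
    have : k = g (e.symm k) := (e.apply_symm_apply k).symm
    conv_lhs => rw [this]
    simpa [he] using hg (e.symm k)
  · rw [if_neg hjk, sub_zero]
    rcases ha j k with h | h
    · exact h
    · refine absurd (huniq j (e.symm k) k h ?_) hjk
      have : k = g (e.symm k) := (e.apply_symm_apply k).symm
      conv_lhs => rw [this]
      simpa [he] using hg (e.symm k)

theorem GoodSample.exists_perm (hκ : 0 < κ) (hC : 0 ≤ C) (hG : GoodSample κ C y z) (hm : 0 < m)
    (hK : 0 < K) {s : Fin m → Fin K} {a : Fin K → Fin K → ℝ} {b : Fin K → EucSp d} {E : ℝ}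
    (hsum : ∀ k, ∑ j, a j k = 1) (hn : ∀ j, 0 < clusterSize s j)
    (hrss : ∀ j, ∑ i, ((if s i = j then 1 else 0) - (a j (y i) + inner ℝ (b j) (z i))) ^ 2 ≤
      E * clusterSize s j) (hE0 : 0 ≤ E)
    (hE1 : 2 * (1 + C / κ) / κ * E ≤ (1 / (16 * K)) ^ 2)
    (hE2 : E * (1 + 2 * (2 * (1 + C / κ) / κ) + 2 * (C / κ)) < 1 / 2) :
    ∃ τ : Equiv.Perm (Fin K), (∀ j, ‖b j‖ ^ 2 ≤ E / κ) ∧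
      (∀ j k, |a j k - if j = τ k then 1 else 0| ≤ 1 / 16) ∧
      ((Finset.univ.filter fun i => s i ≠ τ (y i)).card : ℝ) ≤ 4 * K * (1 + C / κ) * E * m := by
  have hm' : (0 : ℝ) < m := by exact_mod_cast hm
  have hK' : (1 : ℝ) ≤ K := by exact_mod_cast hK
  set ρ : Fin K → ℝ :=
    fun j => ∑ i, ((if s i = j then 1 else 0) - (a j (y i) + inner ℝ (b j) (z i))) ^ 2 with hρ
  have hρn : ∀ j, ρ j ≤ E * m := fun j => (hrss j).trans (by
    gcongr; exact_mod_cast clusterSize_le s j)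
  have hρ0 : ∀ j, 0 ≤ ρ j := fun j => Finset.sum_nonneg fun i _ => sq_nonneg _
  have hclass : ∀ j k, ∑ i with y i = k, sqDistPair 0 1 (a j k + inner ℝ (b j) (z i)) ≤ ρ j := by
    intro j k
    calc _ = ∑ i with y i = k, sqDistPair 0 1 (a j (y i) + inner ℝ (b j) (z i)) := by
          refine Finset.sum_congr rfl fun i hi => ?_
          rw [(Finset.mem_filter.1 hi).2]
      _ ≤ ∑ i, sqDistPair 0 1 (a j (y i) + inner ℝ (b j) (z i)) :=
          Finset.sum_le_sum_of_subset_of_nonneg (Finset.filter_subset _ _)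
            fun i _ _ => sqDistPair_nonneg _ _ _
      _ ≤ _ := Finset.sum_le_sum fun i _ => sqDistPair_indicator_le _ _
  have hb : ∀ j, κ * m * ‖b j‖ ^ 2 ≤ ρ j := fun j =>
    (hG.le_sum_sqDistPair (b j) (a j ⟨0, hK⟩) ⟨0, hK⟩).trans (hclass j _)
  have hinner : ∀ j, ∑ i, (inner ℝ (b j) (z i)) ^ 2 ≤ C / κ * ρ j := by
    intro j
    calc _ ≤ C * m * ‖b j‖ ^ 2 := hG.sum_inner_sq_le _
      _ = C / κ * (κ * m * ‖b j‖ ^ 2) := by field_simp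
      _ ≤ _ := by gcongr; exact hb j
  set G := 2 * (1 + C / κ) / κ with hGdef
  have hG0 : 0 ≤ G := by positivity
  have hD : ∀ j k, m * sqDistPair 0 1 (a j k) ≤ G * ρ j := by
    intro j k
    have h1 : κ * m * sqDistPair 0 1 (a j k) ≤ 2 * (1 + C / κ) * ρ j := by
      calc _ ≤ ((Finset.univ.filter fun i => y i = k).card : ℝ) * sqDistPair 0 1 (a j k) :=
            mul_le_mul_of_nonneg_right (hG.le_card k) (sqDistPair_nonneg _ _ _)
        _ = ∑ i with y i = k, sqDistPair 0 1 (a j k) := by simp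
        _ ≤ ∑ i with y i = k, (2 * sqDistPair 0 1 (a j k + inner ℝ (b j) (z i)) +
              2 * (inner ℝ (b j) (z i)) ^ 2) :=
            Finset.sum_le_sum fun i _ => sqDistPair_le_two_mul _ _
        _ = 2 * ∑ i with y i = k, sqDistPair 0 1 (a j k + inner ℝ (b j) (z i)) +
              2 * ∑ i with y i = k, (inner ℝ (b j) (z i)) ^ 2 := by
            rw [Finset.sum_add_distrib, Finset.mul_sum, Finset.mul_sum]
        _ ≤ 2 * ρ j + 2 * (C / κ * ρ j) := by
            gcongr
            · exact hclass j k
            · exact (Finset.sum_le_sum_of_subset_of_nonneg (Finset.filter_subset _ _)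
                fun i _ _ => sq_nonneg _).trans (hinner j)
        _ = _ := by ring
    calc m * sqDistPair 0 1 (a j k) = κ * m * sqDistPair 0 1 (a j k) / κ := by field_simp
      _ ≤ 2 * (1 + C / κ) * ρ j / κ := by gcongr
      _ = _ := by rw [hGdef]; ring
  set δ : ℝ := 1 / (16 * K) with hδ
  have hδ0 : 0 < δ := by positivity
  have hKδ : K * δ = 1 / 16 := by rw [hδ]; field_simp
  have hδ16 : δ ≤ 1 / 16 := by rw [← hKδ]; exact le_mul_of_one_le_left hδ0.le hK'
  have hδD : ∀ j k, sqDistPair 0 1 (a j k) ≤ δ ^ 2 := by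
    intro j k
    have h1 := (hD j k).trans (mul_le_mul_of_nonneg_left (hρn j) hG0)
    have h2 : (m : ℝ) * sqDistPair 0 1 (a j k) ≤ m * δ ^ 2 := by nlinarith
    exact le_of_mul_le_mul_left h2 hm'
  have hcase := fun j k => abs_le_or_abs_sub_one_le hδ0.le (hδD j k)
  have hex : ∀ j, ∃ k, |a j k - 1| ≤ δ := by
    intro j
    by_contra! hcon
    have hsmall : ∀ k, m * (a j k) ^ 2 ≤ G * ρ j := by
      intro k
      have h1 := (hcase j k).resolve_right (not_le.2 (hcon k))
      have h2 : sqDistPair 0 1 (a j k) = (a j k) ^ 2 := by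
        obtain ⟨h3, h4⟩ := abs_le.1 h1
        unfold sqDistPair
        rw [min_eq_left]
        · ring
        · nlinarith
      rw [← h2]; exact hD j k
    have hup : ∑ i, (a j (y i) + inner ℝ (b j) (z i)) ^ 2 ≤ 2 * (G * ρ j) + 2 * (C / κ * ρ j) := by
      calc _ ≤ ∑ i, (2 * (a j (y i)) ^ 2 + 2 * (inner ℝ (b j) (z i)) ^ 2) :=
            Finset.sum_le_sum fun i _ => by
              nlinarith [sq_nonneg (a j (y i) - inner ℝ (b j) (z i))]
        _ = 2 * ∑ i, (a j (y i)) ^ 2 + 2 * ∑ i, (inner ℝ (b j) (z i)) ^ 2 := by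
            rw [Finset.sum_add_distrib, Finset.mul_sum, Finset.mul_sum]
        _ ≤ _ := by
            gcongr
            · calc ∑ i, (a j (y i)) ^ 2 ≤ ∑ _i : Fin m, G * ρ j / m :=
                    Finset.sum_le_sum fun i _ => by
                      rw [le_div_iff₀ hm', mul_comm]; exact hsmall _
                _ = _ := by
                  rw [Finset.sum_const, Finset.card_univ, Fintype.card_fin, nsmul_eq_mul]
                  field_simp
            · exact hinner j
    have hlow : (clusterSize s j : ℝ) / 2 ≤
        ρ j + ∑ i, (a j (y i) + inner ℝ (b j) (z i)) ^ 2 := by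
      calc (clusterSize s j : ℝ) / 2 = ∑ i, if s i = j then (1 / 2 : ℝ) else 0 := by
            rw [← Finset.sum_filter]; simp [clusterSize]; ring
        _ ≤ ∑ i, (((if s i = j then 1 else 0) - (a j (y i) + inner ℝ (b j) (z i))) ^ 2 +
              (a j (y i) + inner ℝ (b j) (z i)) ^ 2) := Finset.sum_le_sum fun i _ => by
            split_ifs
            · nlinarith [sq_nonneg (a j (y i) + inner ℝ (b j) (z i) - 1 / 2)]
            · positivity
        _ = _ := by rw [Finset.sum_add_distrib]
    have hnj : (0 : ℝ) < clusterSize s j := by exact_mod_cast hn j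
    have h5 : ρ j * (1 + 2 * G + 2 * (C / κ)) ≤
        E * clusterSize s j * (1 + 2 * G + 2 * (C / κ)) := by
      gcongr; exact hrss j
    nlinarith
  obtain ⟨τ, hτ⟩ := exists_perm_of_near_indicator (by rw [hKδ]; norm_num) hsum hcase hex
  refine ⟨τ, fun j => ?_, fun j k => (hτ j k).trans hδ16, ?_⟩
  · rw [le_div_iff₀ hκ]
    have h1 := (hb j).trans (hρn j)
    have h2 : (m : ℝ) * (‖b j‖ ^ 2 * κ) ≤ m * E := by linarith
    exact le_of_mul_le_mul_left h2 hm'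
  · have hpt : ∀ i, (if s i ≠ τ (y i) then (1 : ℝ) else 0) ≤
        ∑ j, 4 * (((if s i = j then 1 else 0) - (a j (y i) + inner ℝ (b j) (z i))) ^ 2 +
          (inner ℝ (b j) (z i)) ^ 2) := by
      intro i
      split_ifs with h
      · refine le_trans ?_ (Finset.single_le_sum (f := fun j =>
          4 * (((if s i = j then 1 else 0) - (a j (y i) + inner ℝ (b j) (z i))) ^ 2 +
          (inner ℝ (b j) (z i)) ^ 2)) (fun j _ => by positivity) (Finset.mem_univ (s i)))
        have h1 := (hτ (s i) (y i)).trans hδ16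
        rw [if_neg h, sub_zero] at h1
        have h2 := (abs_le.1 h1).2
        simp only [if_true]
        set t := inner ℝ (b (s i)) (z i)
        nlinarith [sq_nonneg (1 - (a (s i) (y i) + t) - t)]
      · exact Finset.sum_nonneg fun j _ => by positivity
    calc ((Finset.univ.filter fun i => s i ≠ τ (y i)).card : ℝ)
        = ∑ i, if s i ≠ τ (y i) then (1 : ℝ) else 0 := by rw [← Finset.sum_filter]; simp
      _ ≤ ∑ i, ∑ j, 4 * (((if s i = j then 1 else 0) - (a j (y i) + inner ℝ (b j) (z i))) ^ 2 +
          (inner ℝ (b j) (z i)) ^ 2) := Finset.sum_le_sum fun i _ => hpt i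
      _ = ∑ j, 4 * (ρ j + ∑ i, (inner ℝ (b j) (z i)) ^ 2) := by
          rw [Finset.sum_comm]
          refine Finset.sum_congr rfl fun j _ => ?_
          rw [← Finset.mul_sum, Finset.sum_add_distrib]
      _ ≤ ∑ _j : Fin K, 4 * ((1 + C / κ) * (E * m)) := Finset.sum_le_sum fun j _ => by
          have h1 : (1 + C / κ) * ρ j ≤ (1 + C / κ) * (E * m) := by gcongr; exact hρn j
          have := hinner j
          linarith
      _ = _ := by
          rw [Finset.sum_const, Finset.card_univ, Fintype.card_fin, nsmul_eq_mul]; ring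

/-- The slope of the `j`-th least-squares score, in the coordinates of the noise. -/
noncomputable def trainedSlope (S : Matrix (Fin d) (Fin d) ℝ) (x : Fin m → EucSp d)
    (s : Fin m → Fin K) (j : Fin K) : EucSp d :=
  (clusterSize s j / m : ℝ) • Matrix.toEuclideanCLM (𝕜 := ℝ) (CFC.sqrt S)
    (Matrix.toEuclideanCLM (𝕜 := ℝ) (invSqrt (sampleCov x)) (whitenedCenter x s j))

theorem clusterScore_whiten_add (S : Matrix (Fin d) (Fin d) ℝ) (x : Fin m → EucSp d)
    (s : Fin m → Fin K) (j : Fin K) (c u : EucSp d) :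
    clusterScore (fun i => whiten x (x i)) s j
        (whiten x (c + Matrix.toEuclideanCLM (𝕜 := ℝ) (CFC.sqrt S) u)) =
      clusterScore (fun i => whiten x (x i)) s j (whiten x c) +
        inner ℝ (trainedSlope S x s j) u := by
  have h1 : whiten x (c + Matrix.toEuclideanCLM (𝕜 := ℝ) (CFC.sqrt S) u) = whiten x c +
      Matrix.toEuclideanCLM (𝕜 := ℝ) (invSqrt (sampleCov x))
        (Matrix.toEuclideanCLM (𝕜 := ℝ) (CFC.sqrt S) u) := by
    rw [whiten, whiten, ← map_add]; congr 1; abel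
  rw [h1, clusterScore, clusterScore, trainedSlope, real_inner_smul_left,
    inner_toEuclideanCLM_left (sqrt_isHermitian _), inner_toEuclideanCLM_left (invSqrt_isHermitian _),
    inner_add_right, whitenedCenter]
  ring

theorem GoodSample.sampleCov_posDef (hκ : 0 < κ) (hG : GoodSample κ C y z) (hm : 0 < m)
    (hK : 0 < K) {θ : MixtureModel d K} (hθ : θ.cov.PosDef) {x : Fin m → EucSp d}
    (hx : ∀ i, x i = θ.center (y i) + Matrix.toEuclideanCLM (𝕜 := ℝ) (CFC.sqrt θ.cov) (z i)) :
    (sampleCov x).PosDef := by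
  have hm' : (0 : ℝ) < m := by exact_mod_cast hm
  refine _root_.sampleCov_posDef x hm fun b hb => ?_
  set T := Matrix.toEuclideanCLM (𝕜 := ℝ) (CFC.sqrt θ.cov) with hT
  have h1 := hG.le_sum_sqDistPair (T b) (inner ℝ b (θ.center ⟨0, hK⟩ - sampleMean x)) ⟨0, hK⟩
  have h2 : ∑ i with y i = ⟨0, hK⟩, sqDistPair 0 1
      (inner ℝ b (θ.center ⟨0, hK⟩ - sampleMean x) + inner ℝ (T b) (z i)) = 0 := by
    refine Finset.sum_eq_zero fun i hi => ?_
    have h3 := hb i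
    rw [hx i, (Finset.mem_filter.1 hi).2] at h3
    have h4 : inner ℝ b (θ.center ⟨0, hK⟩ - sampleMean x) + inner ℝ (T b) (z i) = 0 := by
      rw [hT, inner_toEuclideanCLM_left (sqrt_isHermitian _), ← inner_add_right, ← h3]
      congr 1; abel
    rw [h4]; simp [sqDistPair]
  rw [h2] at h1
  have h5 : ‖T b‖ ^ 2 ≤ 0 := by
    by_contra! h6
    have : 0 < κ * m * ‖T b‖ ^ 2 := by positivity
    linarith
  have h6 : T b = 0 := by
    have := le_antisymm h5 (sq_nonneg _)
    simpa using this
  calc b = Matrix.toEuclideanCLM (𝕜 := ℝ) (invSqrt θ.cov) (T b) := by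
        rw [hT, ← toEuclideanCLM_mul_apply, invSqrt_mul_sqrt hθ, toEuclideanCLM_one_apply]
    _ = 0 := by rw [h6, map_zero]

theorem GoodSample.clusterDefect_le (hκ : 0 < κ) (hC : 0 ≤ C) (hG : GoodSample κ C y z) (hm : 0 < m)
    (hK : 2 ≤ K) {θ : MixtureModel d K} {R : ℝ} (hθ : θ.SignalStrength R) {x : Fin m → EucSp d}
    (hx : ∀ i, x i = θ.center (y i) + Matrix.toEuclideanCLM (𝕜 := ℝ) (CFC.sqrt θ.cov) (z i))
    (j : Fin K) :
    clusterDefect (fun i => whiten x (x i)) y j ≤ C * K / (κ * R ^ 2) := by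
  have hm' : (0 : ℝ) < m := by exact_mod_cast hm
  have hR : 0 < R := hθ.2.1
  have hcov := hG.sampleCov_posDef hκ hm (by omega) hθ.1 hx
  obtain ⟨α, b, hval, hb⟩ := hθ.exists_affine hK j
  obtain ⟨b', hb'⟩ := exists_inner_whiten x hcov
    (Matrix.toEuclideanCLM (𝕜 := ℝ) (invSqrt θ.cov) b)
  have hrss := clusterRss_le (s := y) hm (sum_whiten x hm) (sum_inner_whiten_sq x hm hcov) j
    (α + inner ℝ (Matrix.toEuclideanCLM (𝕜 := ℝ) (invSqrt θ.cov) b)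
      (sampleMean x - θ.meanCenter)) b'
  have hres : ∀ i, ((if y i = j then (1 : ℝ) else 0) - (α + inner ℝ (Matrix.toEuclideanCLM (𝕜 := ℝ)
      (invSqrt θ.cov) b) (sampleMean x - θ.meanCenter) + inner ℝ b' (whiten x (x i)))) ^ 2 =
      (inner ℝ b (z i)) ^ 2 := by
    intro i
    rw [← hb', ← hval (y i), add_assoc, ← inner_add_right, hx i,
      inner_toEuclideanCLM_left (invSqrt_isHermitian _)]
    have : sampleMean x - θ.meanCenter + (θ.center (y i) +
        Matrix.toEuclideanCLM (𝕜 := ℝ) (CFC.sqrt θ.cov) (z i) - sampleMean x) =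
        (θ.center (y i) - θ.meanCenter) + Matrix.toEuclideanCLM (𝕜 := ℝ) (CFC.sqrt θ.cov) (z i) := by
      abel
    rw [this, map_add, inner_add_right, ← toEuclideanCLM_mul_apply, invSqrt_mul_sqrt hθ.1,
      toEuclideanCLM_one_apply]
    ring
  simp_rw [hres] at hrss
  have h1 := hrss.trans (hG.sum_inner_sq_le b)
  rw [clusterRss_eq hm (sum_whiten x hm) (sum_inner_whiten_sq x hm hcov)] at h1
  have h2 := clusterDefect_nonneg (s := y) hm (sum_whiten x hm) (sum_inner_whiten_sq x hm hcov) j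
  have h3 : κ * m * clusterDefect (fun i => whiten x (x i)) y j ≤ C * m * ‖b‖ ^ 2 :=
    (mul_le_mul_of_nonneg_right (hG.le_card j) h2).trans h1
  have h4 : κ * clusterDefect (fun i => whiten x (x i)) y j ≤ C * ‖b‖ ^ 2 := by
    have : (m : ℝ) * (κ * clusterDefect (fun i => whiten x (x i)) y j) ≤ m * (C * ‖b‖ ^ 2) := by
      linarith
    exact le_of_mul_le_mul_left this hm'
  rw [le_div_iff₀ (by positivity)]
  calc _ = κ * clusterDefect (fun i => whiten x (x i)) y j * R ^ 2 := by ring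
    _ ≤ C * ‖b‖ ^ 2 * R ^ 2 := by gcongr
    _ = C * (R ^ 2 * ‖b‖ ^ 2) := by ring
    _ ≤ _ := by gcongr

/-- On a good sample, whitened `k`-means recovers most labels up to a permutation, and the trained
classifier is correct at all points whose noise is small in the direction of the slopes. -/
theorem GoodSample.training (hκ : 0 < κ) (hC : 0 ≤ C) (hG : GoodSample κ C y z) (hm : 0 < m)
    (hK : 2 ≤ K) {θ : MixtureModel d K} {R : ℝ} (hθ : θ.SignalStrength R) {x : Fin m → EucSp d}
    (hx : ∀ i, x i = θ.center (y i) + Matrix.toEuclideanCLM (𝕜 := ℝ) (CFC.sqrt θ.cov) (z i))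
    {s : Fin m → Fin K} (hs : IsWhitenedKMeans x s) {E : ℝ} (hE : C * K ^ 2 / (κ * R ^ 2) ≤ E)
    (hE0 : E ≤ 1 / 4) (hE1 : 2 * (1 + C / κ) / κ * E ≤ (1 / (16 * K)) ^ 2)
    (hE2 : E * (1 + 2 * (2 * (1 + C / κ) / κ) + 2 * (C / κ)) < 1 / 2) :
    ∃ τ : Equiv.Perm (Fin K), (∀ j, ‖trainedSlope θ.cov x s j‖ ^ 2 ≤ E / κ) ∧
      (∀ k u j, (∀ l, |inner ℝ (trainedSlope θ.cov x s l) u| ≤ 1 / 16) →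
        IsPredictedLabel x s
          (θ.center k + Matrix.toEuclideanCLM (𝕜 := ℝ) (CFC.sqrt θ.cov) u) j → j = τ k) ∧
      ((Finset.univ.filter fun i => s i ≠ τ (y i)).card : ℝ) ≤ 4 * K * (1 + C / κ) * E * m := by
  have hm' : (0 : ℝ) < m := by exact_mod_cast hm
  have hR : 0 < R := hθ.2.1
  have hEnn : 0 ≤ E := le_trans (by positivity) hE
  have hcov := hG.sampleCov_posDef hκ hm (by omega) hθ.1 hx
  have hw0 := sum_whiten x hm
  have hw := sum_inner_whiten_sq x hm hcov
  set w : Fin m → EucSp d := fun i => whiten x (x i) with hwdef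
  have hdef : ∑ j, clusterDefect w s j ≤ E := by
    have h1 := hs y
    rw [kmeansLoss_eq hm, kmeansLoss_eq hm] at h1
    have h2 : (m : ℝ) * ∑ j, clusterDefect w s j ≤ m * ∑ j, clusterDefect w y j := by linarith
    have h3 := le_of_mul_le_mul_left h2 hm'
    refine h3.trans (le_trans ?_ hE)
    calc _ ≤ ∑ _j : Fin K, C * K / (κ * R ^ 2) :=
          Finset.sum_le_sum fun j _ => hG.clusterDefect_le hκ hC hm hK hθ hx j
      _ = _ := by
          rw [Finset.sum_const, Finset.card_univ, Fintype.card_fin, nsmul_eq_mul]; ring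
  have hdefj : ∀ j, clusterDefect w s j ≤ E := fun j =>
    (Finset.single_le_sum (f := fun j => clusterDefect w s j)
      (fun i _ => clusterDefect_nonneg hm hw0 hw i) (Finset.mem_univ j)).trans hdef
  have hn : ∀ j, 0 < clusterSize s j := by
    intro j
    refine Nat.pos_of_ne_zero fun h0 => ?_
    have := hdefj j
    simp only [clusterDefect, h0, CharP.cast_eq_zero, zero_div, zero_mul, sub_zero] at this
    linarith
  set a : Fin K → Fin K → ℝ := fun j k => clusterScore w s j (whiten x (θ.center k)) with ha
  have hscore : ∀ j k u, clusterScore w s j (whiten x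
      (θ.center k + Matrix.toEuclideanCLM (𝕜 := ℝ) (CFC.sqrt θ.cov) u)) =
      a j k + inner ℝ (trainedSlope θ.cov x s j) u := fun j k u =>
    clusterScore_whiten_add θ.cov x s j (θ.center k) u
  obtain ⟨τ, hτ1, hτ2, hτ3⟩ := hG.exists_perm (s := s) (a := a)
    (b := fun j => trainedSlope θ.cov x s j) (E := E) hκ hC hm (by omega)
    (fun k => sum_clusterScore hm hw0 _) hn (fun j => by
      have h1 : clusterRss w s j ≤ E * clusterSize s j := by
        rw [clusterRss_eq hm hw0 hw, mul_comm]
        gcongr; exact hdefj j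
      refine le_trans (le_of_eq ?_) h1
      refine Finset.sum_congr rfl fun i _ => ?_
      rw [← hscore, ← hx i]) hEnn hE1 hE2
  refine ⟨τ, hτ1, fun k u j hu hpred => ?_, hτ3⟩
  by_contra hne
  have h1 := hpred (τ k)
  refine absurd h1 (not_le.2 ?_)
  refine norm_sub_clusterMean_lt (w := w) hm (hn _) (hn _) (clusterDefect_nonneg hm hw0 hw _)
    ((hdefj j).trans hE0) ?_ ?_
  · rw [hscore]
    have e1 := (abs_le.1 (hτ2 (τ k) k)).1
    have e2 := (abs_le.1 (hu (τ k))).1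
    rw [if_pos rfl] at e1
    linarith
  · rw [hscore]
    have e1 := (abs_le.1 (hτ2 j k)).2
    have e2 := (abs_le.1 (hu j)).2
    rw [if_neg hne] at e1
    linarith

end Training

section Measurability

variable {d K m : ℕ}

theorem measurable_sampleCov_inv_apply (a c : Fin d) :
    Measurable fun x : Fin m → EucSp d => (sampleCov x)⁻¹ a c := by
  have hcov : Continuous fun x : Fin m → EucSp d => sampleCov x := by
    refine continuous_matrix fun a c => ?_
    simp only [sampleCov, Matrix.of_apply, sampleMean]
    fun_prop
  have hdet : Continuous fun x : Fin m → EucSp d => (sampleCov x).det := hcov.matrix_det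
  have hadj : Continuous fun x : Fin m → EucSp d => (sampleCov x).adjugate a c :=
    hcov.matrix_adjugate.matrix_elem a c
  have heq : (fun x : Fin m → EucSp d => (sampleCov x)⁻¹ a c) =
      fun x => ((sampleCov x).det)⁻¹ * (sampleCov x).adjugate a c := by
    funext x
    rw [Matrix.inv_def, Matrix.smul_apply, Ring.inverse_eq_inv', smul_eq_mul]
  rw [heq]
  exact hdet.measurable.inv.mul hadj.measurable

theorem trainedSlope_eq (S : Matrix (Fin d) (Fin d) ℝ) (x : Fin m → EucSp d) (s : Fin m → Fin K)
    (j : Fin K) :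
    trainedSlope S x s j = (clusterSize s j / m : ℝ) • Matrix.toEuclideanCLM (𝕜 := ℝ) (CFC.sqrt S)
      (Matrix.toEuclideanCLM (𝕜 := ℝ) (sampleCov x)⁻¹
        ((clusterSize s j : ℝ)⁻¹ • ∑ i with s i = j, (x i - sampleMean x))) := by
  have h1 : whitenedCenter x s j = Matrix.toEuclideanCLM (𝕜 := ℝ) (invSqrt (sampleCov x))
      ((clusterSize s j : ℝ)⁻¹ • ∑ i with s i = j, (x i - sampleMean x)) := by
    rw [map_smul, map_sum]; rfl
  rw [trainedSlope, h1, ← invSqrt_mul_invSqrt (sampleCov_posSemidef x), toEuclideanCLM_mul_apply]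

theorem measurable_trainedSlope (S : Matrix (Fin d) (Fin d) ℝ) (s : Fin m → Fin K) (j : Fin K) :
    Measurable fun x : Fin m → EucSp d => trainedSlope S x s j := by
  simp_rw [trainedSlope_eq]
  have hv : Measurable fun x : Fin m → EucSp d =>
      (clusterSize s j : ℝ)⁻¹ • ∑ i with s i = j, (x i - sampleMean x) := by
    simp only [sampleMean]
    fun_prop
  have hcoord : ∀ a : Fin d, Measurable fun x : Fin m → EucSp d =>
      (Matrix.toEuclideanCLM (𝕜 := ℝ) (sampleCov x)⁻¹
        ((clusterSize s j : ℝ)⁻¹ • ∑ i with s i = j, (x i - sampleMean x))) a := by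
    intro a
    have : ∀ x : Fin m → EucSp d, (Matrix.toEuclideanCLM (𝕜 := ℝ) (sampleCov x)⁻¹
        ((clusterSize s j : ℝ)⁻¹ • ∑ i with s i = j, (x i - sampleMean x))) a =
        ∑ c, (sampleCov x)⁻¹ a c *
          ((clusterSize s j : ℝ)⁻¹ • ∑ i with s i = j, (x i - sampleMean x)) c := by
      intro x
      rw [Matrix.ofLp_toEuclideanCLM]; rfl
    simp_rw [this]
    refine Finset.measurable_sum _ fun c _ => (measurable_sampleCov_inv_apply a c).mul ?_
    exact (EuclideanSpace.proj (𝕜 := ℝ) c).measurable.comp hv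
  have h2 : Measurable fun x : Fin m → EucSp d => Matrix.toEuclideanCLM (𝕜 := ℝ) (sampleCov x)⁻¹
      ((clusterSize s j : ℝ)⁻¹ • ∑ i with s i = j, (x i - sampleMean x)) :=
    (WithLp.measurable_toLp 2 (Fin d → ℝ)).comp (measurable_pi_lambda _ hcoord)
  have h3 := (Matrix.toEuclideanCLM (𝕜 := ℝ) (CFC.sqrt S)).measurable.comp h2
  exact h3.const_smul (clusterSize s j / m : ℝ)

theorem measurable_apply_countable {α β γ : Type*} [MeasurableSpace α] [MeasurableSpace β]
    [MeasurableSpace γ] [Countable β] [MeasurableSingletonClass β] {F : α → β → γ}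
    (hF : ∀ b, Measurable fun a => F a b) {g : α → β} (hg : Measurable g) :
    Measurable fun a => F a (g a) :=
  (measurable_from_prod_countable_left (f := fun q : α × β => F q.1 q.2) hF).comp
    (measurable_id.prodMk hg)

theorem measurable_trainedSlope_solver (S : Matrix (Fin d) (Fin d) ℝ)
    {solver : (Fin m → EucSp d) → Fin m → Fin K} (hs : Measurable solver) (j : Fin K) :
    Measurable fun x : Fin m → EucSp d => trainedSlope S x (solver x) j :=
  measurable_apply_countable (F := fun x s => trainedSlope S x s j)
    (fun s => measurable_trainedSlope S s j) hs

end Measurability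

theorem IsNoiseSample.indepFun_tuple {d K : ℕ} {Ω ι ι' : Type*} [MeasurableSpace Ω]
    {P : Measure Ω} {θ : MixtureModel d K} [Finite ι'] {y : ι → Ω → Fin K}
    {z : ι → Ω → EucSp d} (h : IsNoiseSample θ P y z) {f : ι' → ι} {i₀ : ι}
    (hf : ∀ i, f i ≠ i₀) :
    IndepFun (fun ω i => (y (f i) ω, z (f i) ω)) (z i₀) P := by
  classical
  cases nonempty_fintype ι'
  have h1 := h.indep.indepFun_finset (Finset.univ.image f) {i₀}
    (by simp [hf]) (fun i => (h.measurable_label i).prodMk (h.measurable_noise i))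
  have h2 := h1.comp (φ := fun g (i : ι') => g ⟨f i, by simp⟩)
    (ψ := fun g => (g ⟨i₀, by simp⟩).2)
    (measurable_pi_lambda _ fun i => measurable_pi_apply _)
    (measurable_snd.comp (measurable_pi_apply _))
  exact h2

section NewPoint

variable {d K : ℕ} {Ω : Type*} [MeasurableSpace Ω] {P : Measure Ω} [IsProbabilityMeasure P]
  {θ : MixtureModel d K}

theorem measureReal_inner_gt_le {σ v t : ℝ} (hσ : 0 < σ) (ht : 0 < t)
    (hT2 : IsT2 σ θ.noise) {B Z : Ω → EucSp d} (hB : Measurable B) (hZ : Measurable Z)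
    (hlaw : P.map Z = θ.noise) (hind : IndepFun B Z P) :
    P.real {ω | ‖B ω‖ ^ 2 ≤ v ∧ t < |inner ℝ (B ω) (Z ω)|} ≤
      2 * Real.exp (-(t ^ 2 / (2 * σ ^ 2 * v))) := by
  have := θ.noise_prob
  set S : Set (EucSp d × EucSp d) := {q | ‖q.1‖ ^ 2 ≤ v} ∩ {q | t < |inner ℝ q.1 q.2|} with hS
  have hSm : MeasurableSet S :=
    (measurableSet_le (by fun_prop) measurable_const).inter
      (measurableSet_lt measurable_const (by fun_prop))
  have hmap := (indepFun_iff_map_prod_eq_prod_map_map hB.aemeasurable hZ.aemeasurable).1 hind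
  have hsec : ∀ b : EucSp d, θ.noise (Prod.mk b ⁻¹' S) ≤
      ENNReal.ofReal (2 * Real.exp (-(t ^ 2 / (2 * σ ^ 2 * v)))) := by
    intro b
    by_cases hb : ‖b‖ ^ 2 ≤ v ∧ 0 < ‖b‖
    · have h1 := hT2.measureReal_le_abs_inner_le (θ.integrable_noise_inner b)
        (θ.integral_noise_inner b) ht
      rw [← ofReal_measureReal]
      refine ENNReal.ofReal_le_ofReal ?_
      calc θ.noise.real (Prod.mk b ⁻¹' S) ≤ θ.noise.real {z | t ≤ |inner ℝ b z|} :=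
            measureReal_mono fun z hz => by
              simp only [hS, Set.mem_preimage, Set.mem_inter_iff, Set.mem_ofPred_eq] at hz ⊢
              exact hz.2.le
        _ ≤ _ := h1
        _ ≤ _ := by
            have := hb.2
            gcongr
            exact hb.1
    · have : Prod.mk b ⁻¹' S = ∅ := by
        ext z
        simp only [hS, Set.mem_preimage, Set.mem_inter_iff, Set.mem_ofPred_eq, Set.mem_empty_iff_false, iff_false,
          not_and, not_lt]
        intro h1
        have h2 : ‖b‖ = 0 := by
          by_contra h3
          exact hb ⟨h1, lt_of_le_of_ne (norm_nonneg _) (Ne.symm h3)⟩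
        rw [norm_eq_zero.1 h2, inner_zero_left, abs_zero]; exact ht.le
      rw [this]; simp
  have : IsProbabilityMeasure (P.map B) := Measure.isProbabilityMeasure_map hB.aemeasurable
  have hpre : {ω | ‖B ω‖ ^ 2 ≤ v ∧ t < |inner ℝ (B ω) (Z ω)|} =
      (fun ω => (B ω, Z ω)) ⁻¹' S := by
    ext ω; simp [hS]
  have hle : P {ω | ‖B ω‖ ^ 2 ≤ v ∧ t < |inner ℝ (B ω) (Z ω)|} ≤
      ENNReal.ofReal (2 * Real.exp (-(t ^ 2 / (2 * σ ^ 2 * v)))) := by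
    rw [hpre]
    calc _ = P.map (fun ω => (B ω, Z ω)) S := (Measure.map_apply (hB.prodMk hZ) hSm).symm
      _ = ∫⁻ b, θ.noise (Prod.mk b ⁻¹' S) ∂(P.map B) := by
          rw [hmap, hlaw, Measure.prod_apply hSm]
      _ ≤ ∫⁻ _b, ENNReal.ofReal (2 * Real.exp (-(t ^ 2 / (2 * σ ^ 2 * v)))) ∂(P.map B) :=
          lintegral_mono hsec
      _ = _ := by simp
  exact ENNReal.toReal_le_of_le_ofReal (by positivity) hle

end NewPoint

section Alignment

variable {K m : ℕ}

theorem hammingDist_eq_card (u v : Fin m → Fin K) :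
    hammingDist u v = (Finset.univ.filter fun i => u i ≠ v i).card := rfl

theorem IsAlignment.eq {s y yt : Fin m → Fin K} {τ τ₁ τ₂ : Equiv.Perm (Fin K)}
    (h : IsAlignment s yt τ) {κ η : ℝ}
    (hclass : ∀ k, κ ≤ ((Finset.univ.filter fun i => y i = k).card : ℝ))
    (hs : ((Finset.univ.filter fun i => s i ≠ τ₁ (y i)).card : ℝ) ≤ η)
    (hlt : 2 * (η + ((Finset.univ.filter fun i => yt i ≠ τ₂ (y i)).card : ℝ)) < κ) (k : Fin K) :
    τ (τ₂ k) = τ₁ k := by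
  by_contra hne
  set e := (Finset.univ.filter fun i => yt i ≠ τ₂ (y i)).card with he
  have h1 : hammingDist s (fun i => (τ₂.symm.trans τ₁) (yt i)) ≤
      (Finset.univ.filter fun i => s i ≠ τ₁ (y i)).card + e := by
    rw [hammingDist_eq_card]
    refine le_trans (Finset.card_le_card fun i hi => ?_) (Finset.card_union_le _ _)
    simp only [Finset.mem_filter, Finset.mem_univ, true_and, Finset.mem_union] at hi ⊢
    by_contra! hcon
    exact hi (by rw [hcon.1, hcon.2]; simp)
  have h2 : (Finset.univ.filter fun i => y i = k).card ≤
      (Finset.univ.filter fun i => s i ≠ τ₁ (y i)).card + e +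
        hammingDist s (fun i => τ (yt i)) := by
    rw [hammingDist_eq_card]
    refine le_trans (Finset.card_le_card fun i hi => ?_)
      ((Finset.card_union_le _ _).trans (Nat.add_le_add_right (Finset.card_union_le _ _) _))
    simp only [Finset.mem_filter, Finset.mem_univ, true_and, Finset.mem_union] at hi ⊢
    by_contra! hcon
    obtain ⟨⟨h3, h4⟩, h5⟩ := hcon
    rw [h3, h4, hi] at h5
    exact hne h5.symm
  have h3 := h (τ₂.symm.trans τ₁)
  have h4 : ((Finset.univ.filter fun i => y i = k).card : ℝ) ≤
      ((Finset.univ.filter fun i => s i ≠ τ₁ (y i)).card : ℝ) + e +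
        (((Finset.univ.filter fun i => s i ≠ τ₁ (y i)).card : ℝ) + e) := by
    exact_mod_cast h2.trans (Nat.add_le_add_left (h3.trans h1) _)
  linarith [hclass k]

theorem misclassError_nonneg {n : ℕ} (u v : Fin n → Fin K) : 0 ≤ misclassError u v :=
  mul_nonneg (by positivity) (Real.iInf_nonneg fun τ => by positivity)

theorem misclassError_le_hammingDist {n : ℕ} (u v : Fin n → Fin K) (τ : Equiv.Perm (Fin K)) :
    misclassError u v ≤ (n : ℝ)⁻¹ * hammingDist u (fun i => τ (v i)) := by
  unfold misclassError
  gcongr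
  exact ciInf_le ⟨0, by rintro _ ⟨τ, rfl⟩; positivity⟩ τ

theorem misclassError_le_one {n : ℕ} (u v : Fin n → Fin K) : misclassError u v ≤ 1 := by
  refine (misclassError_le_hammingDist u v 1).trans ?_
  rw [inv_mul_eq_div]
  refine div_le_one_of_le₀ ?_ (by positivity)
  have := hammingDist_le_card_fintype (x := u) (y := fun i => (1 : Equiv.Perm (Fin K)) (v i))
  rw [Fintype.card_fin] at this
  exact_mod_cast this

theorem inv_le_misclassError {n : ℕ} (u v : Fin n → Fin K) (h : misclassError u v ≠ 0) :
    (n : ℝ)⁻¹ ≤ misclassError u v := by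
  obtain ⟨τ, hτ⟩ := exists_eq_ciInf_of_finite
    (f := fun τ : Equiv.Perm (Fin K) => (hammingDist u (fun i => τ (v i)) : ℝ))
  unfold misclassError at h ⊢
  rw [← hτ] at h ⊢
  have h1 : hammingDist u (fun i => τ (v i)) ≠ 0 := fun h0 => h (by rw [h0]; simp)
  refine le_mul_of_one_le_right (by positivity) ?_
  exact_mod_cast Nat.one_le_iff_ne_zero.2 h1

/-- Deterministic error bound for the aligned output: either the alignment is correct, or the number
of classification errors is of the order of the sample size. -/
theorem misclassError_append_le {s yt₁ yt₂ : Fin m → Fin K} {y : Fin (m + m) → Fin K}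
    {τ τ₁ τ₂ : Equiv.Perm (Fin K)} (hm : 0 < m) (h : IsAlignment s yt₁ τ) {κ : ℝ} (hκ : 0 < κ)
    (hclass : ∀ k, κ * m ≤ ((Finset.univ.filter fun i => y (Fin.castAdd m i) = k).card : ℝ))
    (hs : ((Finset.univ.filter fun i => s i ≠ τ₁ (y (Fin.castAdd m i))).card : ℝ) ≤ κ / 4 * m) :
    misclassError (Fin.append (fun i => τ (yt₁ i)) yt₂) y ≤ (1 + 8 / κ) * ((m + m : ℕ) : ℝ)⁻¹ *
      (((Finset.univ.filter fun i => yt₁ i ≠ τ₂ (y (Fin.castAdd m i))).card : ℝ) +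
        (Finset.univ.filter fun i => yt₂ i ≠ τ₁ (y (Fin.natAdd m i))).card) := by
  have hm' : (0 : ℝ) < m := by exact_mod_cast hm
  set e₁ := (Finset.univ.filter fun i => yt₁ i ≠ τ₂ (y (Fin.castAdd m i))).card with he₁
  set e₂ := (Finset.univ.filter fun i => yt₂ i ≠ τ₁ (y (Fin.natAdd m i))).card with he₂
  by_cases hlt : 2 * (κ / 4 * m + (e₁ : ℝ)) < κ * m
  · have hτ := h.eq hclass hs hlt
    have hham : hammingDist (Fin.append (fun i => τ (yt₁ i)) yt₂) (fun i => τ₁ (y i)) = e₁ + e₂ := by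
      rw [hammingDist_eq_card, Finset.card_filter, Fin.sum_univ_add, he₁, he₂, Finset.card_filter,
        Finset.card_filter]
      congr 1
      · refine Finset.sum_congr rfl fun i _ => ?_
        simp only [Fin.append_left, ← hτ, ne_eq, EmbeddingLike.apply_eq_iff_eq]
      · refine Finset.sum_congr rfl fun i _ => ?_
        simp only [Fin.append_right]
    refine (misclassError_le_hammingDist _ _ τ₁).trans ?_
    rw [hham]
    have : 0 ≤ 8 / κ := by positivity
    calc (((m + m : ℕ) : ℝ))⁻¹ * ((e₁ + e₂ : ℕ) : ℝ)
        ≤ (1 + 8 / κ) * ((((m + m : ℕ) : ℝ))⁻¹ * ((e₁ + e₂ : ℕ) : ℝ)) :=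
          le_mul_of_one_le_left (by positivity) (by linarith)
      _ = _ := by push_cast; ring
  · refine (misclassError_le_one _ _).trans ?_
    have h1 : κ / 4 * m ≤ e₁ := by linarith
    have h2 : (1 : ℝ) ≤ 8 / κ * (((m + m : ℕ) : ℝ))⁻¹ * e₁ := by
      calc (1 : ℝ) = 8 / κ * (((m + m : ℕ) : ℝ))⁻¹ * (κ / 4 * m) := by
            push_cast; field_simp; norm_num
        _ ≤ _ := by gcongr
    have h3 : 0 ≤ (((m + m : ℕ) : ℝ))⁻¹ * (e₁ : ℝ) := by positivity
    have h4 : 0 ≤ (1 + 8 / κ) * (((m + m : ℕ) : ℝ))⁻¹ * (e₂ : ℝ) := by positivity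
    nlinarith

end Alignment

section ErrorBound

/-- The observation `μ_k + Σ^{1/2} u`. -/
noncomputable def MixtureModel.observe {d K : ℕ} (θ : MixtureModel d K) (k : Fin K) (u : EucSp d) :
    EucSp d :=
  θ.center k + Matrix.toEuclideanCLM (𝕜 := ℝ) (CFC.sqrt θ.cov) u

theorem MixtureModel.measurable_observe {d K : ℕ} (θ : MixtureModel d K) :
    Measurable fun q : Fin K × EucSp d => θ.observe q.1 q.2 :=
  ((measurable_of_countable θ.center).comp measurable_fst).add
    ((ContinuousLinearMap.measurable _).comp measurable_snd)

/-- The event that the noise `u` has a non-negligible component along a slope of norm at most `√v`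
of the classifier trained on `x`. -/
def SlopeError {d K m : ℕ} (v : ℝ) (S : Matrix (Fin d) (Fin d) ℝ)
    (solver : (Fin m → EucSp d) → Fin m → Fin K) (x : Fin m → EucSp d) (u : EucSp d) : Prop :=
  ∃ l, ‖trainedSlope S x (solver x) l‖ ^ 2 ≤ v ∧
    1 / 16 < |inner ℝ (trainedSlope S x (solver x) l) u|

variable {d K m : ℕ} {Ω ι : Type*} [MeasurableSpace Ω] {P : Measure Ω} [IsProbabilityMeasure P]
  {θ : MixtureModel d K} {y : ι → Ω → Fin K} {z : ι → Ω → EucSp d}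

theorem measurable_slope_sample {θ : MixtureModel d K} {y : Fin m → Ω → Fin K}
    {z : Fin m → Ω → EucSp d} (hy : ∀ i, Measurable (y i)) (hz : ∀ i, Measurable (z i))
    {solver : (Fin m → EucSp d) → Fin m → Fin K} (hs : Measurable solver) (l : Fin K) :
    Measurable fun ω => trainedSlope θ.cov (fun i => θ.observe (y i ω) (z i ω))
      (solver fun i => θ.observe (y i ω) (z i ω)) l :=
  (measurable_trainedSlope_solver θ.cov hs l).comp
    (measurable_pi_lambda _ fun i => θ.measurable_observe.comp ((hy i).prodMk (hz i)))

theorem IsNoiseSample.measurableSet_slopeError {P : Measure Ω} (h : IsNoiseSample θ P y z)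
    (f : Fin m → ι) (i₀ : ι)
    {solver : (Fin m → EucSp d) → Fin m → Fin K} (hs : Measurable solver) (v : ℝ) :
    MeasurableSet {ω | SlopeError v θ.cov solver (fun i => θ.observe (y (f i) ω) (z (f i) ω))
      (z i₀ ω)} := by
  have heq : {ω | SlopeError v θ.cov solver (fun i => θ.observe (y (f i) ω) (z (f i) ω))
      (z i₀ ω)} = ⋃ l, ({ω | ‖trainedSlope θ.cov (fun i => θ.observe (y (f i) ω) (z (f i) ω))
        (solver fun i => θ.observe (y (f i) ω) (z (f i) ω)) l‖ ^ 2 ≤ v} ∩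
        {ω | 1 / 16 < |inner ℝ (trainedSlope θ.cov (fun i => θ.observe (y (f i) ω) (z (f i) ω))
          (solver fun i => θ.observe (y (f i) ω) (z (f i) ω)) l) (z i₀ ω)|}) := by
    ext ω; simp [SlopeError]
  rw [heq]
  refine MeasurableSet.iUnion fun l => ?_
  have hm := measurable_slope_sample (θ := θ) (fun i => h.measurable_label (f i))
    (fun i => h.measurable_noise (f i)) hs l
  have hz := h.measurable_noise i₀
  exact (measurableSet_le (hm.norm.pow_const 2) measurable_const).inter
    (measurableSet_lt measurable_const (hm.inner hz).abs)

theorem IsNoiseSample.measureReal_slopeError_le {σ : ℝ} (hσ : 0 < σ) (hT2 : IsT2 σ θ.noise)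
    (h : IsNoiseSample θ P y z) {f : Fin m → ι} {i₀ : ι} (hf : ∀ i, f i ≠ i₀)
    {solver : (Fin m → EucSp d) → Fin m → Fin K} (hs : Measurable solver) (v : ℝ) :
    P.real {ω | SlopeError v θ.cov solver (fun i => θ.observe (y (f i) ω) (z (f i) ω))
      (z i₀ ω)} ≤ K * (2 * Real.exp (-((1 / 16) ^ 2 / (2 * σ ^ 2 * v)))) := by
  have heq : {ω | SlopeError v θ.cov solver (fun i => θ.observe (y (f i) ω) (z (f i) ω))
      (z i₀ ω)} = ⋃ l ∈ (Finset.univ : Finset (Fin K)),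
        {ω | ‖trainedSlope θ.cov (fun i => θ.observe (y (f i) ω) (z (f i) ω))
        (solver fun i => θ.observe (y (f i) ω) (z (f i) ω)) l‖ ^ 2 ≤ v ∧
         1 / 16 < |inner ℝ (trainedSlope θ.cov (fun i => θ.observe (y (f i) ω) (z (f i) ω))
          (solver fun i => θ.observe (y (f i) ω) (z (f i) ω)) l) (z i₀ ω)|} := by
    ext ω; simp [SlopeError]
  rw [heq]
  refine (measureReal_biUnion_finset_le _ _).trans ?_
  calc _ ≤ ∑ _l : Fin K, 2 * Real.exp (-((1 / 16) ^ 2 / (2 * σ ^ 2 * v))) := by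
        refine Finset.sum_le_sum fun l _ => ?_
        have hind := (h.indepFun_tuple hf).comp
          (φ := fun g : Fin m → Fin K × EucSp d =>
            trainedSlope θ.cov (fun i => θ.observe (g i).1 (g i).2)
              (solver fun i => θ.observe (g i).1 (g i).2) l) (ψ := id)
          (measurable_slope_sample (θ := θ)
            (y := fun i (g : Fin m → Fin K × EucSp d) => (g i).1) (z := fun i g => (g i).2)
            (fun i => measurable_fst.comp (measurable_pi_apply i))
            (fun i => measurable_snd.comp (measurable_pi_apply i)) hs l) measurable_id
        exact measureReal_inner_gt_le hσ (by norm_num) hT2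
          (measurable_slope_sample (θ := θ) (fun i => h.measurable_label (f i))
            (fun i => h.measurable_noise (f i)) hs l) (h.measurable_noise i₀) (h.noise_law i₀) hind
    _ = _ := by simp

/-- The threshold conditions under which the training step succeeds. -/
theorem exists_training_threshold {κ C : ℝ} (hκ : 0 < κ) (hC : 0 < C) (K₀ : ℕ) :
    ∃ R₀ : ℝ, ∀ {K : ℕ} {R : ℝ}, 1 ≤ K → K ≤ K₀ → 0 < R → R₀ ≤ R →
      ∀ E : ℝ, E = C * (K₀ + 1) ^ 2 / (κ * R ^ 2) →
      C * K ^ 2 / (κ * R ^ 2) ≤ E ∧ E ≤ 1 / 4 ∧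
      2 * (1 + C / κ) / κ * E ≤ (1 / (16 * K)) ^ 2 ∧
      E * (1 + 2 * (2 * (1 + C / κ) / κ) + 2 * (C / κ)) < 1 / 2 ∧
      4 * K * (1 + C / κ) * E ≤ κ / 4 := by
  set L : ℝ := K₀ + 1 with hL
  have hL0 : 0 < L := by positivity
  set G := 2 * (1 + C / κ) / κ with hG
  have hG0 : 0 < G := by positivity
  set e₀ : ℝ := min (1 / 4) (min ((1 / (16 * L)) ^ 2 / G)
    (min (1 / (4 * (1 + 2 * G + 2 * (C / κ)))) (κ / 4 / (4 * L * (1 + C / κ))))) with he₀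
  have he : 0 < e₀ := by positivity
  refine ⟨√(C * L ^ 2 / (κ * e₀)), ?_⟩
  intro K R hK1 hK hR0 hR E hE
  have hKL : (K : ℝ) ≤ L := by
    have : (K : ℝ) ≤ K₀ := by exact_mod_cast hK
    linarith
  have hK' : (0 : ℝ) < K := by exact_mod_cast hK1
  have hEe : E ≤ e₀ := by
    have h1 := (Real.sqrt_le_left hR0.le).1 hR
    rw [div_le_iff₀ (by positivity)] at h1
    rw [hE, div_le_iff₀ (by positivity)]
    linarith
  have hE0 : 0 < E := by rw [hE]; positivity
  refine ⟨?_, hEe.trans (min_le_left _ _), ?_, ?_, ?_⟩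
  · rw [hE]; gcongr
  · have h1 : E ≤ (1 / (16 * L)) ^ 2 / G :=
      hEe.trans ((min_le_right _ _).trans (min_le_left _ _))
    rw [le_div_iff₀ hG0] at h1
    calc G * E = E * G := mul_comm _ _
      _ ≤ (1 / (16 * L)) ^ 2 := h1
      _ ≤ _ := by gcongr
  · have h1 : E ≤ 1 / (4 * (1 + 2 * G + 2 * (C / κ))) :=
      hEe.trans ((min_le_right _ _).trans ((min_le_right _ _).trans (min_le_left _ _)))
    rw [le_div_iff₀ (by positivity)] at h1
    linarith
  · have h1 : E ≤ κ / 4 / (4 * L * (1 + C / κ)) :=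
      hEe.trans ((min_le_right _ _).trans ((min_le_right _ _).trans (min_le_right _ _)))
    rw [le_div_iff₀ (by positivity)] at h1
    calc 4 * K * (1 + C / κ) * E ≤ 4 * L * (1 + C / κ) * E := by gcongr
      _ ≤ _ := by linarith

theorem card_filter_le_sum_indicator {α : Type*} {q : Fin m → Prop} [DecidablePred q]
    {F : Fin m → Set α} {ω : α} (h : ∀ i, q i → ω ∈ F i) :
    ((Finset.univ.filter q).card : ℝ) ≤ ∑ i, (F i).indicator (fun _ => (1 : ℝ)) ω := by
  calc ((Finset.univ.filter q).card : ℝ) = ∑ i, if q i then (1 : ℝ) else 0 := by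
        rw [← Finset.sum_filter]; simp
    _ ≤ _ := Finset.sum_le_sum fun i _ => by
        split_ifs with hq
        · rw [Set.indicator_of_mem (h i hq)]
        · exact Set.indicator_nonneg (fun _ _ => zero_le_one) _

/-- On two good halves, the error of the cross-validated output is controlled by the number of
points with a non-negligible noise component along the slopes trained on the other half. -/
theorem misclassError_le_of_goodSample {κ C E R : ℝ} (hκ : 0 < κ) (hC : 0 < C) (hm : 0 < m)
    (hK : 2 ≤ K) (hθ : θ.SignalStrength R) {y : Fin (m + m) → Fin K} {z : Fin (m + m) → EucSp d}
    (hG₁ : GoodSample κ C (fun i => y (Fin.castAdd m i)) fun i => z (Fin.castAdd m i))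
    (hG₂ : GoodSample κ C (fun i => y (Fin.natAdd m i)) fun i => z (Fin.natAdd m i))
    {solver₁ solver₂ : (Fin m → EucSp d) → Fin m → Fin K}
    (hs₁ : IsWhitenedKMeansSolver solver₁) (hs₂ : IsWhitenedKMeansSolver solver₂)
    {yhat : Fin (m + m) → Fin K}
    (hout : IsCVKMeansOutput solver₁ solver₂ (fun i => θ.observe (y i) (z i)) yhat)
    (hE : C * K ^ 2 / (κ * R ^ 2) ≤ E)
    (hE0 : E ≤ 1 / 4) (hE1 : 2 * (1 + C / κ) / κ * E ≤ (1 / (16 * K)) ^ 2)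
    (hE2 : E * (1 + 2 * (2 * (1 + C / κ) / κ) + 2 * (C / κ)) < 1 / 2)
    (hE3 : 4 * K * (1 + C / κ) * E ≤ κ / 4) {α : Type*} {F₁ F₂ : Fin m → Set α}
    {ω : α}
    (hF₁ : ∀ i, SlopeError (E / κ) θ.cov solver₂
      (fun i => θ.observe (y (Fin.natAdd m i)) (z (Fin.natAdd m i))) (z (Fin.castAdd m i)) →
      ω ∈ F₁ i)
    (hF₂ : ∀ i, SlopeError (E / κ) θ.cov solver₁
      (fun i => θ.observe (y (Fin.castAdd m i)) (z (Fin.castAdd m i))) (z (Fin.natAdd m i)) →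
      ω ∈ F₂ i) :
    misclassError yhat y ≤ (1 + 8 / κ) * ((m + m : ℕ) : ℝ)⁻¹ *
      (∑ i, (F₁ i).indicator (fun _ => (1 : ℝ)) ω +
        ∑ i, (F₂ i).indicator (fun _ => (1 : ℝ)) ω) := by
  obtain ⟨yt₁, yt₂, τ, hp₁, hp₂, hal, rfl⟩ := hout
  obtain ⟨τ₁, hn₁, hc₁, hcard⟩ := hG₁.training hκ hC.le hm hK hθ (fun _ => rfl)
    (hs₁.2 _) hE hE0 hE1 hE2
  obtain ⟨τ₂, hn₂, hc₂, -⟩ := hG₂.training hκ hC.le hm hK hθ (fun _ => rfl)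
    (hs₂.2 _) hE hE0 hE1 hE2
  have h := misclassError_append_le (τ₂ := τ₂) (yt₂ := yt₂) hm hal hκ hG₁.le_card
    (hcard.trans (by gcongr))
  refine h.trans ?_
  gcongr
  · refine card_filter_le_sum_indicator fun i hi => hF₁ i ?_
    by_contra hne
    refine hi (hc₂ _ _ _ (fun l => ?_) (hp₁ i))
    by_contra! hlt
    exact hne ⟨l, hn₂ l, hlt⟩
  · refine card_filter_le_sum_indicator fun i hi => hF₂ i ?_
    by_contra hne
    refine hi (hc₁ _ _ _ (fun l => ?_) (hp₂ i))
    by_contra! hlt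
    exact hne ⟨l, hn₁ l, hlt⟩

theorem measurable_misclassError {n : ℕ} {yhat : Ω → Fin n → Fin K} {y : Fin n → Ω → Fin K}
    (hyhat : Measurable yhat) (hy : ∀ i, Measurable (y i)) :
    Measurable fun ω => misclassError (yhat ω) fun i => y i ω := by
  have hy' : Measurable fun ω i => y i ω := measurable_pi_lambda _ hy
  exact measurable_apply_countable (F := fun ω v => misclassError (yhat ω) v)
    (fun v => (measurable_of_countable fun u => misclassError u v).comp hyhat) hy'

theorem integrable_misclassError {n : ℕ} {yhat : Ω → Fin n → Fin K} {y : Fin n → Ω → Fin K}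
    (hyhat : Measurable yhat) (hy : ∀ i, Measurable (y i)) :
    Integrable (fun ω => misclassError (yhat ω) fun i => y i ω) P := by
  refine Integrable.of_bound (C := 1) (measurable_misclassError hyhat hy).aestronglyMeasurable
    (ae_of_all _ fun ω => ?_)
  rw [Real.norm_of_nonneg (misclassError_nonneg _ _)]
  exact misclassError_le_one _ _

end ErrorBound

theorem exists_integral_misclassError_le {σ p : ℝ} (hσ : 0 < σ) (hp : 0 < p) (K₀ : ℕ) :
    ∃ c C₀ B γ R₀ : ℝ, 0 < c ∧ 0 < C₀ ∧ 1 ≤ B ∧ 0 < γ ∧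
      ∀ {d K m : ℕ} {Ω : Type*} [MeasurableSpace Ω] {P : Measure Ω} [IsProbabilityMeasure P]
        {θ : MixtureModel d K} {R : ℝ} {y : Fin (m + m) → Ω → Fin K}
        {x : Fin (m + m) → Ω → EucSp d} {solver₁ solver₂ : (Fin m → EucSp d) → Fin m → Fin K}
        {yhat : Ω → Fin (m + m) → Fin K},
        0 < m → 2 ≤ K → K ≤ K₀ → IsMixtureSample θ P y x → IsT2 σ θ.noise →
        (∀ j, p ≤ θ.weight j) → θ.SignalStrength R → R₀ ≤ R →
        IsWhitenedKMeansSolver solver₁ → IsWhitenedKMeansSolver solver₂ → Measurable yhat →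
        (∀ᵐ ω ∂P, IsCVKMeansOutput solver₁ solver₂ (fun i => x i ω) (yhat ω)) →
        ∫ ω, misclassError (yhat ω) (fun i => y i ω) ∂P ≤
          C₀ * (Real.exp (-c * R ^ 2) + B ^ (d + 1) * Real.exp (-γ * m)) := by
  obtain ⟨κ, C, B, γ, hκ, hC, hB, hγ, hgood⟩ := exists_measureReal_not_goodSample_le hσ hp
  obtain ⟨R₀, hR₀⟩ := exists_training_threshold hκ hC K₀
  set L : ℝ := K₀ + 1 with hL
  have hL0 : 0 < L := by positivity
  refine ⟨κ ^ 2 / (512 * σ ^ 2 * C * L ^ 2), 2 * L * (1 + 8 / κ), B, γ, R₀, by positivity,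
    by positivity, hB, hγ, ?_⟩
  intro d K m Ω _ P _ θ R y x solver₁ solver₂ yhat hm hK hKK₀ hsample hT2 hw hθ hR hs₁ hs₂ hyhat hout
  have hR0 : 0 < R := hθ.2.1
  obtain ⟨z, hy, hz, hind, hyz, hlaw, hnoise, hx⟩ := hsample
  have hS : IsNoiseSample θ P y z := ⟨hy, hz, hind, hyz, hlaw, hnoise⟩
  set E : ℝ := C * L ^ 2 / (κ * R ^ 2) with hE
  obtain ⟨hE', hE0, hE1, hE2, hE3⟩ := hR₀ (by omega) hKK₀ hR0 hR E hE
  have hm' : (0 : ℝ) < m := by exact_mod_cast hm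
  have hKL : (K : ℝ) ≤ L := by
    have : (K : ℝ) ≤ K₀ := by exact_mod_cast hKK₀
    linarith
  have hS₁ := hS.comp (Fin.castAdd_injective m m)
  have hS₂ := hS.comp (Fin.natAdd_injective m m)
  set b₁ : Set Ω := {ω | ¬ GoodSample κ C (fun i => y (Fin.castAdd m i) ω)
    fun i => z (Fin.castAdd m i) ω} with hb₁
  set b₂ : Set Ω := {ω | ¬ GoodSample κ C (fun i => y (Fin.natAdd m i) ω)
    fun i => z (Fin.natAdd m i) ω} with hb₂
  have hPb₁ : P.real b₁ ≤ L * (B ^ (d + 1) * Real.exp (-γ * m)) := by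
    refine (hgood (by omega) hT2 hw hS₁).trans ?_
    rw [mul_assoc]; gcongr
  have hPb₂ : P.real b₂ ≤ L * (B ^ (d + 1) * Real.exp (-γ * m)) := by
    refine (hgood (by omega) hT2 hw hS₂).trans ?_
    rw [mul_assoc]; gcongr
  set bad := toMeasurable P (b₁ ∪ b₂) with hbad
  have hbadm : MeasurableSet bad := measurableSet_toMeasurable _ _
  have hPbad : P.real bad ≤ 2 * L * (B ^ (d + 1) * Real.exp (-γ * m)) := by
    rw [hbad, measureReal_def, measure_toMeasurable, ← measureReal_def]
    refine (measureReal_union_le _ _).trans ?_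
    linarith
  set F₁ : Fin m → Set Ω := fun i => {ω | SlopeError (E / κ) θ.cov solver₂
    (fun i => θ.observe (y (Fin.natAdd m i) ω) (z (Fin.natAdd m i) ω)) (z (Fin.castAdd m i) ω)}
    with hF₁
  set F₂ : Fin m → Set Ω := fun i => {ω | SlopeError (E / κ) θ.cov solver₁
    (fun i => θ.observe (y (Fin.castAdd m i) ω) (z (Fin.castAdd m i) ω)) (z (Fin.natAdd m i) ω)}
    with hF₂
  have hF₁m : ∀ i, MeasurableSet (F₁ i) := fun i =>
    hS.measurableSet_slopeError (Fin.natAdd m) (Fin.castAdd m i) hs₂.1 _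
  have hF₂m : ∀ i, MeasurableSet (F₂ i) := fun i =>
    hS.measurableSet_slopeError (Fin.castAdd m) (Fin.natAdd m i) hs₁.1 _
  have hne : ∀ i j : Fin m, Fin.natAdd m i ≠ Fin.castAdd m j := fun i j h => by
    have := congrArg Fin.val h
    simp only [Fin.val_natAdd, Fin.val_castAdd] at this
    omega
  set X : ℝ := Real.exp (-(κ ^ 2 / (512 * σ ^ 2 * C * L ^ 2)) * R ^ 2) with hX
  have hXeq : Real.exp (-((1 / 16) ^ 2 / (2 * σ ^ 2 * (E / κ)))) = X := by
    rw [hX, hE]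
    congr 1
    field_simp
    norm_num
  have hPF₁ : ∀ i, P.real (F₁ i) ≤ 2 * L * X := fun i => by
    refine (hS.measureReal_slopeError_le hσ hT2 (fun j => hne j i) hs₂.1 _).trans ?_
    rw [hXeq]
    calc K * (2 * X) ≤ L * (2 * X) := by gcongr
      _ = _ := by ring
  have hPF₂ : ∀ i, P.real (F₂ i) ≤ 2 * L * X := fun i => by
    refine (hS.measureReal_slopeError_le hσ hT2 (fun j => (hne i j).symm) hs₁.1 _).trans ?_
    rw [hXeq]
    calc K * (2 * X) ≤ L * (2 * X) := by gcongr
      _ = _ := by ring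
  set D : ℝ := (1 + 8 / κ) * ((m + m : ℕ) : ℝ)⁻¹ with hD
  have hD0 : 0 ≤ D := by positivity
  have hi1 : ∀ i, Integrable ((F₁ i).indicator fun _ => (1 : ℝ)) P := fun i =>
    (integrable_const _).indicator (hF₁m i)
  have hi2 : ∀ i, Integrable ((F₂ i).indicator fun _ => (1 : ℝ)) P := fun i =>
    (integrable_const _).indicator (hF₂m i)
  have hib : Integrable (bad.indicator fun _ => (1 : ℝ)) P := (integrable_const _).indicator hbadm
  have his1 : Integrable (fun ω => ∑ i, (F₁ i).indicator (fun _ => (1 : ℝ)) ω) P :=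
    integrable_finsetSum _ fun i _ => hi1 i
  have his2 : Integrable (fun ω => ∑ i, (F₂ i).indicator (fun _ => (1 : ℝ)) ω) P :=
    integrable_finsetSum _ fun i _ => hi2 i
  have hisum : Integrable (fun ω => ∑ i, (F₁ i).indicator (fun _ => (1 : ℝ)) ω +
      ∑ i, (F₂ i).indicator (fun _ => (1 : ℝ)) ω) P := his1.add his2
  have hpt : ∀ᵐ ω ∂P, misclassError (yhat ω) (fun i => y i ω) ≤
      bad.indicator (fun _ => (1 : ℝ)) ω + D * (∑ i, (F₁ i).indicator (fun _ => (1 : ℝ)) ω +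
        ∑ i, (F₂ i).indicator (fun _ => (1 : ℝ)) ω) := by
    filter_upwards [hout] with ω hω
    have hnn : 0 ≤ D * (∑ i, (F₁ i).indicator (fun _ => (1 : ℝ)) ω +
        ∑ i, (F₂ i).indicator (fun _ => (1 : ℝ)) ω) :=
      mul_nonneg hD0 (add_nonneg
        (Finset.sum_nonneg fun i _ => Set.indicator_nonneg (fun _ _ => zero_le_one) _)
        (Finset.sum_nonneg fun i _ => Set.indicator_nonneg (fun _ _ => zero_le_one) _))
    by_cases hωb : ω ∈ bad
    · rw [Set.indicator_of_mem hωb]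
      linarith [misclassError_le_one (yhat ω) fun i => y i ω]
    · rw [Set.indicator_of_notMem hωb, zero_add]
      have hωu : ω ∉ b₁ ∪ b₂ := fun h => hωb (subset_toMeasurable _ _ h)
      simp only [hb₁, hb₂, Set.mem_union, Set.mem_ofPred_eq, not_or, not_not] at hωu
      have hxω : (fun i => x i ω) = fun i => θ.observe (y i ω) (z i ω) := by
        funext i; exact hx i ω
      rw [hxω] at hω
      exact misclassError_le_of_goodSample hκ hC hm hK hθ hωu.1 hωu.2 hs₁ hs₂ hω hE' hE0 hE1 hE2 hE3
        (fun i h => h) (fun i h => h)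
  calc ∫ ω, misclassError (yhat ω) (fun i => y i ω) ∂P
      ≤ ∫ ω, (bad.indicator (fun _ => (1 : ℝ)) ω +
        D * (∑ i, (F₁ i).indicator (fun _ => (1 : ℝ)) ω +
        ∑ i, (F₂ i).indicator (fun _ => (1 : ℝ)) ω)) ∂P :=
        integral_mono_ae (integrable_misclassError hyhat hy) (hib.add (hisum.const_mul D)) hpt
    _ = P.real bad + D * (∑ i, P.real (F₁ i) + ∑ i, P.real (F₂ i)) := by
        rw [integral_add hib (hisum.const_mul D), integral_const_mul, integral_add his1 his2,
          integral_finsetSum _ fun i _ => hi1 i, integral_finsetSum _ fun i _ => hi2 i]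
        simp only [integral_indicator_const _ hbadm, integral_indicator_const _ (hF₁m _),
          integral_indicator_const _ (hF₂m _), smul_eq_mul, mul_one]
    _ ≤ 2 * L * (B ^ (d + 1) * Real.exp (-γ * m)) +
        D * (∑ _i : Fin m, 2 * L * X + ∑ _i : Fin m, 2 * L * X) := by
        gcongr
        · exact hPF₁ _
        · exact hPF₂ _
    _ = 2 * L * (B ^ (d + 1) * Real.exp (-γ * m)) + 2 * L * (1 + 8 / κ) * X := by
        rw [hD]
        simp only [Finset.sum_const, Finset.card_univ, Fintype.card_fin, nsmul_eq_mul]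
        push_cast
        field_simp
    _ ≤ 2 * L * (1 + 8 / κ) * (B ^ (d + 1) * Real.exp (-γ * m)) + 2 * L * (1 + 8 / κ) * X := by
        have h1 : (0 : ℝ) ≤ 2 * L * (8 / κ) * (B ^ (d + 1) * Real.exp (-γ * m)) := by positivity
        linarith
    _ = _ := by ring

theorem tendsto_natCast_add_self_atTop :
    Tendsto (fun m : ℕ => ((m + m : ℕ) : ℝ)) atTop atTop :=
  tendsto_natCast_atTop_atTop.comp (tendsto_id.atTop_add_atTop tendsto_id)

theorem eventually_geometric_mul_exp_le {B γ : ℝ} (hB : 1 ≤ B) (hγ : 0 < γ) {d : ℕ → ℕ}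
    (hd : Tendsto (fun m : ℕ => ((m + m : ℕ) : ℝ) / (d m * Real.log (m + m : ℕ) ^ 2))
      atTop atTop) :
    ∀ᶠ m : ℕ in atTop,
      B ^ (d m + 1) * Real.exp (-γ * m) ≤ (((m + m : ℕ) : ℝ) ^ 10)⁻¹ := by
  have hlogB : 0 ≤ Real.log B := Real.log_nonneg hB
  have hm2 := tendsto_natCast_add_self_atTop
  have hlog : ∀ᶠ m : ℕ in atTop, 1 ≤ Real.log (m + m : ℕ) :=
    (Real.tendsto_log_atTop.comp hm2).eventually_ge_atTop 1
  have hlog' : ∀ᶠ m : ℕ in atTop,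
      ‖Real.log (m + m : ℕ)‖ ≤ γ / 40 * ‖((m + m : ℕ) : ℝ)‖ :=
    hm2.eventually (Real.isLittleO_log_id_atTop.bound (by positivity : 0 < γ / 40))
  filter_upwards [hlog, hlog', hd.eventually_ge_atTop (8 * Real.log B / γ + 1),
    eventually_gt_atTop 0] with m h1 h2 h3 hm
  have hn : (0 : ℝ) < (m + m : ℕ) := by positivity
  have hd0 : (1 : ℝ) ≤ d m := by
    rcases Nat.eq_zero_or_pos (d m) with h | h
    · rw [h] at h3
      simp only [Nat.cast_zero, zero_mul, div_zero] at h3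
      have : 0 ≤ 8 * Real.log B / γ := by positivity
      linarith
    · exact_mod_cast h
  have hsq : (1 : ℝ) ≤ Real.log (m + m : ℕ) ^ 2 := one_le_pow₀ h1
  rw [le_div_iff₀ (by positivity)] at h3
  have h4 : (8 * Real.log B / γ) * d m ≤ (m + m : ℕ) := by
    refine le_trans ?_ h3
    have : (0 : ℝ) ≤ 8 * Real.log B / γ := by positivity
    calc 8 * Real.log B / γ * d m = (8 * Real.log B / γ) * (d m * 1) := by ring
      _ ≤ _ := by gcongr; linarith
  have h5 : 8 * Real.log B * d m ≤ γ * (m + m : ℕ) := by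
    have := mul_le_mul_of_nonneg_left h4 hγ.le
    calc 8 * Real.log B * d m = γ * (8 * Real.log B / γ * d m) := by field_simp
      _ ≤ _ := this
  rw [Real.norm_of_nonneg (by linarith), Real.norm_of_nonneg hn.le] at h2
  have h6 : Real.log B ≤ Real.log B * d m := le_mul_of_one_le_right hlogB hd0
  have hB0 : 0 < B := by linarith
  rw [← Real.exp_log (show 0 < B ^ (d m + 1) by positivity),
    ← Real.exp_log (show 0 < (((m + m : ℕ) : ℝ) ^ 10)⁻¹ by positivity), ← Real.exp_add,
    Real.exp_le_exp, Real.log_inv, Real.log_pow, Real.log_pow]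
  push_cast at h5 h2 ⊢
  nlinarith

theorem exp_neg_le_rpow_neg {c R n a : ℝ} (hc : 0 < c) (hn : 0 < n)
    (h : √(a * c⁻¹ * Real.log n) ≤ R) : Real.exp (-c * R ^ 2) ≤ n ^ (-a) := by
  have h1 : a * c⁻¹ * Real.log n ≤ R ^ 2 := Real.sqrt_le_iff.1 h |>.2
  rw [Real.rpow_def_of_pos hn, Real.exp_le_exp]
  have h2 := mul_le_mul_of_nonneg_left h1 hc.le
  have h3 : c * (a * c⁻¹ * Real.log n) = a * Real.log n := by field_simp
  linarith

theorem inv_pow_le_exp_neg {c R n : ℝ} (hc : 0 < c) (hR : 0 ≤ R) (hn : 1 ≤ n)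
    (h : R ≤ √(c⁻¹ * Real.log n)) : (n ^ 10)⁻¹ ≤ Real.exp (-c * R ^ 2) := by
  have hlog : 0 ≤ Real.log n := Real.log_nonneg hn
  have h1 : R ^ 2 ≤ c⁻¹ * Real.log n :=
    (Real.le_sqrt hR (by positivity)).1 h
  have h2 := mul_le_mul_of_nonneg_left h1 hc.le
  rw [mul_inv_cancel_left₀ hc.ne'] at h2
  have hn0 : 0 < n := by linarith
  rw [← Real.exp_log (show 0 < (n ^ 10)⁻¹ by positivity), Real.exp_le_exp, Real.log_inv,
    Real.log_pow]
  push_cast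
  linarith

theorem one_sub_mul_integral_misclassError_le {K n : ℕ} {Ω : Type*} [MeasurableSpace Ω]
    {P : Measure Ω} [IsProbabilityMeasure P] {yhat : Ω → Fin n → Fin K}
    {y : Fin n → Ω → Fin K} (hyhat : Measurable yhat) (hy : ∀ i, Measurable (y i)) (hn : 0 < n) :
    1 - n * ∫ ω, misclassError (yhat ω) (fun i => y i ω) ∂P ≤
      P.real {ω | misclassError (yhat ω) (fun i => y i ω) = 0} := by
  have hms : MeasurableSet {ω | misclassError (yhat ω) (fun i => y i ω) = 0} :=
    measurable_misclassError hyhat hy (measurableSet_singleton 0)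
  have hn' : (0 : ℝ) < n := by exact_mod_cast hn
  have h1 := mul_meas_ge_le_integral_of_nonneg (μ := P)
    (ae_of_all _ fun ω => misclassError_nonneg (yhat ω) fun i => y i ω)
    (integrable_misclassError hyhat hy) (n : ℝ)⁻¹
  have h2 : P.real {ω | misclassError (yhat ω) (fun i => y i ω) = 0}ᶜ ≤
      P.real {ω | (n : ℝ)⁻¹ ≤ misclassError (yhat ω) (fun i => y i ω)} :=
    measureReal_mono fun ω hω => inv_le_misclassError _ _ hω
  rw [probReal_compl_eq_one_sub hms] at h2
  rw [inv_mul_le_iff₀ hn'] at h1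
  linarith

theorem mainTheorem2 (σ : ℝ) (hσ : 0 < σ) (K₀ : ℕ) (p : ℝ) (hp : 0 < p) :
    ∃ c : ℝ, 0 < c ∧ ∃ C : ℝ, 0 < C ∧
      ∀ (d K : ℕ → ℕ) (R : ℕ → ℝ) (θ : ∀ m, MixtureModel (d m) (K m))
        (Ω : ℕ → Type*) [∀ m, MeasurableSpace (Ω m)]
        (P : ∀ m, Measure (Ω m)) [∀ m, IsProbabilityMeasure (P m)]
        (y : ∀ m, Fin (m + m) → Ω m → Fin (K m))
        (x : ∀ m, Fin (m + m) → Ω m → EucSp (d m))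
        (solver₁ solver₂ : ∀ m, (Fin m → EucSp (d m)) → Fin m → Fin (K m))
        (yhat : ∀ m, Ω m → Fin (m + m) → Fin (K m)),
        (∀ m, 2 ≤ K m) →
        (∀ m, IsMixtureSample (θ m) (P m) (y m) (x m)) →
        (∀ m, IsT2 σ (θ m).noise) →
        (∀ m, K m ≤ K₀) →
        (∀ m j, p ≤ (θ m).weight j) →
        (∀ m, (θ m).SignalStrength (R m)) →
        Tendsto R atTop atTop →
        Tendsto (fun m : ℕ => ((m + m : ℕ) : ℝ) / (d m * Real.log (m + m : ℕ) ^ 2))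
          atTop atTop →
        (∀ m, IsWhitenedKMeansSolver (solver₁ m)) →
        (∀ m, IsWhitenedKMeansSolver (solver₂ m)) →
        (∀ m, Measurable (yhat m)) →
        (∀ m, ∀ᵐ ω ∂(P m),
          IsCVKMeansOutput (solver₁ m) (solver₂ m) (fun i => x m i ω) (yhat m ω)) →
        (∃ N : ℕ, ∀ m : ℕ, N < m + m →
          ∫ ω, misclassError (yhat m ω) (fun i => y m i ω) ∂(P m) ≤
            C * (Real.exp (-c * R m ^ 2) + (((m + m : ℕ) : ℝ) ^ 10)⁻¹)) ∧
        ((∀ᶠ m : ℕ in atTop, R m ≤ √(c⁻¹ * Real.log (m + m : ℕ))) →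
          ∃ N : ℕ, ∀ m : ℕ, N < m + m →
            ∫ ω, misclassError (yhat m ω) (fun i => y m i ω) ∂(P m) ≤
              C * Real.exp (-c * R m ^ 2)) ∧
        (∀ ε : ℝ, 0 < ε →
          (∀ᶠ m : ℕ in atTop, √((1 + ε) * c⁻¹ * Real.log (m + m : ℕ)) ≤ R m) →
          Tendsto (fun m => (P m).real {ω | misclassError (yhat m ω) (fun i => y m i ω) = 0})
            atTop (𝓝 1)) := by
  obtain ⟨c, C₀, B, γ, R₀, hc, hC₀, hB, hγ, hbound⟩ := exists_integral_misclassError_le hσ hp K₀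
  refine ⟨c, hc, 2 * C₀, by positivity, ?_⟩
  intro d K R θ Ω _ P _ y x solver₁ solver₂ yhat hK hsample hT2 hK₀ hw hθ hR hd hs₁ hs₂ hyhat hout
  have hy : ∀ m i, Measurable (y m i) := fun m => by
    obtain ⟨z, h, -⟩ := hsample m
    exact h
  have hm2 := tendsto_natCast_add_self_atTop
  have hmain : ∀ᶠ m : ℕ in atTop,
      ∫ ω, misclassError (yhat m ω) (fun i => y m i ω) ∂(P m) ≤
        C₀ * (Real.exp (-c * R m ^ 2) + (((m + m : ℕ) : ℝ) ^ 10)⁻¹) := by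
    filter_upwards [hR.eventually_ge_atTop R₀, eventually_gt_atTop 0,
      eventually_geometric_mul_exp_le hB hγ hd] with m hRm hm hexp
    refine (hbound hm (hK m) (hK₀ m) (hsample m) (hT2 m) (hw m) (hθ m) hRm (hs₁ m) (hs₂ m)
      (hyhat m) (hout m)).trans ?_
    gcongr
  have hN : ∀ {q : ℕ → Prop}, (∀ᶠ m in atTop, q m) → ∃ N : ℕ, ∀ m : ℕ, N < m + m → q m := by
    intro q hq
    obtain ⟨N, hN⟩ := eventually_atTop.1 hq
    exact ⟨N + N, fun m hm => hN m (by omega)⟩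
  refine ⟨hN ?_, fun hsmall => hN ?_, fun ε hε hlarge => ?_⟩
  · filter_upwards [hmain] with m hm
    refine hm.trans ?_
    gcongr
    linarith
  · filter_upwards [hmain, hsmall, hm2.eventually_ge_atTop 1] with m hm hRm hm1
    have h := inv_pow_le_exp_neg hc (hθ m).2.1.le hm1 hRm
    calc _ ≤ _ := hm
      _ ≤ C₀ * (Real.exp (-c * R m ^ 2) + Real.exp (-c * R m ^ 2)) := by gcongr
      _ = _ := by ring
  · have hlim : Tendsto (fun m : ℕ => 1 - C₀ * (((m + m : ℕ) : ℝ) ^ (-ε) +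
        ((m + m : ℕ) : ℝ) ^ (-9 : ℝ))) atTop (𝓝 1) := by
      have h1 := (tendsto_rpow_neg_atTop hε).comp hm2
      have h2 := (tendsto_rpow_neg_atTop (show (0 : ℝ) < 9 by norm_num)).comp hm2
      simpa using ((h1.add h2).const_mul C₀).const_sub 1
    refine tendsto_of_tendsto_of_tendsto_of_le_of_le' hlim tendsto_const_nhds ?_
      (Eventually.of_forall fun m => measureReal_le_one)
    filter_upwards [hmain, hlarge, eventually_gt_atTop 0] with m hm hRm hm0
    have hn : (0 : ℝ) < (m + m : ℕ) := by positivity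
    refine le_trans ?_
      (one_sub_mul_integral_misclassError_le (hyhat m) (hy m) (by omega : 0 < m + m))
    have hexp := exp_neg_le_rpow_neg hc hn hRm
    have h1 : ((m + m : ℕ) : ℝ) * ((m + m : ℕ) : ℝ) ^ (-(1 + ε)) = ((m + m : ℕ) : ℝ) ^ (-ε) := by
      rw [← Real.rpow_one_add' hn.le (by linarith)]
      congr 1
      ring
    have h2 : ((m + m : ℕ) : ℝ) * (((m + m : ℕ) : ℝ) ^ 10)⁻¹ = ((m + m : ℕ) : ℝ) ^ (-9 : ℝ) := by
      rw [Real.rpow_neg hn.le]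
      norm_cast
      push_cast
      field_simp
    rw [← h1, ← h2]
    have h3 := mul_le_mul_of_nonneg_left
      (hm.trans (mul_le_mul_of_nonneg_left (add_le_add_left hexp _) hC₀.le)) hn.le
    linarith
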